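/- **Setting.** An instance $(G,L)$ consists of a finite simple graph $G=(V,E)$, embedded in the sense that the clockwise cyclic order of the edges around every vertex is given, and a finite set $L$ of lines, i.e. simple undirected paths in $G$ with at least one edge (directions chosen for the lines below are auxiliary). The two end vertices of a line are its terminals, its other vertices are its intermediate stations; $L_{uv}$ is the set of lines through the edge $uv$. A *line layout* gives, for every edge $uv$, two orders $\pi_{uv}$, $\pi_{vu}$ of $L_{uv}$: the clockwise orders in which the lines are attached to the port of $u$ towards $v$, and to the port of $v$ towards $u$. Two lines cross on the edge $uv$ if they appear in the same order in $\pi_{uv}$ and $\pi_{vu}$; they cross in the vertex $u$ if they alternate in the cyclic concatenation of the orders $\pi_{uv}$ around $u$. A vertex crossing is unavoidable if it occurs in every line layout. A *solution* is a line layout without avoidable vertex crossings that satisfies the periphery condition: in every $\pi_{uv}$ the lines for which $u$ is an intermediate station are consecutive, all other lines being before or after them. Its cost is the number of (edge, pair of lines) crossings; unavoidable vertex crossings are not counted. MLCM-P asks for an optimal (minimum-cost) solution. The instance is *proper* if no line is a subpath of another line (regardless of direction). *Consistent directions* are directions of all lines such that on each edge all lines through it have the same direction. For a choice of one side (one end of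 the clockwise order) of every port as "top", the opposite one being "bottom", the *conflict graph* $G_{ab}$ of a proper instance is the following multigraph. Its vertices are $b$, $t$, and a vertex $l_u$ for every line $l$ and terminal $u$ of $l$. Consider a maximal common subpath $P$, with at least one edge, of two lines $l\neq l'$. If $P$ leads from a terminal $u$ of $l$, intermediate for $l'$, to a terminal $v$ of $l'$, intermediate for $l$, there is an edge $l_ul'_v$. If $P$ leads from a terminal $u$ of $l$, intermediate for $l'$, to a vertex $v$ that is intermediate for both lines, there is an edge $bl_u$ or $tl_u$: the former if, given the way in which the lines split at $v$, they do not cross on $P$ exactly when $l$ ends at the top side of its port at $u$; the latter if this happens exactly when $l$ ends at the bottom side. The tops are *aligned* if for each edge $l_ul'_v$ the top sides of the ports at both ends of $P$ lie on the same side of $P$. A $b$–$t$ cut is a partition of the vertices into $S_t\ni t$ and $S_b\ni b$; an edge is uncut if both its ends are in the same part; MIN-UNCUT asks for a $b$–$t$ cut with the minimum number of uncut edges. $G_{ab}$ is *almost bipartite* if deleting $b$ and $t$ leaves a bipartite graph. Let $F$ be the number of unavoidable edge crossings, i.e. of pairs of lines with a maximal common subpath with at least one edge, no terminal of the two lines on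 it, at whose ends they split such that their relative order has to change. **Theorem.** 1. There is one polynomial-time algorithm that computes an optimal solution of MLCM-P for every proper instance that admits consistent line directions or whose graph is a caterpillar (a tree with a path such that every vertex is on the path or adjacent to a vertex of it). 2. For a proper instance with consistent directions, call the beginning of the clockwise order $\pi_{uv}$ the top side of the port if $L_{uv}$ is directed from $u$ to $v$, and its end the top side otherwise. Then the tops are aligned, $G_{ab}$ is almost bipartite, and MIN-UNCUT on $G_{ab}$ solves the problem: (a) every solution is described by a $b$–$t$ cut with $l_u\in S_t$ if $l$ ends at the top side and $l_u\in S_b$ if it ends at the bottom side of its port at $u$ (a line end counts as either side if no line through that port has $u$ as an intermediate station), and for every such cut the number of crossings is at least $F$ plus the number of uncut edges; (b) for every $b$–$t$ cut with the minimum number of uncut edges there is an optimal solution whose number of crossings is exactly $F$ plus this number. 3. For every proper instance on a caterpillar there are top sides with the properties in 2. 4. Consistent line directions exist whenever $G$ is a path, and whenever the vertices can be placed such that all lines are strictly monotone in one fixed direction (as for left-to-right or upward trees). -/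

import Mathlib

/-!
Metro-line crossing minimization with periphery condition on embedded networks.
-/

namespace MetroLine

/-! ### A deterministic machine model with running times -/

/-- The data on which programs work: binary trees. -/
inductive Data : Type
  | nil : Data
  | cons : Data → Data → Data

/-- The number of nodes of a binary tree. -/
def Data.size : Data → ℕ
  | .nil => 1
  | .cons a b => a.size + b.size + 1

/-- Unary encoding of natural numbers. -/
def Data.ofNat : ℕ → Data
  | 0 => .nil
  | k + 1 => .cons .nil (Data.ofNat k)

/-- Encoding of lists. -/
def Data.ofList : List Data → Data
  | [] => .nil
  | a :: l => .cons a (Data.ofList l)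

/-- Programs of a small deterministic WHILE language over binary trees. -/
inductive Prog : Type
  | skip : Prog
  | nil : Prog
  | head : Prog
  | tail : Prog
  | pair : Prog → Prog → Prog
  | seq : Prog → Prog → Prog
  | cond : Prog → Prog → Prog → Prog
  | whileDo : Prog → Prog → Prog

/-- `Runs p x y t`: started on `x`, the program `p` halts with result `y` at total cost `t`.
Every instruction that is executed on a value `x` costs `x.size`, the number of nodes of `x` (so at
least one), in addition to the cost of the instructions that it calls. In particular a run of cost
`t` only ever handles trees with at most `t` nodes, so that up to a polynomial these costs agree with
the running times of Turing machines. -/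
inductive Runs : Prog → Data → Data → ℕ → Prop
  | skip (x : Data) : Runs .skip x x x.size
  | nil (x : Data) : Runs .nil x .nil x.size
  | head_nil : Runs .head .nil .nil Data.nil.size
  | head_cons (a b : Data) : Runs .head (.cons a b) a (Data.cons a b).size
  | tail_nil : Runs .tail .nil .nil Data.nil.size
  | tail_cons (a b : Data) : Runs .tail (.cons a b) b (Data.cons a b).size
  | pair {p q : Prog} {x y z : Data} {s t : ℕ} :
      Runs p x y s → Runs q x z t → Runs (.pair p q) x (.cons y z) (s + t + x.size)
  | seq {p q : Prog} {x y z : Data} {s t : ℕ} :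
      Runs p x y s → Runs q y z t → Runs (.seq p q) x z (s + t + x.size)
  | cond_nil {c p q : Prog} {x y : Data} {s t : ℕ} :
      Runs c x .nil s → Runs q x y t → Runs (.cond c p q) x y (s + t + x.size)
  | cond_cons {c p q : Prog} {x y a b : Data} {s t : ℕ} :
      Runs c x (.cons a b) s → Runs p x y t → Runs (.cond c p q) x y (s + t + x.size)
  | while_nil {c p : Prog} {x : Data} {s : ℕ} :
      Runs c x .nil s → Runs (.whileDo c p) x x (s + x.size)
  | while_cons {c p : Prog} {x y z a b : Data} {r s t : ℕ} :
      Runs c x (.cons a b) r → Runs p x y s → Runs (.whileDo c p) y z t →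
        Runs (.whileDo c p) x z (r + s + t + x.size)

/-! ### Networks, lines and layouts -/

/-- An instance: an embedded finite graph, where the embedding is given by the clockwise (cyclic)
order `rot u` of the neighbours of every vertex `u` (cut open at an arbitrary place), together with
finitely many lines, which are simple paths with at least one edge, given by their vertices. -/
structure Network where
  n : ℕ
  graph : SimpleGraph (Fin n)
  rot : Fin n → List (Fin n)
  nodup_rot : ∀ u, (rot u).Nodup
  mem_rot : ∀ u v, v ∈ rot u ↔ graph.Adj u v
  numLines : ℕ
  line : Fin numLines → List (Fin n)
  two_le_length : ∀ i, 2 ≤ (line i).length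
  nodup_line : ∀ i, (line i).Nodup
  isChain_line : ∀ i, (line i).IsChain graph.Adj

/-- `P` is a subpath of the path `l`; the direction does not matter. -/
def Subpath {α : Type} (P l : List α) : Prop :=
  P <:+: l ∨ P.reverse <:+: l

namespace Network

variable (I : Network)

/-- No line is a subpath of another line. -/
def IsProper : Prop :=
  ∀ i j, i ≠ j → ¬ Subpath (I.line i) (I.line j)

/-- The line `i` belongs to `L_e` for the edge `e = (u, v)`. -/
def Passes (i : Fin I.numLines) (u v : Fin I.n) : Prop :=
  Subpath [u, v] (I.line i)

/-- `u` is a terminal of the line `i`. -/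
def IsTerminal (i : Fin I.numLines) (u : Fin I.n) : Prop :=
  (I.line i).head? = some u ∨ (I.line i).getLast? = some u

/-- `u` is an intermediate station of the line `i`. -/
def IsIntermediate (i : Fin I.numLines) (u : Fin I.n) : Prop :=
  u ∈ I.line i ∧ ¬ I.IsTerminal i u

/-- Line orders `π u v` for all ports; `π u v` lists clockwise the lines at the port of `u` that
corresponds to the edge `(u, v)`. -/
abbrev Orders : Type :=
  Fin I.n → Fin I.n → List (Fin I.numLines)

/-- A line layout: `π u v` lists every line through the edge `(u, v)` exactly once. -/
def IsLayout (π : I.Orders) : Prop :=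
  ∀ u v, (π u v).Nodup ∧ ∀ i, i ∈ π u v ↔ I.Passes i u v

variable {I}

/-- The concatenation `π_u` of the line orders at the ports of `u` in clockwise order, cut open at
an arbitrary port. -/
def orderAround (π : I.Orders) (u : Fin I.n) : List (Fin I.numLines) :=
  (I.rot u).flatMap (π u)

/-- The lines `i` and `j` cross in the vertex `u`: they alternate in the cyclic sequence `π_u`. -/
def VertexCrossing (π : I.Orders) (u : Fin I.n) (i j : Fin I.numLines) : Prop :=
  i ≠ j ∧ ∃ r, r.IsRotated (orderAround π u) ∧ [i, j, i, j].Sublist r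

variable (I) in
/-- A vertex crossing of `i` and `j` in `u` is unavoidable: it occurs in every line layout. -/
def UnavoidableVertexCrossing (u : Fin I.n) (i j : Fin I.numLines) : Prop :=
  ∀ π, I.IsLayout π → VertexCrossing π u i j

/-- The periphery condition at every port: first lines that terminate at `u`, then lines for which
`u` is an intermediate station, then lines that terminate at `u`. -/
def Periphery (π : I.Orders) : Prop :=
  ∀ u v, ∃ A B C, π u v = A ++ B ++ C ∧ (∀ i ∈ A, I.IsTerminal i u) ∧
    (∀ i ∈ B, I.IsIntermediate i u) ∧ (∀ i ∈ C, I.IsTerminal i u)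

/-- The number of (edge) crossings. A pair of lines crosses on the edge `{u, v}` if the lines occur
in the same order in `π u v` and `π v u`; the condition `u < v` makes every edge count once, and
`(i, j)` is the order in which the two lines occur. -/
def crossings (π : I.Orders) : ℕ :=
  (Finset.univ.filter fun x : (Fin I.n × Fin I.n) × (Fin I.numLines × Fin I.numLines) =>
    x.1.1 < x.1.2 ∧ [x.2.1, x.2.2].Sublist (π x.1.1 x.1.2) ∧
      [x.2.1, x.2.2].Sublist (π x.1.2 x.1.1)).card

/-- Feasible solutions: line layouts with periphery condition and without avoidable vertex
crossings. -/
def IsSolution (π : I.Orders) : Prop :=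
  I.IsLayout π ∧ Periphery π ∧
    ∀ u i j, VertexCrossing π u i j → I.UnavoidableVertexCrossing u i j

/-- Feasible solutions with the minimum number of crossings. -/
def IsOptimal (π : I.Orders) : Prop :=
  IsSolution π ∧ ∀ π' : I.Orders, IsSolution π' → crossings π ≤ crossings π'

variable (I)

/-! ### Encodings of inputs and outputs -/

/-- The input as a tree: the clockwise lists of neighbours of all vertices, and the lines. (Numbers
are written in unary; the size is polynomial in the size of any other reasonable encoding.) -/
def encode : Data :=
  .cons
    (Data.ofList (List.ofFn fun u => Data.ofList ((I.rot u).map fun v => Data.ofNat v)))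
    (Data.ofList (List.ofFn fun i => Data.ofList ((I.line i).map fun v => Data.ofNat v)))

variable {I} in
/-- Line orders as a tree: the table of the lists `π u v`. -/
def encodeOrders (π : I.Orders) : Data :=
  Data.ofList (List.ofFn fun u => Data.ofList (List.ofFn fun v =>
    Data.ofList ((π u v).map fun i => Data.ofNat i)))

/-! ### Line directions and classes of networks -/

/-- The line `i`, read forwards (`d = false`) or backwards (`d = true`). -/
def directed (i : Fin I.numLines) (d : Bool) : List (Fin I.n) :=
  if d then (I.line i).reverse else I.line i

/-- The directions `d` of the lines are consistent: on every edge all lines have the same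
direction. -/
def IsConsistent (d : Fin I.numLines → Bool) : Prop :=
  ∀ u v i j, [u, v] <:+: I.directed i (d i) → I.Passes j u v → [u, v] <:+: I.directed j (d j)

def HasConsistentDirections : Prop :=
  ∃ d, I.IsConsistent d

/-- The underlying network is a path. -/
def IsPathNetwork : Prop :=
  Nonempty (I.graph ≃g SimpleGraph.pathGraph I.n)

/-- The underlying network is a caterpillar: a tree with a path (the spine) such that every vertex
lies on the path or is adjacent to a vertex of the path. -/
def IsCaterpillar : Prop :=
  I.graph.IsTree ∧ ∃ (a b : Fin I.n) (s : I.graph.Walk a b), s.IsPath ∧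
    ∀ v, v ∈ s.support ∨ ∃ w ∈ s.support, I.graph.Adj v w

/-- The vertices can be placed such that all lines are monotone in a fixed direction, where `x` is
the coordinate in this direction. -/
def HasMonotoneLines : Prop :=
  ∃ x : Fin I.n → ℝ, ∀ i, (I.line i).Pairwise (fun u v => x u < x v) ∨
    (I.line i).Pairwise (fun u v => x v < x u)

/-! ### Common subpaths and crossing formulas -/

/-- `P` is a maximal common subpath, with at least one edge, of the lines `i` and `j`. -/
def IsCommonSubpath (i j : Fin I.numLines) (P : List (Fin I.n)) : Prop :=
  2 ≤ P.length ∧ Subpath P (I.line i) ∧ Subpath P (I.line j) ∧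
    ∀ Q, Subpath Q (I.line i) → Subpath Q (I.line j) → P <:+: Q → Q = P

/-- The neighbours `a`, `b`, `c` of `u` occur in this clockwise cyclic order around `u`. -/
def Clockwise (u a b c : Fin I.n) : Prop :=
  ∃ r, r.IsRotated (I.rot u) ∧ [a, b, c].Sublist r

/-- The lines `i` and `j` share the port `(u, w)`, both continue beyond `u`, and they split at `u`
in such a way that `i` has to precede `j` in `π u w` if there is no vertex crossing: `i` leaves `u`
towards `a`, `j` leaves `u` towards `b`, and clockwise from `w` one meets first `b`, then `a`. -/
def SplitBefore (i j : Fin I.numLines) (u w : Fin I.n) : Prop :=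
  ∃ a b, Subpath [a, u, w] (I.line i) ∧ Subpath [b, u, w] (I.line j) ∧ I.Clockwise u w b a

/-- The number of unavoidable edge crossings: pairs of lines and common subpaths `P` such that the
lines split at both ends of `P` and their relative order has to change along `P`. Here `i` precedes
`j` clockwise at the ports at both ends, and `P` has the direction in which `line i` is given, so
that everything is counted once. -/
noncomputable def unavoidableCrossings : ℕ :=
  Set.ncard {x : (Fin I.numLines × Fin I.numLines) × List (Fin I.n) |
    x.1.1 ≠ x.1.2 ∧ I.IsCommonSubpath x.1.1 x.1.2 x.2 ∧ x.2 <:+: I.line x.1.1 ∧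
    ∃ u w v z, [u, w] <+: x.2 ∧ [v, z] <+: x.2.reverse ∧
      I.SplitBefore x.1.1 x.1.2 u w ∧ I.SplitBefore x.1.1 x.1.2 v z}

/-- The line ends, that is, the variables `l_u`: `(i, false)` is the first end of the line `i`, and
`(i, true)` its last end. -/
abbrev LineEnd : Type :=
  Fin I.numLines × Bool

/-- The line of the line end `x`, read from this end. -/
def fromEnd (x : I.LineEnd) : List (Fin I.n) :=
  I.directed x.1 x.2

/-- `(u, w)` is the terminal port of the line end `x`. -/
def IsPortOf (x : I.LineEnd) (u w : Fin I.n) : Prop :=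
  [u, w] <+: I.fromEnd x

/-- The case of a crossing formula with two variables `x = l_u` and `y = l'_v`: the common subpath
`P` of the lines `l` and `l'` leads from `u` to `v`; `u` is a terminal of `l` and an intermediate
station of `l'`, and `v` is a terminal of `l'` and an intermediate station of `l`. -/
def TwoEndConflict (x y : I.LineEnd) : Prop :=
  x.1 ≠ y.1 ∧ ∃ P u v, I.IsCommonSubpath x.1 y.1 P ∧
    P <+: I.fromEnd x ∧ P.reverse <+: I.fromEnd y ∧
    P.head? = some u ∧ P.getLast? = some v ∧ I.IsIntermediate y.1 u ∧ I.IsIntermediate x.1 v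

/-- The case of a crossing formula with one variable `x = l_u`, caused by the line `j`: the common
subpath `P` of `l` and `j` starts at the terminal `u` of `l`, which is an intermediate station of
`j`, and at the other end `v` the lines split. The Boolean `first` tells whether the lines avoid a
crossing on `P` if `l` terminates at the initial end (`true`) or at the final end (`false`) of the
clockwise order at its terminal port: on a path without crossings the clockwise orders at its two
ends are reversed. -/
def OneEndConflict (x : I.LineEnd) (j : Fin I.numLines) (first : Bool) : Prop :=
  x.1 ≠ j ∧ ∃ P u v z, I.IsCommonSubpath x.1 j P ∧ P <+: I.fromEnd x ∧
    P.head? = some u ∧ I.IsIntermediate j u ∧ [v, z] <+: P.reverse ∧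
    (if first then I.SplitBefore j x.1 v z else I.SplitBefore x.1 j v z)

/-! ### Top and bottom sides of ports, and the conflict graph -/

/-- A choice of top sides: `top u v` tells whether the top side of the port `(u, v)` is the initial
end (`true`) or the final end (`false`) of the clockwise order at this port. -/
abbrev Sides : Type :=
  Fin I.n → Fin I.n → Bool

open Classical in
/-- The top sides given by line directions `d`: the initial end of the clockwise order at the port
`(u, v)` is the top side if the lines through `(u, v)` are directed from `u` to `v`; otherwise it is
the bottom side. -/
noncomputable def sidesOf (d : Fin I.numLines → Bool) : I.Sides :=
  fun u v => decide (∃ i, [u, v] <:+: I.directed i (d i))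

variable {I}

/-- For every crossing formula with two variables, the top sides of the two terminal ports are on the
same side of the common subpath (the initial end of the clockwise order at one port is on the same
side as the final end at the other). -/
def TopsAligned (top : I.Sides) : Prop :=
  ∀ x y u w v z, I.TwoEndConflict x y → I.IsPortOf x u w → I.IsPortOf y v z → top u w ≠ top v z

/-- The crossing formula caused by `l_u = x` and the line `j` is the clause `(l_u)` (for
`val = true`) or the clause `(¬ l_u)` (for `val = false`). -/
def HasClause (top : I.Sides) (x : I.LineEnd) (j : Fin I.numLines) (val : Bool) : Prop :=
  ∃ u w, I.IsPortOf x u w ∧ I.OneEndConflict x j (val == top u w)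

variable (I) in
/-- The vertices of the conflict graph `G_ab`: `b`, `t`, and the variables. -/
inductive ConflictVertex : Type
  | b : ConflictVertex
  | t : ConflictVertex
  | var : I.LineEnd → ConflictVertex

open Classical in
/-- The edges of the conflict graph `G_ab`, which is a multigraph: one edge `(l_u, l'_v)` for every
crossing formula with two variables (listed with the smaller line first, hence once), an edge
`(b, l_u)` for every clause `(l_u)`, and an edge `(t, l_u)` for every clause `(¬ l_u)`. -/
noncomputable def conflictGraph (top : I.Sides) : Multiset (Sym2 I.ConflictVertex) :=
  (Finset.univ.filter fun x : I.LineEnd × I.LineEnd =>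
      x.1.1 < x.2.1 ∧ I.TwoEndConflict x.1 x.2).val.map
        (fun x => s(ConflictVertex.var x.1, ConflictVertex.var x.2)) +
  (Finset.univ.filter fun x : I.LineEnd × Fin I.numLines => HasClause top x.1 x.2 true).val.map
        (fun x => s(ConflictVertex.b, ConflictVertex.var x.1)) +
  (Finset.univ.filter fun x : I.LineEnd × Fin I.numLines => HasClause top x.1 x.2 false).val.map
        (fun x => s(ConflictVertex.t, ConflictVertex.var x.1))

end Network

/-- A multigraph with edges `E` is almost bipartite with special vertices `b` and `t`: all edges
that are not incident to `b` or `t` join different parts of a bipartition. -/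
def AlmostBipartite {V : Type} (E : Multiset (Sym2 V)) (b t : V) : Prop :=
  ∃ c : V → Bool, ∀ e ∈ E, b ∈ e ∨ t ∈ e ∨ ¬ (e.map c).IsDiag

/-- The number of uncut edges of the partition of the vertices into `S⁻¹(true)` and `S⁻¹(false)`. -/
def uncut {V : Type} (E : Multiset (Sym2 V)) (S : V → Bool) : ℕ :=
  (E.filter fun e => (e.map S).IsDiag).card

/-- `S` is a cut that separates `b` from `t`; the part of `t` is `S⁻¹(true)`. -/
def IsCut {V : Type} (b t : V) (S : V → Bool) : Prop :=
  S b = false ∧ S t = true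

/-- `S` is an optimal solution of MIN-UNCUT among the cuts that separate `b` from `t`. -/
def IsMinUncut {V : Type} (E : Multiset (Sym2 V)) (b t : V) (S : V → Bool) : Prop :=
  IsCut b t S ∧ ∀ S', IsCut b t S' → uncut E S ≤ uncut E S'

namespace Network

variable {I : Network}

/-- The cut `S` describes the sides at which the lines terminate in the layout `π`: a line end in the
part of `t` is at the top side of its terminal port, and a line end in the part of `b` is at its
bottom side. (A line is at the initial end of a port if it precedes all lines that pass through the
station.) -/
def Describes (top : I.Sides) (S : I.ConflictVertex → Bool) (π : I.Orders) : Prop :=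
  ∀ (x : I.LineEnd) (u w : Fin I.n), I.IsPortOf x u w → ∀ j ∈ π u w, I.IsIntermediate j u →
    if S (.var x) = top u w then [x.1, j].Sublist (π u w) else [j, x.1].Sublist (π u w)

/-- With the top sides `top`, solving MIN-UNCUT on the conflict graph amounts to crossing
minimization: every solution `π` is described by cuts between `b` and `t`, and it has at least as
many avoidable crossings as any of these has uncut edges; conversely, every optimal cut yields an
optimal layout whose number of avoidable crossings is the number of uncut edges. -/
def MinUncutSolves (top : I.Sides) : Prop :=
  (∀ π : I.Orders, IsSolution π →
    (∃ S, IsCut ConflictVertex.b ConflictVertex.t S ∧ Describes top S π) ∧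
    ∀ S, IsCut ConflictVertex.b ConflictVertex.t S → Describes top S π →
      uncut (conflictGraph top) S + I.unavoidableCrossings ≤ crossings π) ∧
  ∀ S, IsMinUncut (conflictGraph top) ConflictVertex.b ConflictVertex.t S →
    ∃ π : I.Orders, IsOptimal π ∧
      crossings π = uncut (conflictGraph top) S + I.unavoidableCrossings

end Network

end MetroLine

/-! Let `s` tell for every line end whether it lies at the initial end of the clockwise order at its
port. Fix `s`, two lines and a maximal common subpath `P`. Looking beyond an end of `P`, either the
lines split there and the rotation fixes their order, or one of them ends and `s` fixes it (`dir`).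
Along a path without crossings the clockwise orders at both ends are opposite, so a crossing is
forced exactly if the same line comes first at both ends (`needSet`). If no line ends on `P`, this
is an unavoidable crossing; otherwise it is a violated crossing formula. Counting gives `cost s`
plus the number of unavoidable crossings (`ncard_needSet`).

Lower bound: in a solution, lines that share a port and continue do not cross in the vertex, so
their order changes only on edges and every forced crossing takes place (`IsSolution.le_crossings`).
Upper bound: fix one total order of the edges by keys and let each pair cross, if necessary, on the
edge with the smallest key of its common subpath (`cmp`). On the part common to three lines, only
the smallest edge of that part can then carry a crossing of two of them. A cyclic triple could
therefore be moved, avoiding this edge, to a place where the three lines separate, and there it is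
impossible (`cmp_acyclic`). Hence `cmp` orders every port, and `layoutOf s` is a solution that
attains the bound (`crossings_layoutOf_le`).

The local step needs `Good s`: two lines that end at opposite sides of the same port must not be
forced into the other order by what happens at the far end. This follows by exchange
(`good_of_minimal`). Suppose `i` is at the initial end and `k` at the final end, but `i` precedes
`k` at the opposite port. Then every line that wants `i` at the initial end wants this for `k` too,
and every line that wants `k` at the final end wants this for `i` too. So it cannot be strictly
worse to move `i` and not better to move `k`.

In these coordinates a formula with two variables is violated if and only if the two values differ,
and the other formulas fix one value. Thus `cost` is the capacity of a cut in a flow network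
(`outArcs_flowArcs`). The vertices reachable in the residual network after augmentation form a
minimum cut with the strictness required above (`minCut_optimal`). The computation is composed of
list functions in the class `PolyFun` of polynomial-time functions, which is closed under
composition and under loops with polynomially bounded values.

The conflict graph states the same in terms of top and bottom. If the tops are aligned, the change
of coordinates negates exactly one end of each formula with two variables, so that satisfied
formulas become cut edges (`uncut_conflictGraph`), and the top bits themselves are a bipartition.
Aligned tops come from a direction of the common subpath, which leaves at one end and arrives at the
other: the line directions if they are consistent, and the direction of the spine on a caterpillar,
because there the common subpath of such a formula is part of the spine. -/

namespace MetroLine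

/-! ### Ports of paths -/

section Arms

variable {α : Type} [DecidableEq α]

/-- The part of the list `l` after the first occurrence of `w`. -/
def afterFirst (l : List α) (w : α) : List α :=
  (l.dropWhile fun x => decide (x ≠ w)).tail

/-- Boolean version of `Subpath [u, w] l`. -/
def passesB (l : List α) (u w : α) : Bool :=
  decide ((afterFirst l w).head? = some u) || decide ((afterFirst l.reverse w).head? = some u)

/-- The vertices of the path `l` beyond `u`, in the direction from `w` to `u`. -/
def arm (l : List α) (u w : α) : List α :=
  if (afterFirst l w).head? = some u then (afterFirst l w).tail
  else (afterFirst l.reverse w).tail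

/-- The longest common prefix of two lists. -/
def commonPrefix : List α → List α → List α
  | a :: A, b :: B => if a = b then a :: commonPrefix A B else []
  | _, _ => []

/-- `l` is `A`, `u`, `w`, `B` in one of the two directions, where `A` is reversed. -/
def PortSplit (l : List α) (u w : α) (A B : List α) : Prop :=
  A.reverse ++ u :: w :: B = l ∨ A.reverse ++ u :: w :: B = l.reverse

omit [DecidableEq α] in
theorem PortSplit.symm {l : List α} {u w : α} {A B : List α} (h : PortSplit l u w A B) :
    PortSplit l w u B A := by
  rcases h with h | h
  · right; rw [← h]; simp
  · left; rw [← List.reverse_reverse l, ← h]; simp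

omit [DecidableEq α] in
theorem PortSplit.nodup {l : List α} {u w : α} {A B : List α} (h : PortSplit l u w A B)
    (hl : l.Nodup) : (A.reverse ++ u :: w :: B).Nodup := by
  rcases h with h | h
  · rwa [h]
  · rw [h]; exact List.nodup_reverse.2 hl

omit [DecidableEq α] in
theorem PortSplit.subpath {l : List α} {u w : α} {A B : List α} (h : PortSplit l u w A B) :
    Subpath [u, w] l := by
  rcases h with h | h
  · left; exact ⟨A.reverse, B, by rw [← h]; simp⟩
  · right; refine ⟨B.reverse, A, ?_⟩
    rw [← List.reverse_reverse l, ← h]; simp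

omit [DecidableEq α] in
theorem Subpath.exists_portSplit {l : List α} {u w : α} (h : Subpath [u, w] l) :
    ∃ A B, PortSplit l u w A B := by
  rcases h with ⟨s, t, h⟩ | ⟨s, t, h⟩
  · exact ⟨s.reverse, t, Or.inl (by rw [← h]; simp)⟩
  · exact ⟨t, s.reverse, Or.inr (by rw [← h]; simp)⟩

theorem afterFirst_eq {l A B : List α} {w : α} (hl : l.Nodup) (h : l = A ++ w :: B) :
    afterFirst l w = B := by
  subst h
  have : ∀ a ∈ A, decide (a ≠ w) = true := by
    intro a ha
    have := (List.nodup_append.1 hl).2.2 a ha w (by simp)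
    simpa using this
  rw [afterFirst, List.dropWhile_append_of_pos this]
  simp

theorem afterFirst_spec {l : List α} {w u : α} {B : List α} (h : afterFirst l w = u :: B) :
    ∃ A, l = A ++ w :: u :: B := by
  unfold afterFirst at h
  cases hd : l.dropWhile (fun x => decide (x ≠ w)) with
  | nil => rw [hd] at h; simp at h
  | cons a t =>
    rw [hd] at h
    have h1 : decide (a ≠ w) = false := by
      have := List.head_dropWhile_not (fun x => decide (x ≠ w)) (l := l) (by rw [hd]; simp)
      simpa only [hd, List.head_cons] using this
    simp only [ne_eq, decide_not, Bool.not_eq_eq_eq_not, Bool.not_false, decide_eq_true_eq] at h1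
    refine ⟨l.takeWhile (fun x => decide (x ≠ w)), ?_⟩
    conv_lhs => rw [← List.takeWhile_append_dropWhile (p := fun x => decide (x ≠ w)) (l := l), hd]
    simp at h
    rw [h, h1]

theorem PortSplit.eq_arm {l : List α} {u w : α} {A B : List α} (hl : l.Nodup)
    (h : PortSplit l u w A B) : arm l u w = A := by
  have hn := h.nodup hl
  rcases h with h | h
  · have h1 : afterFirst l w = B := afterFirst_eq hl (A := A.reverse ++ [u]) (by rw [← h]; simp)
    have h2 : afterFirst l.reverse w = u :: A :=
      afterFirst_eq (List.nodup_reverse.2 hl) (A := B.reverse) (by rw [← h]; simp)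
    -- `u` occurs only once, hence not after `w`, so the test in `arm` fails and the reversed line
    -- is read.
    have h3 : ¬ B.head? = some u := by
      intro h4
      have : u ∈ B := List.mem_of_mem_head? h4
      simp [List.nodup_append, this] at hn
    rw [arm, h1, if_neg h3, h2]; rfl
  · have h2 : afterFirst l w = u :: A := by
      refine afterFirst_eq hl (A := B.reverse) ?_
      rw [← List.reverse_reverse l, ← h]; simp
    rw [arm, h2]; simp

theorem passesB_iff {l : List α} {u w : α} : passesB l u w = true → Subpath [u, w] l := by
  intro h
  simp only [passesB, Bool.or_eq_true, decide_eq_true_eq] at h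
  rcases h with h | h
  · obtain ⟨B, hB⟩ : ∃ B, afterFirst l w = u :: B := by
      cases hh : afterFirst l w <;> simp_all
    obtain ⟨A, hA⟩ := afterFirst_spec hB
    right; exact ⟨A, B, by rw [hA]; simp⟩
  · obtain ⟨B, hB⟩ : ∃ B, afterFirst l.reverse w = u :: B := by
      cases hh : afterFirst l.reverse w <;> simp_all
    obtain ⟨A, hA⟩ := afterFirst_spec hB
    left; refine ⟨B.reverse, A.reverse, ?_⟩
    rw [← List.reverse_reverse l, hA]; simp

theorem passesB_eq_true_iff {l : List α} (hl : l.Nodup) {u w : α} :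
    passesB l u w = true ↔ Subpath [u, w] l := by
  refine ⟨passesB_iff, fun h => ?_⟩
  obtain ⟨A, B, h⟩ := h.exists_portSplit
  simp only [passesB, Bool.or_eq_true, decide_eq_true_eq]
  rcases h with h | h
  · right
    rw [afterFirst_eq (List.nodup_reverse.2 hl) (A := B.reverse) (B := u :: A) (by rw [← h]; simp)]
    rfl
  · left
    rw [afterFirst_eq hl (A := B.reverse) (B := u :: A)
      (by rw [← List.reverse_reverse l, ← h]; simp)]
    rfl

theorem Subpath.portSplit_arm {l : List α} (hl : l.Nodup) {u w : α} (h : Subpath [u, w] l) :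
    PortSplit l u w (arm l u w) (arm l w u) := by
  obtain ⟨A, B, h⟩ := h.exists_portSplit
  rwa [h.eq_arm hl, h.symm.eq_arm hl]

theorem PortSplit.arms {l : List α} {u w : α} {A B : List α} (hl : l.Nodup)
    (h : PortSplit l u w A B) : arm l u w = A ∧ arm l w u = B :=
  ⟨h.eq_arm hl, h.symm.eq_arm hl⟩

-- The basis of all inductions along a line: the port moves on by one vertex, and `w` joins the arm
-- on the other side.
omit [DecidableEq α] in
theorem PortSplit.step {l : List α} {u w a : α} {A B : List α}
    (h : PortSplit l u w (a :: A) B) : PortSplit l a u A (w :: B) := by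
  simpa [PortSplit] using h

omit [DecidableEq α] in
theorem Subpath.symm {l P : List α} (h : Subpath P l) : Subpath P.reverse l := by
  rcases h with h | h
  · right; simpa using h
  · left; exact h

omit [DecidableEq α] in
theorem Subpath.trans {l P Q : List α} (h : P <:+: Q) (h' : Subpath Q l) : Subpath P l := by
  rcases h' with h' | h'
  · exact Or.inl (h.trans h')
  · exact Or.inr ((List.reverse_infix.2 h).trans h')

theorem commonPrefix_comm (A B : List α) : commonPrefix A B = commonPrefix B A := by
  induction A generalizing B with
  | nil => cases B <;> rfl
  | cons a A ih =>
    cases B with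
    | nil => rfl
    | cons b B =>
      by_cases h : a = b
      · subst h; simp [commonPrefix, ih B]
      · simp [commonPrefix, h, Ne.symm h]

theorem commonPrefix_prefix (A B : List α) : commonPrefix A B <+: A := by
  induction A generalizing B with
  | nil => cases B <;> simp [commonPrefix]
  | cons a A ih =>
    cases B with
    | nil => simp [commonPrefix]
    | cons b B =>
      by_cases h : a = b
      · subst h; simpa [commonPrefix] using ih B
      · simp [commonPrefix, h]

theorem commonPrefix_prefix' (A B : List α) : commonPrefix A B <+: B := by
  rw [commonPrefix_comm]; exact commonPrefix_prefix B A

theorem prefix_commonPrefix {A B C : List α} (h : C <+: A) (h' : C <+: B) :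
    C <+: commonPrefix A B := by
  induction C generalizing A B with
  | nil => simp
  | cons c C ih =>
    obtain ⟨A', rfl⟩ := h
    obtain ⟨B', rfl⟩ := h'
    simp only [List.cons_append, commonPrefix, if_true]
    exact List.cons_prefix_cons.2 ⟨rfl, ih (List.prefix_append _ _) (List.prefix_append _ _)⟩

end Arms

end MetroLine

/-! ### Maximal common subpaths through a port -/

namespace MetroLine

section Runs

variable {α : Type} [DecidableEq α]

/-- Subpaths of a path through a given port are given by prefixes of the two arms. -/
theorem subpath_port_iff {l : List α} (hl : l.Nodup) {u w : α} {A B : List α} :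
    Subpath (A.reverse ++ u :: w :: B) l ↔
      Subpath [u, w] l ∧ A <+: arm l u w ∧ B <+: arm l w u := by
  constructor
  · intro h
    have h0 : Subpath [u, w] l := Subpath.trans ⟨A.reverse, B, by simp⟩ h
    refine ⟨h0, ?_⟩
    have : ∃ s t, PortSplit l u w (A ++ s) (B ++ t) := by
      rcases h with ⟨s, t, h⟩ | ⟨s, t, h⟩
      · exact ⟨s.reverse, t, Or.inl (by rw [← h]; simp)⟩
      · exact ⟨t, s.reverse, Or.inr (by rw [← h]; simp)⟩
    obtain ⟨s, t, h⟩ := this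
    obtain ⟨h1, h2⟩ := h.arms hl
    rw [h1, h2]
    exact ⟨List.prefix_append _ _, List.prefix_append _ _⟩
  · rintro ⟨h, ⟨s, hs⟩, ⟨t, ht⟩⟩
    have := h.portSplit_arm hl
    rw [← hs, ← ht] at this
    rcases this with h | h
    · exact Or.inl ⟨s.reverse, t, by rw [← h]; simp⟩
    · refine Or.inr ⟨t.reverse, s, ?_⟩
      rw [← List.reverse_reverse l, ← h]; simp

/-- The maximal common subpath of two paths through a common port. -/
def run (l l' : List α) (u w : α) : List α :=
  (commonPrefix (arm l u w) (arm l' u w)).reverse ++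
    u :: w :: commonPrefix (arm l w u) (arm l' w u)

theorem run_reverse (l l' : List α) (u w : α) : (run l l' u w).reverse = run l l' w u := by
  simp [run]

theorem run_comm (l l' : List α) (u w : α) : run l l' u w = run l' l u w := by
  simp [run, commonPrefix_comm]

theorem pair_infix_run (l l' : List α) (u w : α) : [u, w] <:+: run l l' u w :=
  ⟨(commonPrefix (arm l u w) (arm l' u w)).reverse,
    commonPrefix (arm l w u) (arm l' w u), by simp [run]⟩

theorem run_subpath {l l' : List α} (hl : l.Nodup) {u w : α} (h : Subpath [u, w] l) :
    Subpath (run l l' u w) l :=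
  (subpath_port_iff hl).2 ⟨h, commonPrefix_prefix _ _, commonPrefix_prefix _ _⟩

/-- Both arms of `Q` at the port are prefixes of the corresponding arms of both paths, hence of
their longest common prefixes. -/
theorem infix_run {l l' : List α} (hl : l.Nodup) (hl' : l'.Nodup) {u w : α} {Q : List α}
    (h : Subpath Q l) (h' : Subpath Q l') (hQ : [u, w] <:+: Q) : Q <:+: run l l' u w := by
  obtain ⟨s, t, rfl⟩ := hQ
  have e : s ++ [u, w] ++ t = s.reverse.reverse ++ u :: w :: t := by simp
  rw [e] at h h' ⊢
  obtain ⟨-, h1, h2⟩ := (subpath_port_iff hl).1 h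
  obtain ⟨-, h3, h4⟩ := (subpath_port_iff hl').1 h'
  obtain ⟨p, hp⟩ := prefix_commonPrefix h1 h3
  obtain ⟨q, hq⟩ := prefix_commonPrefix h2 h4
  exact ⟨p.reverse, q, by rw [run, ← hp, ← hq]; simp⟩

theorem run_maximal {l l' : List α} (hl : l.Nodup) (hl' : l'.Nodup) {u w : α} {Q : List α}
    (h : Subpath Q l) (h' : Subpath Q l') (hQ : run l l' u w <:+: Q) : Q = run l l' u w :=
  ((infix_run hl hl' h h' ((pair_infix_run l l' u w).trans hQ)).eq_of_length_le hQ.length_le)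

end Runs

namespace Network

variable (I : Network)

/-- The vertices of the line `i` beyond `u`, in the direction from `w` to `u`. -/
def arm (i : Fin I.numLines) (u w : Fin I.n) : List (Fin I.n) :=
  MetroLine.arm (I.line i) u w

/-- The maximal common subpath of the lines `i` and `j` through the port `(u, w)`. -/
def run (i j : Fin I.numLines) (u w : Fin I.n) : List (Fin I.n) :=
  MetroLine.run (I.line i) (I.line j) u w

variable {I} {i j : Fin I.numLines} {u w a : Fin I.n}

theorem Passes.symm (h : I.Passes i u w) : I.Passes i w u := Subpath.symm h

theorem Passes.portSplit (h : I.Passes i u w) :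
    PortSplit (I.line i) u w (I.arm i u w) (I.arm i w u) :=
  Subpath.portSplit_arm (I.nodup_line i) h

theorem arms_of_portSplit {A B : List (Fin I.n)} (h : PortSplit (I.line i) u w A B) :
    I.Passes i u w ∧ I.arm i u w = A ∧ I.arm i w u = B :=
  ⟨h.subpath, h.arms (I.nodup_line i)⟩

theorem Passes.step {A : List (Fin I.n)} (h : I.Passes i u w) (hA : I.arm i u w = a :: A) :
    I.Passes i a u ∧ I.arm i a u = A ∧ I.arm i u a = w :: I.arm i w u := by
  have := h.portSplit
  rw [hA] at this
  exact arms_of_portSplit this.step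

theorem Passes.nodup (h : I.Passes i u w) :
    ((I.arm i u w).reverse ++ u :: w :: I.arm i w u).Nodup :=
  h.portSplit.nodup (I.nodup_line i)

theorem Passes.adj (h : I.Passes i u w) : I.graph.Adj u w := by
  have key : ∀ u w, [u, w] <:+: I.line i → I.graph.Adj u w := by
    rintro u w h
    have := (I.isChain_line i).infix h
    simpa using this
  rcases h with h | h
  · exact key _ _ h
  · exact (key w u h).symm

theorem Passes.ne (h : I.Passes i u w) : u ≠ w := h.adj.ne

theorem subpath_iff {A B : List (Fin I.n)} :
    Subpath (A.reverse ++ u :: w :: B) (I.line i) ↔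
      I.Passes i u w ∧ A <+: I.arm i u w ∧ B <+: I.arm i w u :=
  subpath_port_iff (I.nodup_line i)

theorem isCommonSubpath_run (h : I.Passes i u w) (h' : I.Passes j u w) :
    I.IsCommonSubpath i j (I.run i j u w) := by
  refine ⟨(pair_infix_run _ _ _ _).length_le, run_subpath (I.nodup_line i) h, ?_, ?_⟩
  · rw [run, run_comm]; exact run_subpath (I.nodup_line j) h'
  · intro Q h1 h2 h3
    exact run_maximal (I.nodup_line i) (I.nodup_line j) h1 h2 h3

variable {P : List (Fin I.n)}

theorem IsCommonSubpath.passes (h : I.IsCommonSubpath i j P) (hP : [u, w] <:+: P) :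
    I.Passes i u w ∧ I.Passes j u w :=
  ⟨Subpath.trans hP h.2.1, Subpath.trans hP h.2.2.1⟩

/-- Any one of its edges, with its direction, determines a maximal common subpath. This allows
forced crossings to be compared with crossed edges. -/
theorem IsCommonSubpath.eq_run (h : I.IsCommonSubpath i j P) (hP : [u, w] <:+: P) :
    P = I.run i j u w := by
  obtain ⟨h1, h2⟩ := h.passes hP
  have h3 := isCommonSubpath_run h1 h2
  exact (h.2.2.2 _ h3.2.1 h3.2.2.1
    (infix_run (I.nodup_line i) (I.nodup_line j) h.2.1 h.2.2.1 hP)).symm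

theorem IsCommonSubpath.comm (h : I.IsCommonSubpath i j P) : I.IsCommonSubpath j i P :=
  ⟨h.1, h.2.2.1, h.2.1, fun Q h1 h2 h3 => h.2.2.2 Q h2 h1 h3⟩

theorem IsCommonSubpath.reverse (h : I.IsCommonSubpath i j P) :
    I.IsCommonSubpath i j P.reverse :=
  ⟨by simpa using h.1, h.2.1.symm, h.2.2.1.symm, fun Q h1 h2 h3 => by
    rw [← h.2.2.2 Q.reverse h1.symm h2.symm (by simpa using List.reverse_infix.2 h3)]; simp⟩

theorem IsCommonSubpath.exists_cons (h : I.IsCommonSubpath i j P) :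
    ∃ u w C, P = u :: w :: C := by
  rcases P with _ | ⟨u, _ | ⟨w, C⟩⟩
  · simp [IsCommonSubpath] at h
  · simp [IsCommonSubpath] at h
  · exact ⟨u, w, C, rfl⟩

/-- At the beginning of a maximal common subpath the lines do not continue together. -/
theorem IsCommonSubpath.commonPrefix_eq {C : List (Fin I.n)}
    (h : I.IsCommonSubpath i j (u :: w :: C)) :
    commonPrefix (I.arm i u w) (I.arm j u w) = [] ∧
      commonPrefix (I.arm i w u) (I.arm j w u) = C := by
  have hP : [u, w] <:+: u :: w :: C := ⟨[], C, by simp⟩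
  have h1 := h.eq_run hP
  obtain ⟨h2, h3⟩ := h.passes hP
  have hn := h2.portSplit.nodup (I.nodup_line i)
  rw [run, MetroLine.run] at h1
  change _ = (commonPrefix (I.arm i u w) (I.arm j u w)).reverse ++
    u :: w :: commonPrefix (I.arm i w u) (I.arm j w u) at h1
  -- If the back part were nonempty, `u` as the first vertex of the path would belong to its own
  -- arm.
  have h4 : commonPrefix (I.arm i u w) (I.arm j u w) = [] := by
    by_contra h4
    obtain ⟨c, D, hc⟩ := List.exists_cons_of_ne_nil
      (l := (commonPrefix (I.arm i u w) (I.arm j u w)).reverse) (by simpa using h4)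
    rw [hc] at h1
    have h5 : u = c := by simpa using congrArg List.head? h1
    have h6 : c ∈ I.arm i u w := by
      refine (commonPrefix_prefix (I.arm i u w) (I.arm j u w)).subset ?_
      rw [← List.mem_reverse, hc]; simp
    subst h5
    exact (List.nodup_append.1 hn).2.2 u (by simpa using h6) u (by simp) rfl
  rw [h4] at h1
  exact ⟨h4, by simpa using h1.symm⟩

end Network

end MetroLine

/-! ### Order in lists and cyclic lists cut open -/

namespace MetroLine

section Clock

variable {α : Type} [DecidableEq α]

theorem pair_sublist_iff {L : List α} (hL : L.Nodup) {a b : α} :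
    [a, b].Sublist L ↔ a ∈ L ∧ b ∈ L ∧ L.idxOf a < L.idxOf b := by
  induction L with
  | nil => simp
  | cons c L ih =>
    obtain ⟨hc, hL⟩ := List.nodup_cons.1 hL
    rw [List.sublist_cons_iff, ih hL]
    by_cases ha : c = a
    · subst ha
      by_cases hb : c = b
      · subst hb; simp [hc]
      · simp only [hc, false_and, List.cons.injEq, false_or, List.mem_cons, true_or, true_and,
          Ne.symm hb, List.idxOf_cons_self, List.idxOf_cons_ne L hb]
        simp
    · by_cases hb : c = b
      · subst hb
        simp [hc, ha]
      · simp [List.mem_cons, Ne.symm ha, Ne.symm hb, List.idxOf_cons_ne L ha,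
          List.idxOf_cons_ne L hb]

omit [DecidableEq α] in
theorem pair_sublist_total {L : List α} {a b : α} (ha : a ∈ L) (hb : b ∈ L)
    (h : a ≠ b) : [a, b].Sublist L ∨ [b, a].Sublist L := by
  induction L with
  | nil => simp at ha
  | cons c L ih =>
    rcases List.mem_cons.1 ha with rfl | ha'
    · left
      have : b ∈ L := by simpa [h.symm] using hb
      simpa using this
    · rcases List.mem_cons.1 hb with rfl | hb'
      · right; simpa using ha'
      · exact (ih ha' hb').imp (·.cons _) (·.cons _)

theorem pair_sublist_asymm {L : List α} (hL : L.Nodup) {a b : α} (h : [a, b].Sublist L) :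
    ¬ [b, a].Sublist L := by
  rw [pair_sublist_iff hL] at *
  omega

theorem pair_sublist_trans {L : List α} (hL : L.Nodup) {a b c : α} (h : [a, b].Sublist L)
    (h' : [b, c].Sublist L) : [a, c].Sublist L := by
  rw [pair_sublist_iff hL] at *
  exact ⟨h.1, h'.2.1, by omega⟩

theorem pair_sublist_not_iff {L : List α} (hL : L.Nodup) {a b : α} (ha : a ∈ L) (hb : b ∈ L)
    (h : a ≠ b) : ¬ [a, b].Sublist L ↔ [b, a].Sublist L :=
  ⟨fun h' => (pair_sublist_total ha hb h).resolve_left h', fun h' => pair_sublist_asymm hL h'⟩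

/-- The cyclic list `r`, cut open at `a`, without `a`. -/
def cutAt (r : List α) (a : α) : List α :=
  afterFirst r a ++ r.takeWhile fun x => decide (x ≠ a)

/-- Boolean version of `Network.Clockwise`. -/
def clockB (r : List α) (a b c : α) : Bool :=
  decide (c ∈ afterFirst (cutAt r a) b)

theorem cons_cutAt {r : List α} {a : α} (ha : a ∈ r) : (a :: cutAt r a).IsRotated r := by
  have h1 := List.takeWhile_append_dropWhile (p := fun x => decide (x ≠ a)) (l := r)
  have h2 : r.dropWhile (fun x => decide (x ≠ a)) = a :: afterFirst r a := by
    unfold afterFirst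
    cases hd : r.dropWhile (fun x => decide (x ≠ a)) with
    | nil =>
      rw [List.dropWhile_eq_nil_iff] at hd
      simpa using hd a ha
    | cons b t =>
      have := List.head_dropWhile_not (fun x => decide (x ≠ a)) (l := r) (by rw [hd]; simp)
      simp only [hd, List.head_cons] at this
      simp only [ne_eq, decide_not, Bool.not_eq_eq_eq_not, Bool.not_false,
        decide_eq_true_eq] at this
      rw [this]; rfl
  rw [h2] at h1
  conv_rhs => rw [← h1]
  rw [cutAt, ← List.cons_append]
  exact List.isRotated_append

theorem nodup_cutAt {r : List α} (hr : r.Nodup) {a : α} (ha : a ∈ r) :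
    (a :: cutAt r a).Nodup :=
  (cons_cutAt ha).nodup_iff.2 hr

theorem mem_cutAt {r : List α} (hr : r.Nodup) {a b : α} (ha : a ∈ r) :
    b ∈ cutAt r a ↔ b ∈ r ∧ b ≠ a := by
  have h1 := (cons_cutAt ha).mem_iff (a := b)
  have h2 := nodup_cutAt hr ha
  rw [← h1]
  constructor
  · intro h
    refine ⟨by simp [h], ?_⟩
    rintro rfl
    exact (List.nodup_cons.1 h2).1 h
  · rintro ⟨h, h'⟩
    simpa [h'] using h

theorem mem_afterFirst_iff {L : List α} (hL : L.Nodup) {b c : α} (hb : b ∈ L) :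
    c ∈ afterFirst L b ↔ [b, c].Sublist L := by
  obtain ⟨s, t, rfl⟩ := List.append_of_mem hb
  rw [afterFirst_eq hL rfl]
  have hn := List.nodup_append.1 hL
  have hbt : b ∉ t := (List.nodup_cons.1 hn.2.1).1
  constructor
  · intro h
    refine List.Sublist.trans ?_ (List.sublist_append_right s _)
    simpa using h
  · intro h
    rw [pair_sublist_iff hL] at h
    obtain ⟨-, h2, h3⟩ := h
    have hbs : b ∉ s := fun h => hn.2.2 b h b (by simp) rfl
    rcases List.mem_append.1 h2 with h4 | h4
    · rw [List.idxOf_append_of_mem h4, List.idxOf_append_of_notMem hbs] at h3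
      have := List.idxOf_lt_length_of_mem h4
      simp at h3
      omega
    · rcases List.mem_cons.1 h4 with rfl | h4
      · omega
      · exact h4

-- Without repetitions, the position of `a` determines the rotation.
omit [DecidableEq α] in
theorem isRotated_cons_unique {a : α} {s t : List α} (hs : (a :: s).Nodup)
    (h : (a :: s).IsRotated (a :: t)) : s = t := by
  obtain ⟨k, hk, h⟩ := List.isRotated_iff_mod.1 h
  rw [List.rotate_eq_drop_append_take hk] at h
  rcases Nat.eq_zero_or_pos k with rfl | h0
  · simpa using h
  · obtain ⟨k, rfl⟩ : ∃ m, k = m + 1 := ⟨k - 1, by omega⟩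
    simp only [List.drop_succ_cons, List.take_succ_cons] at h
    cases hd : s.drop k with
    | nil =>
      rw [hd] at h
      simp only [List.nil_append, List.cons.injEq, true_and] at h
      rw [← h]
      rw [List.take_of_length_le]
      simpa using hd
    | cons b u =>
      rw [hd] at h
      simp only [List.cons_append, List.cons.injEq] at h
      have : b ∈ s := (List.drop_sublist k s).subset (by rw [hd]; simp)
      rw [h.1] at this
      exact absurd this (List.nodup_cons.1 hs).1

theorem clockB_iff {r : List α} (hr : r.Nodup) {a b c : α} (ha : a ∈ r) (hb : b ∈ r)
    (hab : a ≠ b) : clockB r a b c = true ↔ [b, c].Sublist (cutAt r a) := by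
  rw [clockB, decide_eq_true_eq]
  exact mem_afterFirst_iff (List.nodup_cons.1 (nodup_cutAt hr ha)).2
    ((mem_cutAt hr ha).2 ⟨hb, hab.symm⟩)

/-- A rotation that shows `a`, `b`, `c` in this order can be rotated further so that it starts with
`a`; this does not disturb `b` and `c`, and the result is unique. -/
theorem exists_rotated_sublist_iff {r : List α} (hr : r.Nodup) {a b c : α} (ha : a ∈ r) :
    (∃ r', r'.IsRotated r ∧ [a, b, c].Sublist r') ↔ [b, c].Sublist (cutAt r a) := by
  constructor
  · rintro ⟨r', h1, h2⟩
    obtain ⟨s, t, rfl⟩ := List.append_of_mem (h2.subset (by simp : a ∈ [a, b, c]))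
    have hn : (s ++ a :: t).Nodup := h1.nodup_iff.2 hr
    have h3 : [b, c].Sublist t := by
      have : a ∉ s := fun h => (List.nodup_append.1 hn).2.2 a h a (by simp) rfl
      rw [List.sublist_append_iff] at h2
      obtain ⟨l₁, l₂, e, h4, h5⟩ := h2
      cases l₁ with
      | nil =>
        simp only [List.nil_append] at e
        subst e
        rcases List.sublist_cons_iff.1 h5 with h6 | ⟨r, h6, h7⟩
        · have := h6.subset (by simp : a ∈ [a, b, c])
          exact absurd this (List.nodup_cons.1 (List.nodup_append.1 hn).2.1).1
        · simp only [List.cons.injEq, true_and] at h6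
          rwa [h6]
      | cons x l₁ =>
        simp only [List.cons_append, List.cons.injEq] at e
        exact absurd (h4.subset (by simp [e.1])) this
    have h4 : (a :: (t ++ s)).IsRotated (a :: cutAt r a) := by
      refine List.IsRotated.trans ?_ (h1.trans (cons_cutAt ha).symm)
      rw [← List.cons_append]
      exact List.isRotated_append
    have h5 := isRotated_cons_unique
      (by rw [List.isRotated_append.nodup_iff] at hn; simpa using hn) h4
    rw [← h5]
    exact h3.trans (List.sublist_append_left _ _)
  · intro h
    exact ⟨_, cons_cutAt ha, h.cons_cons a⟩

end Clock

end MetroLine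

/-! ### The order of two lines found by looking back -/

namespace MetroLine

section Look

variable {α : Type} [DecidableEq α]

/-- Follow two arms from the port `(c, p)` as long as they agree. The result is the last port
reached, with the remaining arms. -/
def look (p c : α) : List α → List α → α × α × List α × List α
  | a :: A, b :: B => if a = b then look c a A B else (p, c, a :: A, b :: B)
  | A, B => (p, c, A, B)

/-- The relative order of two lines where they separate: `some true` if the first line comes first,
`none` if both lines terminate. -/
def dirOf (clk : α → α → α → α → Bool) (s s' : α → Bool) :
    α × α × List α × List α → Option Bool
  | (p, c, a :: _, b :: _) => some (clk c p b a)
  | (_, c, [], _ :: _) => some (s c)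
  | (_, c, _ :: _, []) => some (!s' c)
  | (_, _, [], []) => none

theorem look_cons_cons (p c a : α) (A B : List α) : look p c (a :: A) (a :: B) = look c a A B := by
  simp [look]

theorem look_of_commonPrefix {p c : α} {A B : List α} (h : commonPrefix A B = []) :
    look p c A B = (p, c, A, B) := by
  unfold look
  split
  · rename_i a A b B
    by_cases hab : a = b
    · simp [commonPrefix, hab] at h
    · simp [hab]
  · rfl

end Look

namespace Network

variable {I : Network} {i j k : Fin I.numLines} {u w a : Fin I.n}

/-- The value at the end of the line `i` in the vertex `c`. -/
def endVal (s : I.LineEnd → Bool) (i : Fin I.numLines) (c : Fin I.n) : Bool :=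
  s (i, decide ((I.line i).head? ≠ some c))

/-- Boolean version of `Clockwise`. -/
def clock (u a b c : Fin I.n) : Bool := clockB (I.rot u) a b c

/-- The order of the lines `i` and `j` at the port `(u, w)`, as determined by the place beyond `u`
where they separate; `s` tells which line ends are at the initial ends of their ports. -/
def dir (s : I.LineEnd → Bool) (i j : Fin I.numLines) (u w : Fin I.n) : Option Bool :=
  dirOf clock (endVal s i) (endVal s j) (look w u (I.arm i u w) (I.arm j u w))

/-- The lines `i` and `j` share the port `(u, w)` and separate at `u`. -/
def Separate (i j : Fin I.numLines) (u w : Fin I.n) : Prop :=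
  commonPrefix (I.arm i u w) (I.arm j u w) = []

theorem Separate.symm (h : I.Separate i j u w) : I.Separate j i u w := by
  rw [Separate, commonPrefix_comm]; exact h

variable {s : I.LineEnd → Bool}

theorem not_separate_iff : ¬ I.Separate i j u w ↔
    ∃ a A B, I.arm i u w = a :: A ∧ I.arm j u w = a :: B := by
  rw [Separate]
  rcases I.arm i u w with _ | ⟨a, A⟩
  · simp [commonPrefix]
  rcases I.arm j u w with _ | ⟨b, B⟩
  · simp [commonPrefix]
  by_cases h : a = b
  · subst h; simp [commonPrefix]
  · simp [commonPrefix, h, Ne.symm h]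

/-- Induction along a common subpath, starting where two lines separate. -/
theorem back_induction {M : Fin I.n → Fin I.n → Prop}
    (base : ∀ u w, I.Passes i u w → I.Passes j u w → I.Separate i j u w → M u w)
    (step : ∀ u w a A B, I.Passes i u w → I.Passes j u w → I.arm i u w = a :: A →
      I.arm j u w = a :: B → I.Passes i a u → I.Passes j a u → I.arm i a u = A →
      I.arm j a u = B → M a u → M u w)
    (h : I.Passes i u w) (h' : I.Passes j u w) : M u w := by
  induction hA : I.arm i u w generalizing u w with
  | nil => exact base u w h h' (by simp [Separate, hA, commonPrefix])
  | cons a A ih =>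
    by_cases hs : I.Separate i j u w
    · exact base u w h h' hs
    · obtain ⟨b, A', B, h1, h2⟩ := not_separate_iff.1 hs
      rw [h1] at hA
      obtain ⟨rfl, rfl⟩ := List.cons.inj hA
      obtain ⟨h3, h4, -⟩ := h.step h1
      obtain ⟨h5, h6, -⟩ := h'.step h2
      exact step u w b A' B h h' h1 h2 h3 h5 h4 h6 (ih h3 h5 h4)

theorem dir_step {A B : List (Fin I.n)} (h : I.Passes i u w) (h' : I.Passes j u w)
    (hA : I.arm i u w = a :: A) (hB : I.arm j u w = a :: B) :
    dir s i j u w = dir s i j a u := by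
  rw [dir, dir, hA, hB, look_cons_cons, (h.step hA).2.1, (h'.step hB).2.1]

theorem dir_of_separate (h : I.Separate i j u w) :
    dir s i j u w =
      dirOf clock (endVal s i) (endVal s j) (w, u, I.arm i u w, I.arm j u w) := by
  rw [dir, look_of_commonPrefix h]

theorem clock_iff {a b c : Fin I.n} (ha : I.graph.Adj u a) (hb : I.graph.Adj u b) (hab : a ≠ b) :
    clock u a b c = true ↔ [b, c].Sublist (cutAt (I.rot u) a) :=
  clockB_iff (I.nodup_rot u) ((I.mem_rot u a).2 ha) ((I.mem_rot u b).2 hb) hab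

theorem clockwise_iff {a b c : Fin I.n} (ha : I.graph.Adj u a) :
    I.Clockwise u a b c ↔ [b, c].Sublist (cutAt (I.rot u) a) :=
  exists_rotated_sublist_iff (I.nodup_rot u) ((I.mem_rot u a).2 ha)

theorem mem_cutAt_rot {a b : Fin I.n} (ha : I.graph.Adj u a) :
    b ∈ cutAt (I.rot u) a ↔ I.graph.Adj u b ∧ b ≠ a := by
  rw [mem_cutAt (I.nodup_rot u) ((I.mem_rot u a).2 ha), I.mem_rot]

theorem nodup_cutAt_rot {a : Fin I.n} (ha : I.graph.Adj u a) : (cutAt (I.rot u) a).Nodup :=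
  (List.nodup_cons.1 (nodup_cutAt (I.nodup_rot u) ((I.mem_rot u a).2 ha))).2

theorem Passes.mem_cutAt {A : List (Fin I.n)} (h : I.Passes i u w) (hA : I.arm i u w = a :: A) :
    a ∈ cutAt (I.rot u) w := by
  rw [mem_cutAt_rot h.adj]
  refine ⟨(h.step hA).1.adj.symm, ?_⟩
  rintro rfl
  have := h.nodup
  rw [hA] at this
  simp [List.nodup_append] at this

theorem Passes.clock_iff {A : List (Fin I.n)} (h : I.Passes i u w) (hA : I.arm i u w = a :: A)
    {b : Fin I.n} : clock u w a b = true ↔ [a, b].Sublist (cutAt (I.rot u) w) := by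
  have := (mem_cutAt_rot h.adj).1 (h.mem_cutAt hA)
  exact Network.clock_iff h.adj this.1 this.2.symm

/-- Where the lines split, exactly one of the two different neighbours comes first clockwise from
`w`; where just one line ends, the definition is antisymmetric. -/
theorem dir_symm (h : I.Passes i u w) (h' : I.Passes j u w) :
    dir s j i u w = (dir s i j u w).map not := by
  refine back_induction (M := fun u w => dir s j i u w = (dir s i j u w).map not) ?_ ?_ h h'
  · intro u w h h' hs
    rw [dir_of_separate hs, dir_of_separate hs.symm]
    rcases hA : I.arm i u w with _ | ⟨a, A⟩ <;> rcases hB : I.arm j u w with _ | ⟨b, B⟩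
    · rfl
    · rfl
    · simp [dirOf]
    · have hab : a ≠ b := by
        rintro rfl
        simp [Separate, hA, hB, commonPrefix] at hs
      simp only [dirOf, Option.map_some, Option.some.injEq]
      rw [Bool.eq_iff_iff, h.clock_iff hA, Bool.not_eq_true', ← Bool.not_eq_true, h'.clock_iff hB,
        pair_sublist_not_iff (nodup_cutAt_rot h.adj) (h'.mem_cutAt hB) (h.mem_cutAt hA) hab.symm]
  · intro u w a A B h h' hA hB _ _ _ _ ih
    rw [dir_step h' h hB hA, dir_step h h' hA hB, ih]

/-- The order is undetermined only if the lines never separate beyond `u` and end together. -/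
theorem dir_eq_none_iff (h : I.Passes i u w) (h' : I.Passes j u w) :
    dir s i j u w = none ↔ I.arm i u w = I.arm j u w := by
  refine back_induction (M := fun u w => dir s i j u w = none ↔ I.arm i u w = I.arm j u w)
    ?_ ?_ h h'
  · intro u w h h' hs
    rw [dir_of_separate hs]
    rcases hA : I.arm i u w with _ | ⟨a, A⟩ <;> rcases hB : I.arm j u w with _ | ⟨b, B⟩ <;>
      simp [dirOf]
    rintro rfl
    simp [Separate, hA, hB, commonPrefix] at hs
  · intro u w a A B h h' hA hB _ _ hA' hB' ih
    rw [dir_step h h' hA hB, ih, hA, hB, hA', hB']; simp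

theorem subpath_of_prefix (h : I.Passes i u w) (h' : I.Passes j u w)
    (h1 : I.arm i u w <+: I.arm j u w) (h2 : I.arm i w u <+: I.arm j w u) :
    Subpath (I.line i) (I.line j) := by
  have h3 := h.portSplit
  have h4 : Subpath ((I.arm i u w).reverse ++ u :: w :: I.arm i w u) (I.line j) :=
    subpath_iff.2 ⟨h', h1, h2⟩
  rcases h3 with h3 | h3
  · rwa [h3] at h4
  · rw [h3] at h4; simpa using h4.symm

/-- In a proper instance two lines through an edge do not both end together at both sides. -/
theorem IsProper.dir_ne_none (hI : I.IsProper) (hij : i ≠ j) (h : I.Passes i u w)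
    (h' : I.Passes j u w) (h0 : dir s i j u w = none) : dir s i j w u ≠ none := by
  rw [dir_eq_none_iff h h'] at h0
  intro h1
  rw [dir_eq_none_iff h.symm h'.symm] at h1
  exact hI i j hij (subpath_of_prefix h h' (h0 ▸ List.prefix_refl _) (h1 ▸ List.prefix_refl _))

/-- The order of lines determined by looking back has no cycles of length three. -/
theorem dir_acyclic (h1 : I.Passes i u w) (h2 : I.Passes j u w) (h3 : I.Passes k u w)
    (hij : dir s i j u w = some true) (hjk : dir s j k u w = some true) :
    dir s k i u w ≠ some true := by
  -- If just one of the three lines ends here, its value puts it on the same side of the two others;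
  -- if two end, one of the three orders is undetermined.
  induction hA : I.arm i u w generalizing u w with
  | nil =>
    rcases hB : I.arm j u w with _ | ⟨b, B⟩
    · simp [dir, look, dirOf, hA, hB] at hij
    rcases hC : I.arm k u w with _ | ⟨c, C⟩
    · simp [dir, look, dirOf, hA, hC]
    · have e1 : dir s i j u w = some (endVal s i u) := by simp [dir, look, dirOf, hA, hB]
      have e2 : dir s k i u w = some (!endVal s i u) := by simp [dir, look, dirOf, hA, hC]
      rw [e2]; rw [e1] at hij; simp_all
  | cons a A ih =>
    rcases hB : I.arm j u w with _ | ⟨b, B⟩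
    · rcases hC : I.arm k u w with _ | ⟨c, C⟩
      · simp [dir, look, dirOf, hB, hC] at hjk
      · have e1 : dir s i j u w = some (!endVal s j u) := by simp [dir, look, dirOf, hA, hB]
        have e2 : dir s j k u w = some (endVal s j u) := by simp [dir, look, dirOf, hB, hC]
        rw [e1] at hij; rw [e2] at hjk; simp_all
    rcases hC : I.arm k u w with _ | ⟨c, C⟩
    · have e1 : dir s j k u w = some (!endVal s k u) := by simp [dir, look, dirOf, hC, hB]
      have e2 : dir s k i u w = some (endVal s k u) := by simp [dir, look, dirOf, hA, hC]
      rw [e2]; rw [e1] at hjk; simp_all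
    -- If all three lines continue, lines with different next vertices are ordered by the linear
    -- order of neighbours clockwise from `w`, which is transitive.
    have key : ∀ {i j : Fin I.numLines} {a b : Fin I.n} {A B : List (Fin I.n)},
        I.Passes i u w → I.Passes j u w → I.arm i u w = a :: A → I.arm j u w = b :: B → a ≠ b →
        (dir s i j u w = some true ↔ [b, a].Sublist (cutAt (I.rot u) w)) := by
      intro i j a b A B h h' hA hB hab
      have : dir s i j u w = some (clock u w b a) := by simp [dir, look, dirOf, hA, hB, hab]
      rw [this, Option.some.injEq, h'.clock_iff hB]
    have hn := nodup_cutAt_rot h1.adj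
    by_cases hab : a = b
    · subst hab
      by_cases hac : a = c
      · subst hac
        rw [dir_step h1 h2 hA hB] at hij
        rw [dir_step h2 h3 hB hC] at hjk
        rw [dir_step h3 h1 hC hA]
        exact ih (h1.step hA).1 (h2.step hB).1 (h3.step hC).1 hij hjk (h1.step hA).2.1
      · rw [key h2 h3 hB hC hac] at hjk
        rw [Ne, key h3 h1 hC hA (Ne.symm hac)]
        exact pair_sublist_asymm hn hjk
    · rw [key h1 h2 hA hB hab] at hij
      by_cases hbc : b = c
      · subst hbc
        rw [Ne, key h3 h1 hC hA (Ne.symm hab)]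
        exact pair_sublist_asymm hn hij
      · rw [key h2 h3 hB hC hbc] at hjk
        have hca := pair_sublist_trans hn hjk hij
        by_cases hac : a = c
        · subst hac
          exact absurd hij (pair_sublist_asymm hn hjk)
        · rw [Ne, key h3 h1 hC hA (Ne.symm hac)]
          exact pair_sublist_asymm hn hca

end Network

end MetroLine

/-! ### Edge keys and sorting by numbers of predecessors -/

namespace MetroLine

section Keys

/-- A key of the undirected edge between vertices with numbers `a` and `b`. -/
def edgeKey (e : ℕ × ℕ) : ℕ ×ₗ ℕ := toLex (e.1 + e.2, min e.1 e.2)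

theorem edgeKey_swap (a b : ℕ) : edgeKey (a, b) = edgeKey (b, a) := by
  simp [edgeKey, add_comm, min_comm]

theorem edgeKey_snd {e f : ℕ × ℕ} (h : edgeKey e = edgeKey f) : f.2 = e.1 ∨ f.2 = e.2 := by
  simp only [edgeKey, EmbeddingLike.apply_eq_iff_eq, Prod.mk.injEq] at h
  omega

/-- Boolean comparison of edge keys. -/
def keyLt (e f : ℕ × ℕ) : Bool :=
  decide (e.1 + e.2 < f.1 + f.2) ||
    (decide (e.1 + e.2 = f.1 + f.2) && decide (min e.1 e.2 < min f.1 f.2))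

theorem keyLt_iff {e f : ℕ × ℕ} : keyLt e f = true ↔ edgeKey e < edgeKey f := by
  simp [keyLt, edgeKey, Prod.Lex.lt_iff]

/-- Some key of the first list is smaller than all keys of the second. -/
def minB (X Y : List (ℕ × ℕ)) : Bool :=
  X.any fun e => Y.all fun f => keyLt e f

theorem minB_iff {X Y : List (ℕ × ℕ)} :
    minB X Y = true ↔ ∃ e ∈ X, ∀ f ∈ Y, edgeKey e < edgeKey f := by
  simp [minB, keyLt_iff]

theorem exists_min_key {X : List (ℕ × ℕ)} (hX : X ≠ []) :
    ∃ e ∈ X, ∀ f ∈ X, edgeKey e ≤ edgeKey f := by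
  obtain ⟨e, he, h⟩ := X.toFinset.exists_min_image edgeKey (by simpa using hX)
  exact ⟨e, by simpa using he, fun f hf => h f (by simpa using hf)⟩

/-- Both lists attain their minima, and these differ, so exactly one of the two is smaller. -/
theorem minB_not {X Y : List (ℕ × ℕ)} (hX : X ≠ []) (hY : Y ≠ [])
    (h : ∀ e ∈ X, ∀ f ∈ Y, edgeKey e ≠ edgeKey f) : minB Y X = !minB X Y := by
  obtain ⟨e, he, he'⟩ := exists_min_key hX
  obtain ⟨f, hf, hf'⟩ := exists_min_key hY
  rw [Bool.eq_iff_iff, Bool.not_eq_true', ← Bool.not_eq_true, minB_iff, minB_iff]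
  constructor
  · rintro ⟨x, hx, hx'⟩ ⟨y, hy, hy'⟩
    exact lt_asymm (hx' _ hy) (hy' _ hx)
  · intro h1
    push Not at h1
    obtain ⟨g, hg, hg'⟩ := h1 e he
    refine ⟨f, hf, fun x hx => ?_⟩
    refine lt_of_le_of_ne (((hf' g hg).trans hg').trans (he' x hx)) (Ne.symm (h x hx f hf))

variable {α : Type} [DecidableEq α]

/-- The consecutive pairs of the list `u :: C`, as pairs of numbers. -/
def edgesFrom (ν : α → ℕ) (u : α) (C : List α) : List (ℕ × ℕ) :=
  ((u :: C).zip C).map fun e => (ν e.1, ν e.2)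

omit [DecidableEq α] in
@[simp] theorem edgesFrom_cons (ν : α → ℕ) (u a : α) (C : List α) :
    edgesFrom ν u (a :: C) = (ν u, ν a) :: edgesFrom ν a C := by
  simp [edgesFrom]

omit [DecidableEq α] in
@[simp] theorem edgesFrom_nil (ν : α → ℕ) (u : α) : edgesFrom ν u [] = [] := by
  simp [edgesFrom]

omit [DecidableEq α] in
theorem exists_of_mem_edgesFrom {ν : α → ℕ} {u : α} {C : List α} {e : ℕ × ℕ}
    (h : e ∈ edgesFrom ν u C) : ∃ x ∈ u :: C, ∃ y ∈ C, e = (ν x, ν y) := by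
  simp only [edgesFrom, List.mem_map] at h
  obtain ⟨⟨x, y⟩, h, rfl⟩ := h
  exact ⟨x, (List.of_mem_zip h).1, y, (List.of_mem_zip h).2, rfl⟩

/-- With the arms at the ports `(u, w)` and `(w, u)`: the edge with the smallest key on the common
subpath lies beyond `u`. -/
def backMin (ν : α → ℕ) (u w : α) (A B A' B' : List α) : Bool :=
  minB (edgesFrom ν u (commonPrefix A B)) ((ν u, ν w) :: edgesFrom ν w (commonPrefix A' B'))

/-- The order of two lines that is chosen at a port: `X` is the order given by looking back, `Y` the
one at the opposite port. -/
def chooseOrder (bm : Bool) (X Y : Option Bool) : Bool :=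
  if bm then (if Y = none then decide (X = some true) else decide (Y = some false))
  else (if X = none then decide (Y = some false) else decide (X = some true))

/-- Exchanging the two ports and exchanging the two lines cancel out. The absence of crossings both
in vertices and on edges that are not smallest reduces to this symmetry. -/
theorem chooseOrder_swap (bm : Bool) (X Y : Option Bool) :
    chooseOrder (!bm) (Y.map not) (X.map not) = chooseOrder bm X Y := by
  rcases bm with _ | _ <;> rcases X with _ | _ | _ <;> rcases Y with _ | _ | _ <;> rfl

/-- The elements of the list `c`, ordered by their numbers of predecessors. -/
def rankSort {β : Type} (r : β → β → Bool) (c : List β) : List β :=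
  (List.range c.length).flatMap fun k =>
    c.filter fun i => decide ((c.filter fun j => r j i).length = k)

/-- For a strict total order the number of predecessors is strictly increasing, so every rank below
the length is taken by at most one element and listing by ranks sorts. -/
theorem rankSort_spec {β : Type} [DecidableEq β] {r : β → β → Bool} {c : List β} (hc : c.Nodup)
    (hr : ∀ i ∈ c, r i i = false) (ht : ∀ i ∈ c, ∀ j ∈ c, i ≠ j → r i j = !r j i)
    (htr : ∀ i ∈ c, ∀ j ∈ c, ∀ k ∈ c, r i j = true → r j k = true → r i k = true) :
    (rankSort r c).Nodup ∧ (∀ i, i ∈ rankSort r c ↔ i ∈ c) ∧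
      ∀ i j, [i, j].Sublist (rankSort r c) ↔ i ∈ c ∧ j ∈ c ∧ r i j = true := by
  set rk : β → ℕ := fun i => (c.filter fun j => r j i).length with hrk
  have hlt : ∀ i ∈ c, ∀ j ∈ c, r i j = true → rk i < rk j := by
    intro i hi j hj hij
    -- By transitivity the predecessors of `i`, and also `i` itself, are predecessors of `j`.
    have hsub : (i :: c.filter fun k => r k i).Subperm (c.filter fun k => r k j) := by
      refine List.subperm_of_subset ?_ ?_
      · refine List.nodup_cons.2 ⟨by simp [hr i hi], hc.filter _⟩
      · intro k hk
        rcases List.mem_cons.1 hk with rfl | hk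
        · simp [hi, hij]
        · rw [List.mem_filter] at hk ⊢
          exact ⟨hk.1, htr k hk.1 i hi j hj hk.2 hij⟩
    simpa [hrk] using hsub.length_le
  have hinj : ∀ i ∈ c, ∀ j ∈ c, rk i = rk j → i = j := by
    intro i hi j hj hij
    by_contra hne
    cases h : r i j with
    | true => exact absurd (hlt i hi j hj h) (by omega)
    | false =>
      have := ht j hj i hi (Ne.symm hne)
      rw [h] at this
      exact absurd (hlt j hj i hi (by simpa using this)) (by omega)
  have hmem : ∀ i, i ∈ rankSort r c ↔ i ∈ c := by
    intro i
    simp only [rankSort, List.mem_flatMap, List.mem_range, List.mem_filter, decide_eq_true_eq]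
    constructor
    · rintro ⟨k, -, h, -⟩; exact h
    · intro h
      refine ⟨_, ?_, h, rfl⟩
      have hsub : (i :: c.filter fun k => r k i).Subperm c := by
        refine List.subperm_of_subset ?_ ?_
        · refine List.nodup_cons.2 ⟨by simp [hr i h], hc.filter _⟩
        · intro k hk
          rcases List.mem_cons.1 hk with rfl | hk
          · exact h
          · exact (List.mem_filter.1 hk).1
      simpa using hsub.length_le
  have hnd : (rankSort r c).Nodup := by
    rw [rankSort, List.nodup_flatMap]
    refine ⟨fun k _ => hc.filter _, ?_⟩
    refine List.nodup_range.pairwise_of_forall_ne ?_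
    intro k _ l _ hkl x hx hy
    simp only [List.mem_filter, decide_eq_true_eq] at hx hy
    omega
  have hpw : (rankSort r c).Pairwise fun i j => rk i ≤ rk j := by
    rw [rankSort, List.pairwise_flatMap]
    refine ⟨?_, ?_⟩
    · intro k _
      refine List.Pairwise.imp_of_mem (R := fun _ _ => True) ?_ (List.pairwise_of_forall fun _ _ => trivial)
      intro a b ha hb _
      simp only [List.mem_filter, decide_eq_true_eq] at ha hb
      simp only [hrk]; omega
    · refine List.pairwise_lt_range.imp ?_
      intro k l hkl a ha b hb
      simp only [List.mem_filter, decide_eq_true_eq] at ha hb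
      simp only [hrk]; omega
  refine ⟨hnd, hmem, fun i j => ?_⟩
  have key : ∀ i j, [i, j].Sublist (rankSort r c) → i ∈ c ∧ j ∈ c ∧ r i j = true := by
    intro i j h
    have hi := (hmem i).1 (h.subset (by simp))
    have hj := (hmem j).1 (h.subset (by simp))
    have hle : rk i ≤ rk j := by simpa using hpw.sublist h
    have hne : i ≠ j := by simpa using hnd.sublist h
    refine ⟨hi, hj, ?_⟩
    rw [ht i hi j hj hne, Bool.not_eq_true']
    by_contra h1
    have := hlt j hj i hi (by simpa using h1)
    omega
  refine ⟨key i j, ?_⟩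
  rintro ⟨hi, hj, hij⟩
  have hne : i ≠ j := by rintro rfl; rw [hr i hi] at hij; cases hij
  rcases pair_sublist_total ((hmem i).2 hi) ((hmem j).2 hj) hne with h | h
  · exact h
  · have := (key j i h).2.2
    rw [ht i hi j hj hne, this] at hij
    cases hij

end Keys

end MetroLine

/-! ### The constructed order at a port and its transitivity -/

namespace MetroLine
namespace Network

variable {I : Network} {i j k : Fin I.numLines} {u w a : Fin I.n} {s : I.LineEnd → Bool}

/-- The keys of the edges beyond `u` on the common subpath of `i` and `j` through `(u, w)`. -/
def backEdges (i j : Fin I.numLines) (u w : Fin I.n) : List (ℕ × ℕ) :=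
  edgesFrom Fin.val u (commonPrefix (I.arm i u w) (I.arm j u w))

/-- The edge of the port `(u, w)` and the edges beyond `w` on the common subpath. -/
def frontEdges (i j : Fin I.numLines) (u w : Fin I.n) : List (ℕ × ℕ) :=
  (u.val, w.val) :: edgesFrom Fin.val w (commonPrefix (I.arm i w u) (I.arm j w u))

/-- The order of the lines `i` and `j` at the port `(u, w)` in the layout that is constructed: on
each common subpath crossings take place on the edge with the smallest key. -/
def cmp (s : I.LineEnd → Bool) (i j : Fin I.numLines) (u w : Fin I.n) : Bool :=
  chooseOrder
    (backMin Fin.val u w (I.arm i u w) (I.arm j u w) (I.arm i w u) (I.arm j w u))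
    (dir s i j u w) (dir s i j w u)

theorem backMin_eq : backMin Fin.val u w (I.arm i u w) (I.arm j u w) (I.arm i w u) (I.arm j w u) =
    minB (backEdges i j u w) (frontEdges i j u w) := rfl

theorem backEdges_comm : backEdges i j u w = backEdges j i u w := by
  rw [backEdges, commonPrefix_comm, backEdges]

theorem frontEdges_comm : frontEdges i j u w = frontEdges j i u w := by
  rw [frontEdges, commonPrefix_comm, frontEdges]

/-- A simple path traverses every undirected edge at most once, and keys identify undirected edges.
-/
theorem key_ne (h : I.Passes i u w) : ∀ e ∈ backEdges i j u w, ∀ f ∈ frontEdges i j u w,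
    edgeKey e ≠ edgeKey f := by
  intro e he f hf hef
  have hn := List.nodup_append.1 h.nodup
  obtain ⟨x, hx, y, hy, rfl⟩ := exists_of_mem_edgesFrom he
  have hC : ∀ z ∈ commonPrefix (I.arm i u w) (I.arm j u w), z ∈ I.arm i u w :=
    (commonPrefix_prefix _ _).subset
  have hx' : x = u ∨ x ∈ I.arm i u w := (List.mem_cons.1 hx).imp id (hC x)
  have hy' := hC y hy
  -- The second vertex of `f` lies at `w` or beyond, whereas both vertices of `e` lie at `u` or
  -- behind it.
  obtain ⟨z, hz, hz'⟩ : ∃ z ∈ w :: I.arm i w u, f.2 = z.val := by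
    rcases List.mem_cons.1 hf with rfl | hf
    · exact ⟨w, by simp, rfl⟩
    · obtain ⟨p, -, q, hq, rfl⟩ := exists_of_mem_edgesFrom hf
      exact ⟨q, List.mem_cons_of_mem _ ((commonPrefix_prefix _ _).subset hq), rfl⟩
  have hzu : z ∈ u :: w :: I.arm i w u := List.mem_cons_of_mem _ hz
  have hu : u ∉ w :: I.arm i w u := (List.nodup_cons.1 hn.2.1).1
  have h1 : z = x ∨ z = y := by
    have := edgeKey_snd hef
    rw [hz'] at this
    exact this.imp Fin.ext Fin.ext
  rcases h1 with rfl | rfl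
  · rcases hx' with rfl | hx'
    · exact hu hz
    · exact hn.2.2 z (by simpa using hx') z hzu rfl
  · exact hn.2.2 z (by simpa using hy') z hzu rfl

/-- The ports `(u, w)` and `(u, a)` face in opposite directions from the same vertex, so what is
behind for one is in front for the other. -/
theorem edges_step {A B : List (Fin I.n)} (h : I.Passes i u w) (h' : I.Passes j u w)
    (hA : I.arm i u w = a :: A) (hB : I.arm j u w = a :: B) :
    backEdges i j u a = frontEdges i j u w ∧ frontEdges i j u a = backEdges i j u w := by
  obtain ⟨h1, h2, h3⟩ := h.step hA
  obtain ⟨h4, h5, h6⟩ := h'.step hB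
  simp [backEdges, frontEdges, h2, h3, h5, h6, hA, hB, commonPrefix]

/-- At an intermediate vertex of a common subpath there is no vertex crossing. -/
theorem cmp_step {A B : List (Fin I.n)} (h : I.Passes i u w) (h' : I.Passes j u w)
    (hA : I.arm i u w = a :: A) (hB : I.arm j u w = a :: B) :
    cmp s i j u w = cmp s j i u a := by
  obtain ⟨h1, h2, h3⟩ := h.step hA
  obtain ⟨h4, h5, h6⟩ := h'.step hB
  have e1 : dir s j i u a = (dir s i j w u).map not := by
    rw [dir_step h4.symm h1.symm h6 h3, dir_symm h.symm h'.symm]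
  have e2 : dir s j i a u = (dir s i j u w).map not := by
    rw [← dir_step h' h hB hA, dir_symm h h']
  have e3 : backMin Fin.val u a (I.arm j u a) (I.arm i u a) (I.arm j a u) (I.arm i a u) =
      !backMin Fin.val u w (I.arm i u w) (I.arm j u w) (I.arm i w u) (I.arm j w u) := by
    rw [backMin_eq, backMin_eq, backEdges_comm, frontEdges_comm, (edges_step h h' hA hB).1,
      (edges_step h h' hA hB).2]
    refine minB_not ?_ (by simp [frontEdges]) (key_ne h)
    simp [backEdges, hA, hB, commonPrefix]
  rw [cmp, cmp, e1, e2, e3, chooseOrder_swap]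

/-- The edge of the port `(u, w)` does not have the smallest key on the common subpath. -/
def NotMin (i j : Fin I.numLines) (u w : Fin I.n) : Prop :=
  ∃ e, (e ∈ backEdges i j u w ∨ e ∈ frontEdges i j u w) ∧ edgeKey e < edgeKey (u.val, w.val)

theorem frontEdges_eq : frontEdges i j u w = (u.val, w.val) :: backEdges i j w u := rfl

/-- The smallest key lies strictly to one side of the edge, so it is behind exactly one of the two
ports of this edge. -/
theorem minB_swap_of_notMin (h : I.Passes i u w) (hm : NotMin i j u w) :
    backMin Fin.val w u (I.arm i w u) (I.arm j w u) (I.arm i u w) (I.arm j u w) =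
      !backMin Fin.val u w (I.arm i u w) (I.arm j u w) (I.arm i w u) (I.arm j w u) := by
  rw [backMin_eq, backMin_eq]
  obtain ⟨e, he, hlt⟩ := hm
  have hd := key_ne h (j := j)
  have hd' := key_ne h.symm (j := j)
  simp only [frontEdges_eq] at he hd hd' ⊢
  have hs := edgeKey_swap w.val u.val
  set X := backEdges i j u w
  set Y := backEdges i j w u
  have he : e ∈ X ∨ e ∈ Y := by
    rcases he with he | he
    · exact Or.inl he
    · rcases List.mem_cons.1 he with rfl | he
      · exact absurd hlt (lt_irrefl _)
      · exact Or.inr he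
  rw [Bool.eq_iff_iff, Bool.not_eq_true', ← Bool.not_eq_true, minB_iff, minB_iff]
  constructor
  · rintro ⟨x, hx, hx'⟩ ⟨y, hy, hy'⟩
    exact lt_asymm (hx' y (List.mem_cons_of_mem _ hy)) (hy' x (List.mem_cons_of_mem _ hx))
  · intro h1
    obtain ⟨m, hm, hm'⟩ := exists_min_key (X := X ++ Y)
      (by rcases he with he | he <;> intro h0 <;> simp_all)
    rcases List.mem_append.1 hm with hm | hm
    · exfalso
      apply h1
      refine ⟨m, hm, fun f hf => ?_⟩
      refine lt_of_le_of_ne ?_ (hd m hm f hf)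
      rcases List.mem_cons.1 hf with rfl | hf
      · exact (hm' e (List.mem_append.2 he)).trans hlt.le
      · exact hm' f (by simp [hf])
    · refine ⟨m, hm, fun f hf => ?_⟩
      refine lt_of_le_of_ne ?_ (hd' m hm f hf)
      rcases List.mem_cons.1 hf with rfl | hf
      · rw [hs]; exact (hm' e (List.mem_append.2 he)).trans hlt.le
      · exact hm' f (List.mem_append.2 (Or.inl hf))

/-- On edges that do not have the smallest key the lines do not cross. -/
theorem cmp_swap_of_notMin (h : I.Passes i u w) (h' : I.Passes j u w) (hm : NotMin i j u w) :
    cmp s i j u w = cmp s j i w u := by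
  rw [cmp, cmp, dir_symm h h', dir_symm h.symm h'.symm, ← chooseOrder_swap]
  congr 1
  rw [backMin_eq (i := j), backEdges_comm, frontEdges_comm, ← backMin_eq,
    minB_swap_of_notMin h hm]

theorem cmp_of_separate (h : I.Separate i j u w) :
    cmp s i j u w = chooseOrder false (dir s i j u w) (dir s i j w u) := by
  rw [cmp, backMin_eq, backEdges, h]
  rfl

/-- By properness at least one of the two directions of view determines an order, so `chooseOrder`
never has to decide between two undetermined values. -/
theorem cmp_antisymm (hI : I.IsProper) (hij : i ≠ j) (h : I.Passes i u w) (h' : I.Passes j u w) :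
    cmp s i j u w = !cmp s j i u w := by
  have h1 := hI.dir_ne_none (s := s) hij h h'
  rw [cmp, cmp, dir_symm h h', dir_symm h.symm h'.symm, backMin_eq (i := j), backEdges_comm,
    frontEdges_comm, ← backMin_eq]
  generalize backMin Fin.val u w (I.arm i u w) (I.arm j u w) (I.arm i w u) (I.arm j w u) = b
  revert h1
  generalize dir s i j u w = X
  generalize dir s i j w u = Y
  rcases b with _ | _ <;> rcases X with _ | _ | _ <;> rcases Y with _ | _ | _ <;>
    simp [chooseOrder]

theorem dir_self (h : I.Passes i u w) : dir s i i u w = none :=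
  (dir_eq_none_iff h h).2 rfl

/-- Line ends at the same port are placed at different sides only if this does not cause a
crossing. -/
def Good (s : I.LineEnd → Bool) : Prop :=
  ∀ i k u w, i ≠ k → I.Passes i u w → I.Passes k u w → I.arm i u w = [] → I.arm k u w = [] →
    endVal s i u = true → endVal s k u = false → dir s i k w u ≠ some true

section Local

theorem dir_nil_cons (hA : I.arm i u w = []) (hB : I.arm j u w ≠ []) :
    I.Separate i j u w ∧ dir s i j u w = some (endVal s i u) := by
  obtain ⟨b, B, hB⟩ := List.exists_cons_of_ne_nil hB
  simp [dir, look, dirOf, hA, hB, Separate, commonPrefix]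

theorem dir_cons_nil (hA : I.arm i u w ≠ []) (hB : I.arm j u w = []) :
    I.Separate i j u w ∧ dir s i j u w = some (!endVal s j u) := by
  obtain ⟨b, B, hA⟩ := List.exists_cons_of_ne_nil hA
  simp [dir, look, dirOf, hA, hB, Separate, commonPrefix]

theorem dir_nil_nil (hA : I.arm i u w = []) (hB : I.arm j u w = []) :
    I.Separate i j u w ∧ dir s i j u w = none := by
  simp [dir, look, dirOf, hA, hB, Separate, commonPrefix]

theorem dir_cons_cons {b : Fin I.n} {A B : List (Fin I.n)} (h' : I.Passes j u w)
    (hA : I.arm i u w = a :: A) (hB : I.arm j u w = b :: B) (hab : a ≠ b) :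
    I.Separate i j u w ∧ ∃ v, dir s i j u w = some v ∧
      (v = true ↔ [b, a].Sublist (cutAt (I.rot u) w)) := by
  refine ⟨by simp [Separate, hA, hB, commonPrefix, hab], clock u w b a, ?_, h'.clock_iff hB⟩
  simp [dir, look, dirOf, hA, hB, hab]

theorem cmp_nil_cons (hA : I.arm i u w = []) (hB : I.arm j u w ≠ []) :
    cmp s i j u w = endVal s i u := by
  obtain ⟨h1, h2⟩ := dir_nil_cons (s := s) hA hB
  rw [cmp_of_separate h1, h2]; simp [chooseOrder]

theorem cmp_cons_nil (hA : I.arm i u w ≠ []) (hB : I.arm j u w = []) :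
    cmp s i j u w = !endVal s j u := by
  obtain ⟨h1, h2⟩ := dir_cons_nil (s := s) hA hB
  rw [cmp_of_separate h1, h2]; simp [chooseOrder]

theorem cmp_nil_nil (hA : I.arm i u w = []) (hB : I.arm j u w = []) :
    cmp s i j u w = true ↔ dir s i j w u = some false := by
  obtain ⟨h1, h2⟩ := dir_nil_nil (s := s) hA hB
  rw [cmp_of_separate h1, h2]; simp [chooseOrder]

theorem cmp_cons_cons {b : Fin I.n} {A B : List (Fin I.n)} (h' : I.Passes j u w)
    (hA : I.arm i u w = a :: A) (hB : I.arm j u w = b :: B) (hab : a ≠ b) :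
    cmp s i j u w = true ↔ [b, a].Sublist (cutAt (I.rot u) w) := by
  obtain ⟨h1, v, h2, h3⟩ := dir_cons_cons (s := s) h' hA hB hab
  rw [cmp_of_separate h1, h2, ← h3]; simp [chooseOrder]

end Local

/-- If all three lines end, their order is the reverse of the order seen from the opposite port,
which is acyclic. If exactly two end, the third forces different values on them, and `Good` excludes
the order that would close the cycle. If only `i` ends, its value puts it on one side of both
others. -/
theorem cmp_acyclic_of_nil (hs : Good s) (hik : i ≠ k)
    (hji : j ≠ i) (h1 : I.Passes i u w) (h2 : I.Passes j u w) (h3 : I.Passes k u w)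
    (hA : I.arm i u w = []) (hij : cmp s i j u w = true) (hjk : cmp s j k u w = true) :
    cmp s k i u w = false := by
  by_contra hki
  rw [Bool.not_eq_false] at hki
  -- Of two lines that end here, one with value `true` cannot come after one with value `false`.
  have aux : ∀ p q : Fin I.numLines, p ≠ q → I.Passes p u w → I.Passes q u w →
      I.arm p u w = [] → I.arm q u w = [] → endVal s p u = true → endVal s q u = false →
      cmp s q p u w = true → False := by
    intro p q hpq hp hq hp' hq' e1 e2 e3
    rw [cmp_nil_nil hq' hp', dir_symm hp.symm hq.symm] at e3
    refine hs p q u w hpq hp hq hp' hq' e1 e2 ?_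
    cases h : dir s p q w u <;> simp_all
  by_cases hB : I.arm j u w = [] <;> by_cases hC : I.arm k u w = []
  · rw [cmp_nil_nil hA hB] at hij
    rw [cmp_nil_nil hB hC] at hjk
    rw [cmp_nil_nil hC hA] at hki
    refine dir_acyclic (s := s) (i := j) (j := i) (k := k) h2.symm h1.symm h3.symm ?_ ?_ ?_
    · rw [dir_symm h1.symm h2.symm, hij]; rfl
    · rw [dir_symm h3.symm h1.symm, hki]; rfl
    · rw [dir_symm h2.symm h3.symm, hjk]; rfl
  · rw [cmp_nil_cons hB hC] at hjk
    rw [cmp_cons_nil hC hA] at hki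
    exact aux j i hji h2 h1 hB hA hjk (by simpa using hki) hij
  · rw [cmp_nil_cons hA hB] at hij
    rw [cmp_cons_nil hB hC] at hjk
    exact aux i k hik h1 h3 hA hC hij (by simpa using hjk) hki
  · rw [cmp_nil_cons hA hB] at hij
    rw [cmp_cons_nil hC hA] at hki
    simp_all

/-- There are no cycles of length three at ports where three lines do not continue together. -/
theorem cmp_acyclic_local (hs : Good s) (hij' : i ≠ j) (hjk' : j ≠ k)
    (hik : i ≠ k) (h1 : I.Passes i u w) (h2 : I.Passes j u w) (h3 : I.Passes k u w)
    (hl : ¬ ∃ a A B C, I.arm i u w = a :: A ∧ I.arm j u w = a :: B ∧ I.arm k u w = a :: C)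
    (hij : cmp s i j u w = true) (hjk : cmp s j k u w = true) : cmp s k i u w = false := by
  by_contra hki
  rw [Bool.not_eq_false] at hki
  rcases hA : I.arm i u w with _ | ⟨a, A⟩
  · have := cmp_acyclic_of_nil hs hik hij'.symm h1 h2 h3 hA hij hjk
    simp_all
  rcases hB : I.arm j u w with _ | ⟨b, B⟩
  · have := cmp_acyclic_of_nil hs hij'.symm hjk'.symm h2 h3 h1 hB hjk hki
    simp_all
  rcases hC : I.arm k u w with _ | ⟨c, C⟩
  · have := cmp_acyclic_of_nil hs hjk'.symm hik h3 h1 h2 hC hki hij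
    simp_all
  have hn := nodup_cutAt_rot h1.adj
  by_cases hab : a = b
  · subst hab
    have hac : a ≠ c := by rintro rfl; exact hl ⟨a, A, B, C, hA, hB, hC⟩
    rw [cmp_cons_cons h3 hB hC hac] at hjk
    rw [cmp_cons_cons h1 hC hA hac.symm] at hki
    exact pair_sublist_asymm hn hjk hki
  · rw [cmp_cons_cons h2 hA hB hab] at hij
    by_cases hbc : b = c
    · subst hbc
      rw [cmp_cons_cons h1 hC hA (Ne.symm hab)] at hki
      exact pair_sublist_asymm hn hij hki
    · rw [cmp_cons_cons h3 hB hC hbc] at hjk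
      have hca := pair_sublist_trans hn hjk hij
      by_cases hac : a = c
      · subst hac
        exact absurd hij (pair_sublist_asymm hn hjk)
      · rw [cmp_cons_cons h1 hC hA (Ne.symm hac)] at hki
        exact pair_sublist_asymm hn hca hki

/-- There are no cycles of length three if the smallest key on the common subpath of the three lines
is not beyond `u`. -/
theorem cmp_acyclic_back (hs : Good s) (hij' : i ≠ j) (hjk' : j ≠ k)
    (hik : i ≠ k) (h1 : I.Passes i u w) (h2 : I.Passes j u w) (h3 : I.Passes k u w) (κ : ℕ × ℕ)
    (e1 : κ ∈ frontEdges i j u w) (e2 : κ ∈ frontEdges j k u w) (e3 : κ ∈ frontEdges k i u w)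
    (hκ : ∀ e ∈ edgesFrom Fin.val u (commonPrefix (I.arm i u w)
      (commonPrefix (I.arm j u w) (I.arm k u w))), edgeKey κ < edgeKey e)
    (hij : cmp s i j u w = true) (hjk : cmp s j k u w = true) : cmp s k i u w = false := by
  induction hA : I.arm i u w generalizing u w with
  | nil => exact cmp_acyclic_local hs hij' hjk' hik h1 h2 h3 (by simp [hA]) hij hjk
  | cons a A ih =>
    by_cases hl : ∃ a A B C, I.arm i u w = a :: A ∧ I.arm j u w = a :: B ∧ I.arm k u w = a :: C
    · obtain ⟨a', A', B, C, hA', hB, hC⟩ := hl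
      rw [hA] at hA'
      obtain ⟨rfl, rfl⟩ := List.cons.inj hA'
      obtain ⟨p1, p2, p3⟩ := h1.step hA
      obtain ⟨q1, q2, q3⟩ := h2.step hB
      obtain ⟨r1, r2, r3⟩ := h3.step hC
      -- Each pair has an edge with a smaller key than `{u, a}`, so no pair crosses on that edge,
      -- nor in `u`; the cycle moves on to the port `(a, u)`.
      have hlt : edgeKey κ < edgeKey (u.val, a.val) := hκ _ (by simp [hA, hB, hC, commonPrefix])
      have t : ∀ {i j : Fin I.numLines} {A B : List (Fin I.n)}, I.Passes i u w → I.Passes j u w →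
          I.arm i u w = a :: A → I.arm j u w = a :: B → κ ∈ frontEdges i j u w →
          cmp s i j u w = cmp s i j a u ∧ κ ∈ frontEdges i j a u := by
        intro i j A B h h' hA hB hm
        have e1 := (edges_step h h' hA hB).1
        constructor
        · rw [cmp_step h h' hA hB, cmp_swap_of_notMin (h'.step hB).1.symm (h.step hA).1.symm]
          refine ⟨κ, Or.inl ?_, hlt⟩
          rw [backEdges_comm, e1]; exact hm
        · rw [frontEdges_eq]
          refine List.mem_cons_of_mem _ ?_
          rw [e1]; exact hm
      obtain ⟨t1, t1'⟩ := t h1 h2 hA hB e1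
      obtain ⟨t2, t2'⟩ := t h2 h3 hB hC e2
      obtain ⟨t3, t3'⟩ := t h3 h1 hC hA e3
      rw [t3]
      refine ih p1 q1 r1 t1' t2' t3' ?_ (t1 ▸ hij) (t2 ▸ hjk) p2
      intro e he
      refine hκ e ?_
      rw [p2, q2, r2] at he
      simp [hA, hB, hC, commonPrefix, he]
    · exact cmp_acyclic_local hs hij' hjk' hik h1 h2 h3 hl hij hjk

/-- Let `m` have the smallest key on the part common to all three lines. The edges of this part
other than `m` carry no crossing of two of the lines, whatever smaller edges the pairs have
elsewhere. If `m` is not behind `u`, a cycle can be traced back from the port to where the lines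
separate. Otherwise it survives the change to the port `(w, u)`, with the cyclic order reversed, and
is traced in the other direction. -/
theorem cmp_acyclic (hs : Good s) (hij' : i ≠ j) (hjk' : j ≠ k)
    (hik : i ≠ k) (h1 : I.Passes i u w) (h2 : I.Passes j u w) (h3 : I.Passes k u w)
    (hij : cmp s i j u w = true) (hjk : cmp s j k u w = true) : cmp s k i u w = false := by
  set X := edgesFrom Fin.val u (commonPrefix (I.arm i u w)
      (commonPrefix (I.arm j u w) (I.arm k u w))) with hX
  set Y := edgesFrom Fin.val w (commonPrefix (I.arm i w u)
      (commonPrefix (I.arm j w u) (I.arm k w u))) with hY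
  have sub : ∀ (x : Fin I.n) {C D : List (Fin I.n)}, C <+: D →
      edgesFrom Fin.val x C ⊆ edgesFrom Fin.val x D := by
    rintro x C _ ⟨D, rfl⟩
    induction C generalizing x with
    | nil => simp
    | cons c C ih => simpa using List.subset_cons_of_subset _ (ih c)
  have pre : ∀ A B C : List (Fin I.n),
      commonPrefix A (commonPrefix B C) <+: commonPrefix A B ∧
      commonPrefix A (commonPrefix B C) <+: commonPrefix B C ∧
      commonPrefix A (commonPrefix B C) <+: commonPrefix C A := by
    intro A B C
    have f1 := commonPrefix_prefix A (commonPrefix B C)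
    have f2 := commonPrefix_prefix' A (commonPrefix B C)
    have f3 := f2.trans (commonPrefix_prefix B C)
    have f4 := f2.trans (commonPrefix_prefix' B C)
    exact ⟨prefix_commonPrefix f1 f3, f2, prefix_commonPrefix f4 f1⟩
  obtain ⟨a1, a2, a3⟩ := pre (I.arm i u w) (I.arm j u w) (I.arm k u w)
  obtain ⟨b1, b2, b3⟩ := pre (I.arm i w u) (I.arm j w u) (I.arm k w u)
  have hXb : X ⊆ backEdges i j u w := sub u a1
  have hYb : Y ⊆ backEdges i j w u := sub w b1
  obtain ⟨m, hm, hm'⟩ := exists_min_key (X := (u.val, w.val) :: (X ++ Y)) (by simp)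
  by_cases hmf : m ∈ (u.val, w.val) :: Y
  · have hsub : ∀ i j : Fin I.numLines, Y ⊆ backEdges i j w u → m ∈ frontEdges i j u w := by
      intro i j h
      rw [frontEdges_eq]
      rcases List.mem_cons.1 hmf with rfl | hmf
      · simp
      · exact List.mem_cons_of_mem _ (h hmf)
    refine cmp_acyclic_back hs hij' hjk' hik h1 h2 h3 m (hsub _ _ (sub w b1))
      (hsub _ _ (sub w b2)) (hsub _ _ (sub w b3)) ?_ hij hjk
    intro e he
    refine lt_of_le_of_ne (hm' e (by simp [hX, he])) ?_
    exact (key_ne h1 e (hXb he) m (hsub _ _ (sub w b1))).symm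
  · have hmX : m ∈ X := by
      simp only [List.mem_cons, List.mem_append] at hm hmf
      tauto
    have hlt : edgeKey m < edgeKey (u.val, w.val) := by
      refine lt_of_le_of_ne (hm' _ (by simp)) (key_ne h1 m (hXb hmX) _ ?_)
      rw [frontEdges_eq]; simp
    have t : ∀ {i j : Fin I.numLines}, I.Passes i u w → I.Passes j u w →
        X ⊆ backEdges i j u w → cmp s i j u w = cmp s j i w u ∧ m ∈ frontEdges j i w u := by
      intro i j h h' hX'
      refine ⟨cmp_swap_of_notMin h h' ⟨m, Or.inl (hX' hmX), hlt⟩, ?_⟩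
      rw [frontEdges_comm, frontEdges_eq]
      exact List.mem_cons_of_mem _ (hX' hmX)
    obtain ⟨t1, t1'⟩ := t h1 h2 (sub u a1)
    obtain ⟨t2, t2'⟩ := t h2 h3 (sub u a2)
    obtain ⟨t3, t3'⟩ := t h3 h1 (sub u a3)
    by_contra hki
    rw [Bool.not_eq_false] at hki
    rw [t1] at hij
    rw [t2] at hjk
    rw [t3] at hki
    have := cmp_acyclic_back hs hik hjk'.symm hij' h1.symm h3.symm h2.symm m t3' t2' t1' ?_
      hki hjk
    · simp_all
    intro e he
    have heY : e ∈ Y := by rw [hY, commonPrefix_comm (I.arm j w u)]; exact he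
    refine lt_of_le_of_ne (hm' e (by simp [heY])) ?_
    refine (key_ne h1 m (hXb hmX) e ?_)
    rw [frontEdges_eq]
    exact List.mem_cons_of_mem _ (hYb heY)

theorem cmp_trans (hI : I.IsProper) (hs : Good s) (h1 : I.Passes i u w) (h2 : I.Passes j u w)
    (h3 : I.Passes k u w) (hij : cmp s i j u w = true) (hjk : cmp s j k u w = true) :
    cmp s i k u w = true := by
  by_cases e1 : i = j
  · subst e1; exact hjk
  by_cases e2 : j = k
  · subst e2; exact hij
  by_cases e3 : i = k
  · subst e3
    rw [cmp_antisymm hI e1 h1 h2, hjk] at hij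
    cases hij
  · rw [cmp_antisymm hI e3 h1 h3, cmp_acyclic hs e1 e2 e3 h1 h2 h3 hij hjk]; rfl

theorem cmp_self (h : I.Passes i u w) : cmp s i i u w = false := by
  rw [cmp, dir_self h, dir_self h.symm]
  cases backMin Fin.val u w (I.arm i u w) (I.arm i u w) (I.arm i w u) (I.arm i w u) <;> rfl

end Network
end MetroLine

/-! ### Vertex crossings -/

namespace MetroLine

section Rotation

variable {β : Type} [DecidableEq β]

/-- The restriction of a list to two elements. -/
def restrict (i j : β) (L : List β) : List β := L.filter fun x => decide (x = i ∨ x = j)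

theorem restrict_append (i j : β) (L M : List β) :
    restrict i j (L ++ M) = restrict i j L ++ restrict i j M := List.filter_append ..

theorem sublist_restrict {i j : β} {L M : List β} (hM : ∀ x ∈ M, x = i ∨ x = j) :
    M.Sublist (restrict i j L) ↔ M.Sublist L := by
  constructor
  · intro h; exact h.trans List.filter_sublist
  · intro h
    have : restrict i j M = M := by simpa [restrict, List.filter_eq_self] using hM
    rw [← this]
    exact h.filter _

theorem restrict_rotated {i j : β} {L M : List β} (h : L.IsRotated M) :
    (restrict i j L).IsRotated (restrict i j M) := by
  obtain ⟨k, hk, rfl⟩ := List.isRotated_iff_mod.1 h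
  rw [List.rotate_eq_drop_append_take hk, restrict_append]
  conv_lhs => rw [← List.take_append_drop k L, restrict_append]
  exact List.isRotated_append

theorem restrict_eq_pair {i j : β} {L : List β} (hL : L.Nodup) (h : [i, j].Sublist L) :
    restrict i j L = [i, j] := by
  have h1 : [i, j].Sublist (restrict i j L) := (sublist_restrict (by simp)).2 h
  refine (h1.eq_of_length_le ?_).symm
  have : (restrict i j L).Subperm [i, j] :=
    List.subperm_of_subset (hL.filter _) (by intro x; simp [restrict])
  exact this.length_le

theorem restrict_eq_left {i j : β} {L : List β} (hL : L.Nodup) (h : i ∈ L) (h' : j ∉ L) :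
    restrict i j L = [i] := by
  have h1 : [i].Sublist (restrict i j L) :=
    (sublist_restrict (by simp)).2 (List.singleton_sublist.2 h)
  refine (h1.eq_of_length_le ?_).symm
  have : (restrict i j L).Subperm [i] := by
    refine List.subperm_of_subset (hL.filter _) ?_
    intro x hx
    simp only [restrict, List.mem_filter, decide_eq_true_eq] at hx
    rcases hx with ⟨hx, rfl | rfl⟩
    · simp
    · exact absurd hx h'
  exact this.length_le

theorem restrict_comm (i j : β) (L : List β) : restrict i j L = restrict j i L := by
  simp [restrict, or_comm]

theorem restrict_eq_nil {i j : β} {L : List β} (h : i ∉ L) (h' : j ∉ L) :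
    restrict i j L = [] := by
  rw [restrict, List.filter_eq_nil_iff]
  intro x hx
  simp only [decide_eq_true_eq]
  rintro (rfl | rfl) <;> contradiction

/-- Two elements alternate in the cyclic list `L`. -/
def Alternate (i j : β) (L : List β) : Prop :=
  ∃ r, r.IsRotated L ∧ [i, j, i, j].Sublist r

omit [DecidableEq β] in
theorem Alternate.of_rotated {i j : β} {L M : List β} (h : Alternate i j L)
    (hM : L.IsRotated M) : Alternate i j M := by
  obtain ⟨r, h1, h2⟩ := h
  exact ⟨r, h1.trans hM, h2⟩

/-- Only the occurrences of the two elements matter: a place where the restricted list is cut open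
lifts to a place in any list with this restriction. -/
theorem Alternate.of_restrict_eq {i j : β} {L M : List β} (h : Alternate i j L)
    (hM : restrict i j L = restrict i j M) : Alternate i j M := by
  obtain ⟨r, h1, h2⟩ := h
  obtain ⟨k, hk, rfl⟩ := List.isRotated_iff_mod.1 h1.symm
  rw [List.rotate_eq_drop_append_take hk] at h2
  rw [← List.take_append_drop k L, restrict_append] at hM
  obtain ⟨A, B, rfl, hA, hB⟩ := List.filter_eq_append_iff.1 hM.symm
  refine ⟨B ++ A, List.isRotated_append, ?_⟩
  rw [← sublist_restrict (i := i) (j := j) (by simp)] at h2 ⊢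
  rw [restrict_append] at h2 ⊢
  change restrict i j A = _ at hA
  change restrict i j B = _ at hB
  rwa [hA, hB]

theorem alternate_of_restrict {i j : β} {L : List β}
    (h : restrict i j L = [i, j, i, j] ∨ restrict i j L = [j, i, j, i]) : Alternate i j L := by
  rcases h with h | h
  · exact ⟨L, List.IsRotated.refl _, (sublist_restrict (i := i) (j := j) (by simp)).1 (by rw [h])⟩
  · have h0 : Alternate i j [j, i, j, i] := ⟨[i, j, i, j], ⟨1, rfl⟩, List.Sublist.refl _⟩
    refine h0.of_restrict_eq ?_
    rw [h]; simp [restrict]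

/-- The four occurrences use up the whole restriction, and the rotations of the alternating pattern
are just these two. -/
theorem alternate_iff_of_restrict {i j : β} {L : List β}
    (hL : (restrict i j L).length = 4) : Alternate i j L ↔
      restrict i j L = [i, j, i, j] ∨ restrict i j L = [j, i, j, i] := by
  refine ⟨?_, alternate_of_restrict⟩
  rintro ⟨r, h1, h2⟩
  have h3 := restrict_rotated (i := i) (j := j) h1
  rw [← sublist_restrict (i := i) (j := j) (by simp)] at h2
  have h4 := h2.eq_of_length_le (by rw [h3.perm.length_eq, hL]; rfl)
  rw [← h4] at h3
  obtain ⟨k, hk, h5⟩ := List.isRotated_iff_mod.1 h3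
  simp only [List.length_cons, List.length_nil] at hk
  rw [← h5]
  interval_cases k <;> simp

omit [DecidableEq β] in
theorem flatMap_rotated {γ : Type} {L M : List γ} (g : γ → List β) (h : L.IsRotated M) :
    (L.flatMap g).IsRotated (M.flatMap g) := by
  obtain ⟨k, hk, rfl⟩ := List.isRotated_iff_mod.1 h
  rw [List.rotate_eq_drop_append_take hk, List.flatMap_append]
  conv_lhs => rw [← List.take_append_drop k L, List.flatMap_append]
  exact List.isRotated_append

theorem restrict_flatMap {γ : Type} (i j : β) (L : List γ) (g : γ → List β) :
    restrict i j (L.flatMap g) = L.flatMap fun v => restrict i j (g v) := by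
  simp [restrict, List.filter_flatMap]

omit [DecidableEq β] in
theorem flatMap_restrict {γ : Type} [DecidableEq γ] (a b : γ) (L : List γ) {g : γ → List β}
    (hg : ∀ v ∈ L, v ≠ a → v ≠ b → g v = []) : L.flatMap g = (restrict a b L).flatMap g := by
  induction L with
  | nil => rfl
  | cons c L ih =>
    have ih := ih fun v hv => hg v (List.mem_cons_of_mem _ hv)
    by_cases hc : c = a ∨ c = b
    · simp only [restrict, List.flatMap_cons, List.filter_cons, hc, decide_true, if_true] at ih ⊢
      rw [ih]
    · rw [List.flatMap_cons, hg c (by simp) (by tauto) (by tauto), List.nil_append, ih]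
      simp [restrict, hc]

end Rotation

namespace Network

variable {I : Network} {i j k : Fin I.numLines} {u w v a b : Fin I.n} {π : I.Orders}

/-- As `u` occurs only once on the line, the line uses no ports of `u` other than those towards its
two neighbours on the line. -/
theorem Passes.passes_iff (h : I.Passes i u w) :
    I.Passes i u v ↔ v = w ∨ (I.arm i u w).head? = some v := by
  constructor
  · intro h'
    have n1 := h.portSplit
    have n2 := h'.portSplit
    have hn := I.nodup_line i
    have hn' := List.nodup_reverse.2 hn
    have key : ∀ l : List (Fin I.n), l.Nodup →
        ∀ X Y X' Y', l = X ++ u :: Y → l = X' ++ u :: Y' → Y = Y' := by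
      intro l hl X Y X' Y' h1 h2
      rw [← afterFirst_eq hl h1, ← afterFirst_eq hl h2]
    rcases n1 with n1 | n1 <;> rcases n2 with n2 | n2
    · left
      have := key _ hn _ _ _ _ n1.symm n2.symm
      simp at this; exact this.1.symm
    · right
      have n1 : (I.line i).reverse = (I.arm i w u).reverse ++ [w] ++ u :: I.arm i u w := by
        rw [← n1]; simp
      rw [key _ hn' _ _ _ _ n1 n2.symm]; rfl
    · right
      have n1 : I.line i = (I.arm i w u).reverse ++ [w] ++ u :: I.arm i u w := by
        rw [← List.reverse_reverse (I.line i), ← n1]; simp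
      rw [key _ hn _ _ _ _ n1 n2.symm]; rfl
    · left
      have := key _ hn' _ _ _ _ n1.symm n2.symm
      simp at this; exact this.1.symm
  · rintro (rfl | h')
    · exact h
    · obtain ⟨A, hA⟩ := List.head?_eq_some_iff.1 h'
      exact (h.step hA).1.symm

theorem orderAround_rotated (h : I.graph.Adj u w) :
    (orderAround π u).IsRotated ((w :: cutAt (I.rot u) w).flatMap (π u)) :=
  flatMap_rotated _ (cons_cutAt ((I.mem_rot u w).2 h)).symm

theorem vertexCrossing_iff (h : I.graph.Adj u w) : VertexCrossing π u i j ↔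
    i ≠ j ∧ Alternate i j ((w :: cutAt (I.rot u) w).flatMap (π u)) := by
  refine and_congr Iff.rfl ⟨fun h' => ?_, fun h' => ?_⟩
  · exact Alternate.of_rotated h' (orderAround_rotated h)
  · exact h'.of_rotated (orderAround_rotated h).symm

theorem IsLayout.total (hπ : I.IsLayout π) (hij : i ≠ j) (h : I.Passes i u w)
    (h' : I.Passes j u w) : ¬ [i, j].Sublist (π u w) ↔ [j, i].Sublist (π u w) :=
  pair_sublist_not_iff (hπ u w).1 (((hπ u w).2 i).2 h) (((hπ u w).2 j).2 h') hij

theorem IsLayout.restrict_pair (hπ : I.IsLayout π) (hij : i ≠ j) (h : I.Passes i u w)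
    (h' : I.Passes j u w) :
    restrict i j (π u w) = [i, j] ∧ [i, j].Sublist (π u w) ∨
      restrict i j (π u w) = [j, i] ∧ ¬ [i, j].Sublist (π u w) := by
  by_cases hs : [i, j].Sublist (π u w)
  · exact Or.inl ⟨restrict_eq_pair (hπ u w).1 hs, hs⟩
  · right
    refine ⟨?_, hs⟩
    rw [restrict_comm]
    exact restrict_eq_pair (hπ u w).1 ((hπ.total hij h h').1 hs)

/-- Around `u` the two lines occur at the ports towards `w` and `a` only, and two pairs in cyclic
order alternate if and only if they are ordered alike. -/
theorem vertexCrossing_iff_of_common {A B : List (Fin I.n)} (hπ : I.IsLayout π) (hij : i ≠ j)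
    (h : I.Passes i u w) (h' : I.Passes j u w) (hA : I.arm i u w = a :: A)
    (hB : I.arm j u w = a :: B) :
    VertexCrossing π u i j ↔ ([i, j].Sublist (π u w) ↔ [i, j].Sublist (π u a)) := by
  have hn := nodup_cutAt_rot h.adj
  have hr : restrict a a (cutAt (I.rot u) w) = [a] := by
    have h1 : [a].Sublist (restrict a a (cutAt (I.rot u) w)) :=
      (sublist_restrict (by simp)).2 (List.singleton_sublist.2 (h.mem_cutAt hA))
    refine (h1.eq_of_length_le ?_).symm
    exact (List.subperm_of_subset (hn.filter _) (by intro x; simp)).length_le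
  have hf : restrict i j ((w :: cutAt (I.rot u) w).flatMap (π u)) =
      restrict i j (π u w) ++ restrict i j (π u a) := by
    rw [List.flatMap_cons, restrict_append, restrict_flatMap, flatMap_restrict a a, hr]
    · simp
    · intro v hv hva _
      have hvw := ((mem_cutAt_rot h.adj).1 hv).2
      refine restrict_eq_nil ?_ ?_
      · rw [(hπ u v).2, h.passes_iff, hA]; simp [hvw, Ne.symm hva]
      · rw [(hπ u v).2, h'.passes_iff, hB]; simp [hvw, Ne.symm hva]
  have hi := (h.step hA).1.symm
  have hj := (h'.step hB).1.symm
  have r1 := hπ.restrict_pair hij h h'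
  have r2 := hπ.restrict_pair hij hi hj
  rw [vertexCrossing_iff h.adj, and_iff_right hij, alternate_iff_of_restrict, hf]
  · rcases r1 with ⟨r1, r1'⟩ | ⟨r1, r1'⟩ <;> rcases r2 with ⟨r2, r2'⟩ | ⟨r2, r2'⟩ <;>
      simp [r1, r2, r1', r2', hij, hij.symm]
  · rw [hf]
    rcases r1 with ⟨r1, -⟩ | ⟨r1, -⟩ <;> rcases r2 with ⟨r2, -⟩ | ⟨r2, -⟩ <;> simp [r1, r2]

/-- Starting at the port towards `w`, one meets both lines there, and then `i` and `j` once more in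
the clockwise order of `a` and `b`. Without alternation the second order is the reverse of the
first. -/
theorem vertexCrossing_iff_of_split {A B : List (Fin I.n)} (hπ : I.IsLayout π) (hij : i ≠ j)
    (h : I.Passes i u w) (h' : I.Passes j u w) (hA : I.arm i u w = a :: A)
    (hB : I.arm j u w = b :: B) (hab : a ≠ b) :
    VertexCrossing π u i j ↔
      ¬ ([i, j].Sublist (π u w) ↔ [b, a].Sublist (cutAt (I.rot u) w)) := by
  have hn := nodup_cutAt_rot h.adj
  have hac := h.mem_cutAt hA
  have hbc := h'.mem_cutAt hB
  have hwa := ((mem_cutAt_rot h.adj).1 hac).2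
  have hwb := ((mem_cutAt_rot h.adj).1 hbc).2
  have ha : restrict i j (π u a) = [i] := by
    refine restrict_eq_left (hπ u a).1 ?_ ?_
    · rw [(hπ u a).2]; exact (h.step hA).1.symm
    · rw [(hπ u a).2, h'.passes_iff, hB]; simp [hab.symm, hwa]
  have hb : restrict i j (π u b) = [j] := by
    rw [restrict_comm]
    refine restrict_eq_left (hπ u b).1 ?_ ?_
    · rw [(hπ u b).2]; exact (h'.step hB).1.symm
    · rw [(hπ u b).2, h.passes_iff, hA]; simp [hab, hwb]
  have hf : restrict i j ((w :: cutAt (I.rot u) w).flatMap (π u)) =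
      restrict i j (π u w) ++ (restrict b a (cutAt (I.rot u) w)).flatMap
        fun v => restrict i j (π u v) := by
    rw [List.flatMap_cons, restrict_append, restrict_flatMap, flatMap_restrict b a]
    intro v hv hvb hva
    have hvw := ((mem_cutAt_rot h.adj).1 hv).2
    refine restrict_eq_nil ?_ ?_
    · rw [(hπ u v).2, h.passes_iff, hA]; simp [hvw, Ne.symm hva]
    · rw [(hπ u v).2, h'.passes_iff, hB]; simp [hvw, Ne.symm hvb]
  have r1 := hπ.restrict_pair hij h h'
  have r2 : restrict b a (cutAt (I.rot u) w) = [b, a] ∧ [b, a].Sublist (cutAt (I.rot u) w) ∨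
      restrict b a (cutAt (I.rot u) w) = [a, b] ∧ ¬ [b, a].Sublist (cutAt (I.rot u) w) := by
    by_cases hs : [b, a].Sublist (cutAt (I.rot u) w)
    · exact Or.inl ⟨restrict_eq_pair hn hs, hs⟩
    · right
      refine ⟨?_, hs⟩
      rw [restrict_comm]
      exact restrict_eq_pair hn ((pair_sublist_not_iff hn hbc hac hab.symm).1 hs)
  rw [vertexCrossing_iff h.adj, and_iff_right hij, alternate_iff_of_restrict, hf]
  · rcases r1 with ⟨r1, r1'⟩ | ⟨r1, r1'⟩ <;> rcases r2 with ⟨r2, r2'⟩ | ⟨r2, r2'⟩ <;>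
      simp [r1, r2, r1', r2', hij, hij.symm, ha, hb]
  · rw [hf]
    rcases r1 with ⟨r1, -⟩ | ⟨r1, -⟩ <;> rcases r2 with ⟨r2, -⟩ | ⟨r2, -⟩ <;> simp [r1, r2, ha, hb]

/-- A line that ends at `u` occurs only once around `u`, but alternation needs two occurrences. -/
theorem not_vertexCrossing_of_nil (hπ : I.IsLayout π) (h : I.Passes i u w)
    (hA : I.arm i u w = []) : ¬ VertexCrossing π u i j ∧ ¬ VertexCrossing π u j i := by
  have hc : ((w :: cutAt (I.rot u) w).flatMap (π u)).count i ≤ 1 := by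
    rw [List.flatMap_cons, List.count_append]
    have h1 : (π u w).count i ≤ 1 := List.nodup_iff_count_le_one.1 (hπ u w).1 i
    have h2 : ((cutAt (I.rot u) w).flatMap (π u)).count i = 0 := by
      rw [List.count_eq_zero, List.mem_flatMap]
      rintro ⟨v, hv, hv'⟩
      have hvw := ((mem_cutAt_rot h.adj).1 hv).2
      rw [(hπ u v).2, h.passes_iff, hA] at hv'
      simp [hvw] at hv'
    omega
  have key : ∀ M : List (Fin I.numLines), 2 ≤ M.count i → ∀ r, r.IsRotated
      ((w :: cutAt (I.rot u) w).flatMap (π u)) → ¬ M.Sublist r := by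
    intro M hM r hr hs
    have := hs.count_le i
    rw [hr.perm.count_eq] at this
    omega
  rw [vertexCrossing_iff h.adj, vertexCrossing_iff h.adj]
  constructor
  · rintro ⟨-, r, hr, hs⟩
    exact key [i, j, i, j] (by simp [List.count_cons]; omega) r hr hs
  · rintro ⟨-, r, hr, hs⟩
    exact key [j, i, j, i] (by simp [List.count_cons]; omega) r hr hs

/-- If two lines share no port of `u`, then all layouts agree on whether they cross in `u`. -/
theorem VertexCrossing.unavoidable (hπ : I.IsLayout π) (hc : VertexCrossing π u i j)
    (h : ∀ w, I.Passes i u w → ¬ I.Passes j u w) : I.UnavoidableVertexCrossing u i j := by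
  intro π' hπ'
  refine ⟨hc.1, Alternate.of_restrict_eq (L := orderAround π u) hc.2 ?_⟩
  rw [orderAround, orderAround, restrict_flatMap, restrict_flatMap]
  congr 1
  funext v
  by_cases h1 : I.Passes i u v
  · have key : ∀ π : I.Orders, I.IsLayout π → restrict i j (π u v) = [i] := fun π hπ =>
      restrict_eq_left (hπ u v).1 (((hπ u v).2 i).2 h1) (by rw [(hπ u v).2]; exact h v h1)
    rw [key _ hπ, key _ hπ']
  · by_cases h2 : I.Passes j u v
    · have key : ∀ π : I.Orders, I.IsLayout π → restrict i j (π u v) = [j] := fun π hπ => by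
        rw [restrict_comm]
        exact restrict_eq_left (hπ u v).1 (((hπ u v).2 j).2 h2) (by rwa [(hπ u v).2])
      rw [key _ hπ, key _ hπ']
    · have key : ∀ π : I.Orders, I.IsLayout π → restrict i j (π u v) = [] := fun π hπ =>
        restrict_eq_nil (by rwa [(hπ u v).2]) (by rwa [(hπ u v).2])
      rw [key _ hπ, key _ hπ']

/-- A vertex crossing of lines that share a port can be avoided by reversing the order there. -/
theorem IsSolution.not_vertexCrossing (hπ : IsSolution π) (hij : i ≠ j)
    (h : I.Passes i u w) (h' : I.Passes j u w) (hA : I.arm i u w ≠ [])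
    (hB : I.arm j u w ≠ []) : ¬ VertexCrossing π u i j := by
  intro hc
  obtain ⟨a, A, hA⟩ := List.exists_cons_of_ne_nil hA
  obtain ⟨b, B, hB⟩ := List.exists_cons_of_ne_nil hB
  have hun := hπ.2.2 u i j hc
  classical
  let π' : I.Orders := fun x y => if x = u ∧ y = w then (π x y).reverse else π x y
  have hπ' : I.IsLayout π' := by
    intro x y
    -- Reversal keeps the set of lines at the port and changes the order there only, which turns the
    -- criterion for a crossing into its negation.
    simp only [π']
    split
    · simpa using hπ.1 x y
    · exact hπ.1 x y
  have h1 : [i, j].Sublist (π' u w) ↔ ¬ [i, j].Sublist (π u w) := by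
    rw [hπ.1.total hij h h']
    simp only [π', and_self, if_true]
    rw [← List.reverse_sublist]; simp
  have hc' := hun π' hπ'
  by_cases hab : a = b
  · subst hab
    rw [vertexCrossing_iff_of_common hπ.1 hij h h' hA hB] at hc
    rw [vertexCrossing_iff_of_common hπ' hij h h' hA hB, h1] at hc'
    have haw : a ≠ w := ((mem_cutAt_rot h.adj).1 (h.mem_cutAt hA)).2
    have : π' u a = π u a := by simp [π', haw]
    rw [this] at hc'
    tauto
  · rw [vertexCrossing_iff_of_split hπ.1 hij h h' hA hB hab] at hc
    rw [vertexCrossing_iff_of_split hπ' hij h h' hA hB hab, h1] at hc'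
    tauto

end Network
end MetroLine

/-! ### The constructed layout is a solution -/

namespace MetroLine

/-- A class closed under predecessors is an initial segment, and one closed under successors is a
final segment; this yields the form of the periphery condition. -/
theorem eq_append_of_classes {β : Type} {L : List β} (p q : β → Prop) [DecidablePred p]
    [DecidablePred q] (h1 : ∀ a b, [a, b].Sublist L → p b → p a)
    (h2 : ∀ a b, [a, b].Sublist L → q a → q b) :
    ∃ A B C, L = A ++ B ++ C ∧ (∀ x ∈ A, p x) ∧ (∀ x ∈ B, ¬ p x ∧ ¬ q x) ∧ ∀ x ∈ C, q x := by
  induction L with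
  | nil => exact ⟨[], [], [], by simp⟩
  | cons x L ih =>
    obtain ⟨A, B, C, rfl, hA, hB, hC⟩ := ih (fun a b h => h1 a b (h.cons x))
      (fun a b h => h2 a b (h.cons x))
    by_cases hx : p x
    · exact ⟨x :: A, B, C, by simp, by simpa [hx] using hA, hB, hC⟩
    have hA' : A = [] := by
      rcases A with _ | ⟨a, A⟩
      · rfl
      · exact absurd (h1 x a (by simp) (hA a (by simp))) hx
    subst hA'
    by_cases hq : q x
    · refine ⟨[], [], x :: (B ++ C), by simp, by simp, by simp, ?_⟩
      intro y hy
      rcases List.mem_cons.1 hy with rfl | hy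
      · exact hq
      · exact h2 x y (by simpa using hy) hq
    · refine ⟨[], x :: B, C, by simp, by simp, ?_, hC⟩
      intro y hy
      rcases List.mem_cons.1 hy with rfl | hy
      · exact ⟨hx, hq⟩
      · exact hB y hy

namespace Network

variable {I : Network} {i j k : Fin I.numLines} {u w v a b : Fin I.n} {s : I.LineEnd → Bool}

theorem Passes.isTerminal_iff (h : I.Passes i u w) : I.IsTerminal i u ↔ I.arm i u w = [] := by
  have n := h.portSplit
  have hn := h.nodup
  have h1 : (I.line i).head? = some u ∨ (I.line i).getLast? = some u ↔
      ((I.arm i u w).reverse ++ u :: w :: I.arm i w u).head? = some u ∨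
      ((I.arm i u w).reverse ++ u :: w :: I.arm i w u).getLast? = some u := by
    rcases n with n | n
    · rw [n]
    · rw [n]; simp [or_comm]
  rw [IsTerminal, h1]
  have hl : ((I.arm i u w).reverse ++ u :: w :: I.arm i w u).getLast? ≠ some u := by
    intro hl
    rw [List.getLast?_append_cons, List.getLast?_cons_cons] at hl
    have := List.mem_of_mem_getLast? hl
    exact (List.nodup_cons.1 (List.nodup_append.1 hn).2.1).1 this
  simp only [hl, or_false]
  rcases hA : I.arm i u w with _ | ⟨a, A⟩
  · simp
  · simp only [List.reverse_cons, reduceCtorEq, iff_false]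
    intro h2
    rw [hA] at hn
    have h3 : u ∈ (A.reverse ++ [a]) := by
      rw [List.head?_append_of_ne_nil _ (by simp)] at h2
      exact List.mem_of_mem_head? h2
    exact (List.nodup_append.1 hn).2.2 u (by simpa using h3) u (by simp) rfl

theorem Passes.mem_line (h : I.Passes i u w) : u ∈ I.line i := by
  rcases h.portSplit with h | h
  · rw [← h]; simp
  · rw [← List.mem_reverse, ← h]; simp

theorem Passes.isIntermediate_iff (h : I.Passes i u w) :
    I.IsIntermediate i u ↔ I.arm i u w ≠ [] := by
  rw [IsIntermediate, h.isTerminal_iff, and_iff_right h.mem_line]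

/-- The layout determined by the positions `s` of the line ends. -/
def layoutOf (s : I.LineEnd → Bool) : I.Orders := fun u w =>
  rankSort (fun i j => cmp s i j u w)
    ((List.finRange I.numLines).filter fun i => passesB (I.line i) u w)

theorem layoutOf_spec (hI : I.IsProper) (hs : Good s) (u w : Fin I.n) :
    (layoutOf s u w).Nodup ∧ (∀ i, i ∈ layoutOf s u w ↔ I.Passes i u w) ∧
      ∀ i j, [i, j].Sublist (layoutOf s u w) ↔
        I.Passes i u w ∧ I.Passes j u w ∧ cmp s i j u w = true := by
  have hm : ∀ i, i ∈ (List.finRange I.numLines).filter (fun i => passesB (I.line i) u w) ↔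
      I.Passes i u w := by
    intro i
    simp only [List.mem_filter, List.mem_finRange, true_and]
    exact passesB_eq_true_iff (I.nodup_line i)
  have := rankSort_spec (r := fun i j => cmp s i j u w)
    (c := (List.finRange I.numLines).filter fun i => passesB (I.line i) u w)
    ((List.nodup_finRange _).filter _) (fun i hi => cmp_self ((hm i).1 hi))
    (fun i hi j hj hij => cmp_antisymm hI hij ((hm i).1 hi) ((hm j).1 hj))
    (fun i hi j hj k hk => cmp_trans hI hs ((hm i).1 hi) ((hm j).1 hj) ((hm k).1 hk))
  simp only [hm] at this
  exact this

theorem isLayout_layoutOf (hI : I.IsProper) (hs : Good s) : I.IsLayout (layoutOf s) :=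
  fun u w => ⟨(layoutOf_spec hI hs u w).1, (layoutOf_spec hI hs u w).2.1⟩

/-- Lines ending with value `true` come before all continuing lines, and lines ending with value
`false` after them. `Good` ensures that the first kind also precedes the second. -/
theorem periphery_layoutOf (hI : I.IsProper) (hs : Good s) : Periphery (layoutOf s) := by
  intro u w
  obtain ⟨-, hm, ho⟩ := layoutOf_spec hI hs u w
  have c1 : ∀ i j, [i, j].Sublist (layoutOf s u w) → I.arm j u w = [] ∧ endVal s j u = true →
      I.arm i u w = [] ∧ endVal s i u = true := by
    rintro i j h ⟨h5, h6⟩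
    obtain ⟨p, q, r⟩ := (ho i j).1 h
    by_cases hi : I.arm i u w = []
    · refine ⟨hi, ?_⟩
      by_contra h7
      rw [Bool.not_eq_true] at h7
      have hij : j ≠ i := by rintro rfl; simp_all
      have := hs j i u w hij q p h5 hi h6 h7
      rw [cmp_nil_nil hi h5, dir_symm q.symm p.symm] at r
      revert r this
      rcases dir s j i w u with _ | _ | _ <;> simp
    · rw [cmp_cons_nil hi h5, h6] at r; cases r
  have c2 : ∀ i j, [i, j].Sublist (layoutOf s u w) → I.arm i u w = [] ∧ endVal s i u = false →
      I.arm j u w = [] ∧ endVal s j u = false := by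
    rintro i j h ⟨h5, h6⟩
    obtain ⟨p, q, r⟩ := (ho i j).1 h
    by_cases hj : I.arm j u w = []
    · refine ⟨hj, ?_⟩
      by_contra h7
      rw [Bool.not_eq_false] at h7
      have hij : j ≠ i := by rintro rfl; simp_all
      have := hs j i u w hij q p hj h5 h7 h6
      rw [cmp_nil_nil h5 hj, dir_symm q.symm p.symm] at r
      revert r this
      rcases dir s j i w u with _ | _ | _ <;> simp
    · rw [cmp_nil_cons h5 hj, h6] at r; cases r
  obtain ⟨A, B, C, h1, h2, h3, h4⟩ := eq_append_of_classes (L := layoutOf s u w)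
    (fun i => I.arm i u w = [] ∧ endVal s i u = true)
    (fun i => I.arm i u w = [] ∧ endVal s i u = false) c1 c2
  have hP : ∀ i ∈ A ++ B ++ C, I.Passes i u w := fun i hi => (hm i).1 (h1 ▸ hi)
  refine ⟨A, B, C, h1, fun i hi => ?_, fun i hi => ?_, fun i hi => ?_⟩
  · exact (hP i (by simp [hi])).isTerminal_iff.2 (h2 i hi).1
  · rw [(hP i (by simp [hi])).isIntermediate_iff]
    intro h5
    have := h3 i hi
    simp [h5] at this
  · exact (hP i (by simp [hi])).isTerminal_iff.2 (h4 i hi).1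

/-- Lines without a common port at `u` cross there in all layouts or in none. Otherwise lines that
stay together keep their order by `cmp_step`, and lines that split are ordered by the rotation. -/
theorem isSolution_layoutOf (hI : I.IsProper) (hs : Good s) : IsSolution (layoutOf s) := by
  have hl := isLayout_layoutOf hI hs
  refine ⟨hl, periphery_layoutOf hI hs, fun u i j hc => ?_⟩
  by_cases h : ∀ w, I.Passes i u w → ¬ I.Passes j u w
  · exact hc.unavoidable hl h
  exfalso
  push Not at h
  obtain ⟨w, h1, h2⟩ := h
  have ho := fun w => (layoutOf_spec hI hs u w).2.2 i j
  rcases hA : I.arm i u w with _ | ⟨a, A⟩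
  · exact (not_vertexCrossing_of_nil hl h1 hA).1 hc
  rcases hB : I.arm j u w with _ | ⟨b, B⟩
  · exact (not_vertexCrossing_of_nil hl h2 hB).2 hc
  by_cases hab : a = b
  · subst hab
    have hij := hc.1
    rw [vertexCrossing_iff_of_common hl hij h1 h2 hA hB, ho, ho, cmp_step h1 h2 hA hB] at hc
    have h3 := (h1.step hA).1.symm
    have h4 := (h2.step hB).1.symm
    have h5 := cmp_antisymm (s := s) hI hij h3 h4
    simp only [h1, h2, h3, h4, true_and, h5] at hc
    revert hc
    cases cmp s j i u a <;> simp
  · rw [vertexCrossing_iff_of_split hl hc.1 h1 h2 hA hB hab, ho, cmp_cons_cons h2 hA hB hab] at hc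
    simp [h1, h2] at hc

end Network
end MetroLine

/-! ### Common subpaths on which a crossing is forced -/

namespace MetroLine
namespace Network

variable {I : Network} {i j k : Fin I.numLines} {u w v z a b x y : Fin I.n} {s : I.LineEnd → Bool}
  {P : List (Fin I.n)} {e : I.LineEnd}

/-- The end of the line `i` in the vertex `u`. -/
def endAt (i : Fin I.numLines) (u : Fin I.n) : I.LineEnd :=
  (i, decide ((I.line i).head? ≠ some u))

theorem endVal_eq : endVal s i u = s (endAt i u) := rfl

theorem fromEnd_nodup (e : I.LineEnd) : (I.fromEnd e).Nodup := by
  unfold fromEnd directed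
  split
  · exact List.nodup_reverse.2 (I.nodup_line _)
  · exact I.nodup_line _

theorem IsPortOf.spec (h : I.IsPortOf e u w) :
    I.Passes e.1 u w ∧ I.arm e.1 u w = [] ∧ I.fromEnd e = u :: w :: I.arm e.1 w u ∧
      endAt e.1 u = e := by
  obtain ⟨B, hB⟩ := h
  have hs : PortSplit (I.line e.1) u w [] B := by
    unfold fromEnd directed at hB
    split at hB
    · exact Or.inr (by simpa using hB)
    · exact Or.inl (by simpa using hB)
  obtain ⟨h1, h2, h3⟩ := arms_of_portSplit hs
  refine ⟨h1, h2, by rw [h3, ← hB]; rfl, ?_⟩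
  -- The terminal determines which end of the line it is, because the first vertex of a line differs
  -- from its last one.
  refine Prod.ext rfl ?_
  have hn := fromEnd_nodup e
  rw [← hB] at hn
  obtain ⟨l, d⟩ := e
  unfold fromEnd directed at hB
  cases d with
  | false =>
    simp only [Bool.false_eq_true, if_false] at hB
    simp [endAt, ← hB]
  | true =>
    simp only [if_true] at hB
    have : I.line l = (u :: w :: B).reverse := by
      rw [← List.reverse_reverse (I.line l), ← hB]; rfl
    simp only [endAt, this, decide_eq_true_eq]
    intro h4
    have h5 : u ∈ (w :: B) := by
      rw [List.reverse_cons, List.head?_append_of_ne_nil _ (by simp)] at h4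
      have := List.mem_of_mem_head? h4
      simpa [or_comm] using this
    exact (List.nodup_cons.1 hn).1 h5

theorem isPortOf_endAt (h : I.Passes i u w) (hA : I.arm i u w = []) :
    I.IsPortOf (endAt i u) u w := by
  have h1 := h.portSplit
  rw [hA] at h1
  obtain ⟨d, hd⟩ : ∃ d, I.IsPortOf (i, d) u w := by
    rcases h1 with h1 | h1
    · exact ⟨false, I.arm i w u, by simpa [fromEnd, directed] using h1⟩
    · exact ⟨true, I.arm i w u, by simpa [fromEnd, directed] using h1⟩
  have := hd.spec.2.2.2
  simp only at this
  rwa [this]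

theorem splitBefore_iff : I.SplitBefore i j u w ↔
    I.Passes i u w ∧ I.Passes j u w ∧ ∃ a A b B, I.arm i u w = a :: A ∧ I.arm j u w = b :: B ∧
      [b, a].Sublist (cutAt (I.rot u) w) := by
  have key : ∀ i a, Subpath [a, u, w] (I.line i) ↔
      I.Passes i u w ∧ ∃ A, I.arm i u w = a :: A := by
    intro i a
    have := subpath_iff (i := i) (u := u) (w := w) (A := [a]) (B := [])
    simp only [List.reverse_cons, List.reverse_nil, List.nil_append, List.cons_append,
      List.nil_prefix, and_true] at this
    rw [this]
    refine and_congr Iff.rfl ⟨?_, ?_⟩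
    · rintro ⟨A, hA⟩; exact ⟨A, hA.symm⟩
    · rintro ⟨A, hA⟩; exact ⟨A, hA.symm⟩
  simp only [SplitBefore, key]
  constructor
  · rintro ⟨a, b, ⟨h1, A, hA⟩, ⟨h2, B, hB⟩, h3⟩
    exact ⟨h1, h2, a, A, b, B, hA, hB, (clockwise_iff h1.adj).1 h3⟩
  · rintro ⟨h1, h2, a, A, b, B, hA, hB, h3⟩
    exact ⟨a, b, ⟨h1, A, hA⟩, ⟨h2, B, hB⟩, (clockwise_iff h1.adj).2 h3⟩

/-- Where two lines split, `SplitBefore` describes their order. -/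
theorem dir_eq_true_iff_splitBefore (h : I.Passes i u w) (h' : I.Passes j u w)
    (hs : I.Separate i j u w) (hA : I.arm i u w ≠ []) (hB : I.arm j u w ≠ []) :
    dir s i j u w = some true ↔ I.SplitBefore i j u w := by
  obtain ⟨a, A, hA⟩ := List.exists_cons_of_ne_nil hA
  obtain ⟨b, B, hB⟩ := List.exists_cons_of_ne_nil hB
  have hab : a ≠ b := by
    rintro rfl
    simp [Separate, hA, hB, commonPrefix] at hs
  obtain ⟨-, v, h1, h2⟩ := dir_cons_cons (s := s) h' hA hB hab
  rw [h1, Option.some.injEq, h2, splitBefore_iff]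
  constructor
  · intro h3
    exact ⟨h, h', a, A, b, B, hA, hB, h3⟩
  · rintro ⟨-, -, a', A', b', B', hA', hB', h3⟩
    rw [hA] at hA'
    rw [hB] at hB'
    obtain ⟨rfl, -⟩ := List.cons.inj hA'
    obtain ⟨rfl, -⟩ := List.cons.inj hB'
    exact h3

theorem SplitBefore.arms (h : I.SplitBefore i j u w) :
    I.arm i u w ≠ [] ∧ I.arm j u w ≠ [] := by
  obtain ⟨-, -, a, A, b, B, hA, hB, -⟩ := splitBefore_iff.1 h
  simp [hA, hB]

theorem IsCommonSubpath.separate (hP : I.IsCommonSubpath i j P) (h : [u, w] <+: P) :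
    I.Separate i j u w := by
  obtain ⟨C, rfl⟩ := h
  exact hP.commonPrefix_eq.1

/-- A function of directed edges that agrees on consecutive edges is constant along the path. -/
theorem eq_on_edges {V γ : Type} {f : V → V → γ} {P : List V}
    (hf : ∀ u w a, [u, w, a] <:+: P → f u w = f w a) {u w x y : V} (h : [u, w] <:+: P)
    (h' : [x, y] <:+: P) : f u w = f x y := by
  have key : ∀ (P : List V) (p q : V), (∀ u w a, [u, w, a] <:+: p :: q :: P → f u w = f w a) →
      ∀ u w, [u, w] <:+: p :: q :: P → f u w = f p q := by
    intro P
    induction P with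
    | nil =>
      intro p q _ u w h
      have := h.eq_of_length rfl
      simp only [List.cons.injEq, and_true] at this
      rw [this.1, this.2]
    | cons r P ih =>
      intro p q hf u w h
      rcases List.infix_cons_iff.1 h with h | h
      · obtain ⟨h1, h⟩ := List.cons_prefix_cons.1 h
        rw [h1, (List.cons_prefix_cons.1 h).1]
      · rw [ih q r (fun u w a h => hf u w a (List.infix_cons h)) u w h]
        exact (hf p q r ⟨[], P, rfl⟩).symm
  rcases P with _ | ⟨p, _ | ⟨q, P⟩⟩
  · simp at h
  · have := h.length_le; simp at this
  · rw [key P p q hf u w h, key P p q hf x y h']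

/-- From every port of `P` that faces the same way, looking back arrives at the same place of
separation. A forced crossing can thus be tested at any edge of `P`. -/
theorem IsCommonSubpath.dir_const (hP : I.IsCommonSubpath i j P) (h : [u, w] <:+: P)
    (h' : [x, y] <:+: P) : dir s i j u w = dir s i j x y := by
  refine eq_on_edges (f := fun u w => dir s i j u w) (fun u w a h => ?_) h h'
  have h1 : ∀ i, Subpath P (I.line i) → I.Passes i w a ∧ ∃ A, I.arm i w a = u :: A := by
    intro i hi
    have : Subpath ([u].reverse ++ w :: a :: []) (I.line i) := Subpath.trans h hi
    obtain ⟨h1, ⟨A, hA⟩, -⟩ := subpath_iff.1 this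
    exact ⟨h1, A, hA.symm⟩
  obtain ⟨p1, A, hA⟩ := h1 i hP.2.1
  obtain ⟨p2, B, hB⟩ := h1 j hP.2.2.1
  exact (dir_step p1 p2 hA hB).symm

/-- `P` leaves from a terminal of the line `i`. -/
def StartsAt (i : Fin I.numLines) (P : List (Fin I.n)) : Prop :=
  ∃ u w, [u, w] <+: P ∧ I.arm i u w = []

theorem startsAt_iff {C : List (Fin I.n)} : I.StartsAt i (u :: w :: C) ↔ I.arm i u w = [] := by
  constructor
  · rintro ⟨x, y, h, h'⟩
    obtain ⟨h1, h⟩ := List.cons_prefix_cons.1 h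
    rwa [h1, (List.cons_prefix_cons.1 h).1] at h'
  · intro h; exact ⟨u, w, ⟨C, rfl⟩, h⟩

theorem IsCommonSubpath.exists_ends (hP : I.IsCommonSubpath i j P) :
    ∃ u w v z, [u, w] <+: P ∧ [v, z] <+: P.reverse := by
  obtain ⟨u, w, C, h⟩ := hP.exists_cons
  obtain ⟨v, z, D, h'⟩ := hP.reverse.exists_cons
  exact ⟨u, w, v, z, ⟨C, by rw [h]; rfl⟩, ⟨D, by rw [h']; rfl⟩⟩

theorem startsAt_iff_of_prefix (h : [u, w] <+: P) : I.StartsAt i P ↔ I.arm i u w = [] := by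
  obtain ⟨C, rfl⟩ := h
  exact startsAt_iff

/-- The common subpaths on which the lines have to cross, if the line ends have the positions `s`;
the line `i` comes first at both ends. -/
def needSet (s : I.LineEnd → Bool) :
    Set ((Fin I.numLines × Fin I.numLines) × List (Fin I.n)) :=
  {x | x.1.1 ≠ x.1.2 ∧ I.IsCommonSubpath x.1.1 x.1.2 x.2 ∧ ∃ u w, [u, w] <:+: x.2 ∧
    dir s x.1.1 x.1.2 u w = some true ∧ dir s x.1.1 x.1.2 w u = some true}

theorem reverse_pair_infix : [u, w] <:+: P.reverse ↔ [w, u] <:+: P := by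
  rw [← List.reverse_infix]; simp

theorem mem_needSet_iff (hP : I.IsCommonSubpath i j P) (hij : i ≠ j) (h : [u, w] <+: P)
    (h' : [v, z] <+: P.reverse) :
    ((i, j), P) ∈ needSet s ↔ dir s i j u w = some true ∧ dir s i j v z = some true := by
  have h1 := h.isInfix
  have h2 := h'.isInfix
  have h3 := reverse_pair_infix.1 h2
  constructor
  · rintro ⟨-, -, x, y, h4, h5, h6⟩
    exact ⟨(hP.dir_const h1 h4).trans h5,
      (hP.reverse.dir_const h2 (reverse_pair_infix.2 h4)).trans h6⟩
  · rintro ⟨h4, h5⟩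
    exact ⟨hij, hP, z, v, h3, (hP.dir_const h3 h1).trans h4, h5⟩

theorem reverse_mem_needSet (h : ((i, j), P) ∈ needSet s) : ((i, j), P.reverse) ∈ needSet s := by
  obtain ⟨h1, h2, x, y, h3, h4, h5⟩ := h
  exact ⟨h1, h2.reverse, y, x, reverse_pair_infix.2 h3, h5, h4⟩

theorem needSet_not_both (h : ((i, j), P) ∈ needSet s) :
    ¬ (I.StartsAt i P ∧ I.StartsAt j P) := by
  rintro ⟨h1, h2⟩
  obtain ⟨u, w, v, z, hu, hv⟩ := h.2.1.exists_ends
  rw [startsAt_iff_of_prefix hu] at h1 h2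
  have := ((mem_needSet_iff h.2.1 h.1 hu hv).1 h).1
  rw [(dir_nil_nil h1 h2).2] at this
  cases this

/-- A line that ends at both ends of `P` is equal to `P` and hence a subpath of the other line,
against properness. -/
theorem IsCommonSubpath.not_startsAt_reverse (hI : I.IsProper) (hP : I.IsCommonSubpath i j P)
    (hij : i ≠ j) (h : I.StartsAt i P) : ¬ I.StartsAt i P.reverse := by
  intro h'
  obtain ⟨u, w, v, z, hu, hv⟩ := hP.exists_ends
  rw [startsAt_iff_of_prefix hu] at h
  rw [startsAt_iff_of_prefix hv] at h'
  have hp := hP.passes hu.isInfix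
  have hq := hP.reverse.passes hv.isInfix
  have e1 := (isPortOf_endAt hp.1 h).spec.2.2.1
  have e2 := (isPortOf_endAt hq.1 h').spec.2.2.1
  have hn := fromEnd_nodup (endAt i u)
  have hPL : P <+: I.fromEnd (endAt i u) := by
    obtain ⟨C, rfl⟩ := hu
    have := hP.2.1
    have := (subpath_iff (i := i) (u := u) (w := w) (A := []) (B := C)).1 this
    rw [e1]
    exact List.cons_prefix_cons.2 ⟨rfl, List.cons_prefix_cons.2 ⟨rfl, this.2.2⟩⟩
  have hPL' : P.reverse <+: I.fromEnd (endAt i v) := by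
    obtain ⟨C, hC⟩ := hv
    have := hP.reverse.2.1
    rw [← hC] at this ⊢
    have := (subpath_iff (i := i) (u := v) (w := z) (A := []) (B := C)).1 this
    rw [e2]
    exact List.cons_prefix_cons.2 ⟨rfl, List.cons_prefix_cons.2 ⟨rfl, this.2.2⟩⟩
  have huv : u ≠ v := by
    rintro rfl
    obtain ⟨C, rfl⟩ := hu
    have h1 : u ∈ w :: C := by
      obtain ⟨D, hD⟩ := hv
      have h2 := congrArg List.head? hD
      rw [List.head?_reverse] at h2
      simp only [List.cons_append, List.head?_cons, List.getLast?_cons_cons] at h2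
      exact List.mem_of_mem_getLast? h2.symm
    exact (List.nodup_cons.1 (hn.sublist hPL.sublist)).1 h1
  have hrev : I.fromEnd (endAt i v) = (I.fromEnd (endAt i u)).reverse := by
    have key : ∀ d d' : Bool, I.directed i d = I.directed i d' ∨
        I.directed i d = (I.directed i d').reverse := by
      intro d d'
      cases d <;> cases d' <;> simp [directed]
    refine (key _ _).resolve_left fun h3 => huv ?_
    change I.fromEnd (endAt i v) = I.fromEnd (endAt i u) at h3
    rw [e1, e2] at h3
    exact (List.cons.inj h3).1.symm
  have hsub : P <:+ I.fromEnd (endAt i u) := by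
    rw [hrev] at hPL'
    exact List.reverse_prefix.1 hPL'
  -- `P` is both a prefix and a suffix of a list without repetitions, so nothing precedes its first
  -- vertex.
  have hPe : I.fromEnd (endAt i u) = P := by
    obtain ⟨t, ht⟩ := hsub
    obtain ⟨t', ht'⟩ := hPL
    obtain ⟨C, rfl⟩ := hu
    rcases t with _ | ⟨c, t⟩
    · exact ht.symm
    · rw [← ht] at ht' hn
      have : u = c := by simpa using congrArg List.head? ht'
      subst this
      simp at hn
  apply hI i j hij
  have h4 := hP.2.2.1
  rw [← hPe] at h4
  unfold fromEnd directed at h4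
  split at h4
  · have := h4.symm
    rwa [List.reverse_reverse] at this
  · exact h4

end Network
end MetroLine

/-! ### Forced crossings as violated crossing formulas -/

namespace MetroLine
namespace Network

variable {I : Network} {i j k : Fin I.numLines} {u w v z a b x y : Fin I.n} {s : I.LineEnd → Bool}
  {P P' : List (Fin I.n)} {e e' : I.LineEnd}

/-- The violated crossing formulas with two variables. -/
def twoSet (s : I.LineEnd → Bool) : Set (I.LineEnd × I.LineEnd) :=
  {x | I.TwoEndConflict x.1 x.2 ∧ s x.1 = true ∧ s x.2 = false}

/-- The violated crossing formulas with one variable. -/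
def oneSet (s : I.LineEnd → Bool) (first : Bool) : Set (I.LineEnd × Fin I.numLines) :=
  {x | I.OneEndConflict x.1 x.2 first ∧ s x.1 = !first}

/-- The number of violated crossing formulas, if `s` tells which line ends are at the initial ends of
their ports. -/
noncomputable def cost (s : I.LineEnd → Bool) : ℕ :=
  (twoSet s).ncard + (oneSet s false).ncard + (oneSet s true).ncard

theorem needSet_finite : (needSet s).Finite := by
  have h1 : {P : List (Fin I.n) | P.length ≤ I.n}.Finite := List.finite_length_le _ _
  refine (Set.finite_univ.prod h1).subset ?_
  rintro ⟨⟨i, j⟩, P⟩ ⟨-, h, -⟩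
  refine ⟨trivial, ?_⟩
  have hn : P.Nodup := by
    rcases h.2.1 with h2 | h2
    · exact (I.nodup_line i).sublist h2.sublist
    · exact List.nodup_reverse.1 ((I.nodup_line i).sublist h2.sublist)
  simpa using hn.length_le_card

theorem IsCommonSubpath.nodup (h : I.IsCommonSubpath i j P) : P.Nodup := by
  rcases h.2.1 with h2 | h2
  · exact (I.nodup_line i).sublist h2.sublist
  · exact List.nodup_reverse.1 ((I.nodup_line i).sublist h2.sublist)

theorem IsCommonSubpath.isPortOf (hP : I.IsCommonSubpath i j P) (h : [u, w] <+: P)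
    (hs : I.StartsAt i P) : I.IsPortOf (endAt i u) u w ∧ P <+: I.fromEnd (endAt i u) := by
  rw [startsAt_iff_of_prefix h] at hs
  have hp := (hP.passes h.isInfix).1
  have h1 := isPortOf_endAt hp hs
  refine ⟨h1, ?_⟩
  obtain ⟨C, rfl⟩ := h
  rw [h1.spec.2.2.1]
  have := (subpath_iff (i := i) (u := u) (w := w) (A := []) (B := C)).1 hP.2.1
  exact List.cons_prefix_cons.2 ⟨rfl, List.cons_prefix_cons.2 ⟨rfl, this.2.2⟩⟩

theorem prefix_of_prefix_fromEnd (h : P <+: I.fromEnd e) (h2 : 2 ≤ P.length) :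
    ∃ u w, [u, w] <+: P ∧ I.IsPortOf e u w := by
  rcases P with _ | ⟨u, _ | ⟨w, C⟩⟩
  · simp at h2
  · simp at h2
  · exact ⟨u, w, ⟨C, rfl⟩, List.IsPrefix.trans ⟨C, rfl⟩ h⟩

/-- The starting line end determines the common subpath. -/
theorem eq_of_startsAt (hP : I.IsCommonSubpath i j P) (hP' : I.IsCommonSubpath i j P')
    (hs : I.StartsAt i P) (hs' : I.StartsAt i P') (h : [u, w] <+: P) (h' : [v, z] <+: P')
    (he : I.endAt i u = endAt i v) : P = P' := by
  obtain ⟨h1, h2⟩ := hP.isPortOf h hs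
  obtain ⟨h3, h4⟩ := hP'.isPortOf h' hs'
  rw [← he] at h3
  have e1 := h1.spec.2.2.1
  have e2 := h3.spec.2.2.1
  rw [e1] at e2
  obtain ⟨rfl, e2⟩ := List.cons.inj e2
  obtain ⟨rfl, -⟩ := List.cons.inj e2
  rw [hP.eq_run h.isInfix, hP'.eq_run h'.isInfix]

/-- The line `i` starts at `P` and the line `j` ends there, or the line `j` splits there. -/
theorem twoEndConflict_iff : I.TwoEndConflict e e' ↔ e.1 ≠ e'.1 ∧ ∃ P u w v z,
    I.IsCommonSubpath e.1 e'.1 P ∧ [u, w] <+: P ∧ [v, z] <+: P.reverse ∧ I.StartsAt e.1 P ∧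
      ¬ I.StartsAt e'.1 P ∧ I.StartsAt e'.1 P.reverse ∧ ¬ I.StartsAt e.1 P.reverse ∧
      e = endAt e.1 u ∧ e' = endAt e'.1 v := by
  refine and_congr Iff.rfl ⟨?_, ?_⟩
  · rintro ⟨P, u, v, hP, h1, h2, h3, h4, h5, h6⟩
    obtain ⟨u', w, p1, p2⟩ := prefix_of_prefix_fromEnd h1 hP.1
    obtain ⟨v', z, p3, p4⟩ := prefix_of_prefix_fromEnd h2 (by simpa using hP.1)
    have e1 : u' = u := by
      obtain ⟨C, rfl⟩ := p1; simpa using h3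
    have e2 : v' = v := by
      obtain ⟨C, hC⟩ := p3
      rw [← List.head?_reverse, ← hC] at h4; simpa using h4
    subst e1 e2
    obtain ⟨q1, q2, -, q3⟩ := p2.spec
    obtain ⟨r1, r2, -, r3⟩ := p4.spec
    refine ⟨P, u', w, v', z, hP, p1, p3, ?_, ?_, ?_, ?_, q3.symm, r3.symm⟩
    · rwa [startsAt_iff_of_prefix p1]
    · rw [startsAt_iff_of_prefix p1]
      exact (hP.passes p1.isInfix).2.isIntermediate_iff.1 h5
    · rwa [startsAt_iff_of_prefix p3]
    · rw [startsAt_iff_of_prefix p3]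
      exact (hP.reverse.passes p3.isInfix).1.isIntermediate_iff.1 h6
  · rintro ⟨P, u, w, v, z, hP, p1, p3, h1, h2, h3, h4, h5, h6⟩
    obtain ⟨-, q1⟩ := hP.isPortOf p1 h1
    obtain ⟨-, q2⟩ := hP.comm.reverse.isPortOf p3 h3
    rw [← h5] at q1
    rw [← h6] at q2
    rw [startsAt_iff_of_prefix p1] at h2
    rw [startsAt_iff_of_prefix p3] at h4
    refine ⟨P, u, v, hP, q1, q2, ?_, ?_, ?_, ?_⟩
    · obtain ⟨C, rfl⟩ := p1; rfl
    · rw [← List.head?_reverse]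
      obtain ⟨C, hC⟩ := p3; rw [← hC]; rfl
    · exact (hP.passes p1.isInfix).2.isIntermediate_iff.2 h2
    · exact (hP.reverse.passes p3.isInfix).1.isIntermediate_iff.2 h4

theorem oneEndConflict_iff {first : Bool} : I.OneEndConflict e j first ↔ e.1 ≠ j ∧ ∃ P u w v z,
    I.IsCommonSubpath e.1 j P ∧ [u, w] <+: P ∧ [v, z] <+: P.reverse ∧ I.StartsAt e.1 P ∧
      ¬ I.StartsAt j P ∧ e = endAt e.1 u ∧
      (if first then I.SplitBefore j e.1 v z else I.SplitBefore e.1 j v z) := by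
  refine and_congr Iff.rfl ⟨?_, ?_⟩
  · rintro ⟨P, u, v, z, hP, h1, h3, h4, p3, h5⟩
    obtain ⟨u', w, p1, p2⟩ := prefix_of_prefix_fromEnd h1 hP.1
    have e1 : u' = u := by
      obtain ⟨C, rfl⟩ := p1; simpa using h3
    subst e1
    obtain ⟨q1, q2, -, q3⟩ := p2.spec
    refine ⟨P, u', w, v, z, hP, p1, p3, ?_, ?_, q3.symm, h5⟩
    · rwa [startsAt_iff_of_prefix p1]
    · rw [startsAt_iff_of_prefix p1]
      exact (hP.passes p1.isInfix).2.isIntermediate_iff.1 h4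
  · rintro ⟨P, u, w, v, z, hP, p1, p3, h1, h2, h5, h6⟩
    obtain ⟨-, q1⟩ := hP.isPortOf p1 h1
    rw [← h5] at q1
    rw [startsAt_iff_of_prefix p1] at h2
    refine ⟨P, u, v, z, hP, q1, ?_, ?_, p3, h6⟩
    · obtain ⟨C, rfl⟩ := p1; rfl
    · exact (hP.passes p1.isInfix).2.isIntermediate_iff.2 h2

theorem prefix_pair_inj (h : [u, w] <+: P) (h' : [v, z] <+: P) : u = v ∧ w = z := by
  obtain ⟨C, rfl⟩ := h
  obtain ⟨h1, h'⟩ := List.cons_prefix_cons.1 h'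
  exact ⟨h1.symm, (List.cons_prefix_cons.1 h').1.symm⟩

theorem SplitBefore.not_startsAt (h : I.SplitBefore i j u w) (hP : [u, w] <+: P) :
    ¬ I.StartsAt i P ∧ ¬ I.StartsAt j P := by
  rw [startsAt_iff_of_prefix hP, startsAt_iff_of_prefix hP]
  exact h.arms

theorem IsCommonSubpath.dir_eq_true_iff (hP : I.IsCommonSubpath i j P) (h : [u, w] <+: P)
    (hi : ¬ I.StartsAt i P) (hj : ¬ I.StartsAt j P) :
    dir s i j u w = some true ↔ I.SplitBefore i j u w := by
  rw [startsAt_iff_of_prefix h] at hi hj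
  obtain ⟨h1, h2⟩ := hP.passes h.isInfix
  exact dir_eq_true_iff_splitBefore h1 h2 (hP.separate h) hi hj

theorem dir_eq_true_of_left (h : [u, w] <+: P) (hi : I.StartsAt i P) (hj : ¬ I.StartsAt j P) :
    dir s i j u w = some true ↔ s (endAt i u) = true := by
  rw [startsAt_iff_of_prefix h] at hi hj
  rw [(dir_nil_cons hi hj).2, Option.some.injEq, endVal_eq]

theorem dir_eq_true_of_right (h : [u, w] <+: P) (hi : ¬ I.StartsAt i P) (hj : I.StartsAt j P) :
    dir s i j u w = some true ↔ s (endAt j u) = false := by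
  rw [startsAt_iff_of_prefix h] at hi hj
  rw [(dir_cons_nil hi hj).2, Option.some.injEq, endVal_eq, Bool.not_eq_true']

/-- The part of `needSet` where the terminals at the start of the common subpath are prescribed. -/
def needPart (s : I.LineEnd → Bool) (p q p' q' : Prop) :
    Set ((Fin I.numLines × Fin I.numLines) × List (Fin I.n)) :=
  {x | x ∈ needSet s ∧ (I.StartsAt x.1.1 x.2 ↔ p) ∧ (I.StartsAt x.1.2 x.2 ↔ q) ∧
    (I.StartsAt x.1.1 x.2.reverse ↔ p') ∧ (I.StartsAt x.1.2 x.2.reverse ↔ q')}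

/-- The bijection sends a common subpath to the ends of the two lines at its two ends. That `i`
comes first at both means that its own end has value `true` and the end of `j` has value `false`.
The starting end and the other line determine the subpath. -/
theorem ncard_two : (needPart s True False False True).ncard = (twoSet s).ncard := by
  classical
  refine Set.ncard_congr (fun x _ => ((x.1.1, decide ((I.line x.1.1).head? ≠ x.2.head?)),
    (x.1.2, decide ((I.line x.1.2).head? ≠ x.2.reverse.head?)))) ?_ ?_ ?_
  · rintro ⟨⟨i, j⟩, P⟩ ⟨hx, h1, h2, h3, h4⟩
    simp only [iff_true, iff_false] at h1 h2 h3 h4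
    obtain ⟨hij, hP, -⟩ := id hx
    obtain ⟨u, w, v, z, hu, hv⟩ := hP.exists_ends
    obtain ⟨d1, d2⟩ := (mem_needSet_iff hP hij hu hv).1 hx
    have hu' : P.head? = some u := by obtain ⟨C, rfl⟩ := hu; rfl
    have hv' : P.reverse.head? = some v := by obtain ⟨C, hC⟩ := hv; rw [← hC]; rfl
    simp only [hu', hv']
    refine ⟨twoEndConflict_iff.2 ⟨hij, P, u, w, v, z, hP, hu, hv, h1, h2, h4, h3, rfl, rfl⟩, ?_, ?_⟩
    · exact (dir_eq_true_of_left hu h1 h2).1 d1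
    · exact (dir_eq_true_of_right hv h3 h4).1 d2
  · rintro ⟨⟨i, j⟩, P⟩ ⟨⟨i', j'⟩, P'⟩ ⟨hx, h1, -⟩ ⟨hx', h1', -⟩ he
    simp only [Prod.mk.injEq] at he
    obtain ⟨⟨rfl, h5⟩, rfl, -⟩ := he
    simp only [iff_true] at h1 h1'
    obtain ⟨u, w, -, -, hu, -⟩ := hx.2.1.exists_ends
    obtain ⟨v, z, -, -, hv, -⟩ := hx'.2.1.exists_ends
    have hu' : P.head? = some u := by obtain ⟨C, rfl⟩ := hu; rfl
    have hv' : P'.head? = some v := by obtain ⟨C, rfl⟩ := hv; rfl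
    have : P = P' := eq_of_startsAt hx.2.1 hx'.2.1 h1 h1' hu hv
      (by simp only [endAt, ← hu', ← hv', h5])
    rw [this]
  · rintro ⟨e, e'⟩ ⟨h1, h2, h3⟩
    obtain ⟨hij, P, u, w, v, z, hP, hu, hv, q1, q2, q3, q4, q5, q6⟩ := twoEndConflict_iff.1 h1
    simp only at hij hP q1 q2 q3 q4 q5 q6 h2 h3
    have hu' : P.head? = some u := by obtain ⟨C, rfl⟩ := hu; rfl
    have hv' : P.reverse.head? = some v := by obtain ⟨C, hC⟩ := hv; rw [← hC]; rfl
    refine ⟨((e.1, e'.1), P), ⟨(mem_needSet_iff hP hij hu hv).2 ⟨?_, ?_⟩, by simpa using q1,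
      by simpa using q2, by simpa using q4, by simpa using q3⟩, ?_⟩
    · rw [dir_eq_true_of_left hu q1 q2, ← q5]; exact h2
    · rw [dir_eq_true_of_right hv q4 q3, ← q6]; exact h3
    · simp only [hu', hv']
      exact Prod.ext q5.symm q6.symm

/-- Here `i` ends at the start of `P` and the lines split at the far end with `i` first. The formula
demands the final end for `i`, and it is violated by the value `true`. -/
theorem ncard_one_false : (needPart s True False False False).ncard = (oneSet s false).ncard := by
  classical
  refine Set.ncard_congr (fun x _ => ((x.1.1, decide ((I.line x.1.1).head? ≠ x.2.head?)), x.1.2))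
    ?_ ?_ ?_
  · rintro ⟨⟨i, j⟩, P⟩ ⟨hx, h1, h2, h3, h4⟩
    simp only [iff_true, iff_false] at h1 h2 h3 h4
    obtain ⟨hij, hP, -⟩ := id hx
    obtain ⟨u, w, v, z, hu, hv⟩ := hP.exists_ends
    obtain ⟨d1, d2⟩ := (mem_needSet_iff hP hij hu hv).1 hx
    have hu' : P.head? = some u := by obtain ⟨C, rfl⟩ := hu; rfl
    simp only [hu']
    refine ⟨oneEndConflict_iff.2 ⟨hij, P, u, w, v, z, hP, hu, hv, h1, h2, rfl, ?_⟩, ?_⟩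
    · exact (hP.reverse.dir_eq_true_iff hv h3 h4).1 d2
    · exact (dir_eq_true_of_left hu h1 h2).1 d1
  · rintro ⟨⟨i, j⟩, P⟩ ⟨⟨i', j'⟩, P'⟩ ⟨hx, h1, -⟩ ⟨hx', h1', -⟩ he
    simp only [Prod.mk.injEq] at he
    obtain ⟨⟨rfl, h5⟩, rfl⟩ := he
    simp only [iff_true] at h1 h1'
    obtain ⟨u, w, -, -, hu, -⟩ := hx.2.1.exists_ends
    obtain ⟨v, z, -, -, hv, -⟩ := hx'.2.1.exists_ends
    have hu' : P.head? = some u := by obtain ⟨C, rfl⟩ := hu; rfl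
    have hv' : P'.head? = some v := by obtain ⟨C, rfl⟩ := hv; rfl
    have : P = P' := eq_of_startsAt hx.2.1 hx'.2.1 h1 h1' hu hv
      (by simp only [endAt, ← hu', ← hv', h5])
    rw [this]
  · rintro ⟨e, j⟩ ⟨h1, h2⟩
    obtain ⟨hij, P, u, w, v, z, hP, hu, hv, q1, q2, q3, q4⟩ := oneEndConflict_iff.1 h1
    simp only [Bool.false_eq_true, if_false, Bool.not_false] at hij hP q1 q2 q3 q4 h2
    have hu' : P.head? = some u := by obtain ⟨C, rfl⟩ := hu; rfl
    obtain ⟨r1, r2⟩ := q4.not_startsAt hv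
    refine ⟨((e.1, j), P), ⟨(mem_needSet_iff hP hij hu hv).2 ⟨?_, ?_⟩, by simpa using q1,
      by simpa using q2, by simpa using r1, by simpa using r2⟩, ?_⟩
    · rw [dir_eq_true_of_left hu q1 q2, ← q3]; exact h2
    · rw [hP.reverse.dir_eq_true_iff hv r1 r2]; exact q4
    · simp only [hu']
      exact Prod.ext q3.symm rfl

/-- Now the line that ends is the second one, so the first component of the image comes from `j`,
and the violating value is `false`. -/
theorem ncard_one_true : (needPart s False True False False).ncard = (oneSet s true).ncard := by
  classical
  refine Set.ncard_congr (fun x _ => ((x.1.2, decide ((I.line x.1.2).head? ≠ x.2.head?)), x.1.1))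
    ?_ ?_ ?_
  · rintro ⟨⟨i, j⟩, P⟩ ⟨hx, h1, h2, h3, h4⟩
    simp only [iff_true, iff_false] at h1 h2 h3 h4
    obtain ⟨hij, hP, -⟩ := id hx
    obtain ⟨u, w, v, z, hu, hv⟩ := hP.exists_ends
    obtain ⟨d1, d2⟩ := (mem_needSet_iff hP hij hu hv).1 hx
    have hu' : P.head? = some u := by obtain ⟨C, rfl⟩ := hu; rfl
    simp only [hu']
    refine ⟨oneEndConflict_iff.2 ⟨hij.symm, P, u, w, v, z, hP.comm, hu, hv, h2, h1, rfl, ?_⟩, ?_⟩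
    · exact (hP.reverse.dir_eq_true_iff hv h3 h4).1 d2
    · exact (dir_eq_true_of_right hu h1 h2).1 d1
  · rintro ⟨⟨i, j⟩, P⟩ ⟨⟨i', j'⟩, P'⟩ ⟨hx, -, h1, -⟩ ⟨hx', -, h1', -⟩ he
    simp only [Prod.mk.injEq] at he
    obtain ⟨⟨rfl, h5⟩, rfl⟩ := he
    simp only [iff_true] at h1 h1'
    obtain ⟨u, w, -, -, hu, -⟩ := hx.2.1.exists_ends
    obtain ⟨v, z, -, -, hv, -⟩ := hx'.2.1.exists_ends
    have hu' : P.head? = some u := by obtain ⟨C, rfl⟩ := hu; rfl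
    have hv' : P'.head? = some v := by obtain ⟨C, rfl⟩ := hv; rfl
    have : P = P' := eq_of_startsAt hx.2.1.comm hx'.2.1.comm h1 h1' hu hv
      (by simp only [endAt, ← hu', ← hv', h5])
    rw [this]
  · rintro ⟨e, j⟩ ⟨h1, h2⟩
    obtain ⟨hij, P, u, w, v, z, hP, hu, hv, q1, q2, q3, q4⟩ := oneEndConflict_iff.1 h1
    simp only [if_true, Bool.not_true] at hij hP q1 q2 q3 q4 h2
    have hu' : P.head? = some u := by obtain ⟨C, rfl⟩ := hu; rfl
    obtain ⟨r1, r2⟩ := q4.not_startsAt hv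
    refine ⟨((j, e.1), P), ⟨(mem_needSet_iff hP.comm hij.symm hu hv).2 ⟨?_, ?_⟩, by simpa using q2,
      by simpa using q1, by simpa using r1, by simpa using r2⟩, ?_⟩
    · rw [dir_eq_true_of_right hu q2 q1, ← q3]; exact h2
    · rw [hP.comm.reverse.dir_eq_true_iff hv r1 r2]; exact q4
    · simp only [hu']
      exact Prod.ext q3.symm rfl

/-- The unavoidable crossings. -/
theorem unavoidableCrossings_eq : I.unavoidableCrossings =
    {x | x ∈ needPart s False False False False ∧ x.2 <:+: I.line x.1.1}.ncard := by
  rw [unavoidableCrossings]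
  congr 1
  ext ⟨⟨i, j⟩, P⟩
  constructor
  · rintro ⟨hij, hP, h0, u, w, v, z, hu, hv, h1, h2⟩
    obtain ⟨r1, r2⟩ := h1.not_startsAt hu
    obtain ⟨r3, r4⟩ := h2.not_startsAt hv
    refine ⟨⟨(mem_needSet_iff hP hij hu hv).2 ⟨?_, ?_⟩, ?_⟩, h0⟩
    · rwa [hP.dir_eq_true_iff hu r1 r2]
    · rwa [hP.reverse.dir_eq_true_iff hv r3 r4]
    · simpa using ⟨r1, r2, r3, r4⟩
  · rintro ⟨⟨hx, h⟩, h0⟩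
    simp only [iff_false] at h
    obtain ⟨r1, r2, r3, r4⟩ := h
    obtain ⟨hij, hP, -⟩ := id hx
    obtain ⟨u, w, v, z, hu, hv⟩ := hP.exists_ends
    obtain ⟨d1, d2⟩ := (mem_needSet_iff hP hij hu hv).1 hx
    refine ⟨hij, hP, h0, u, w, v, z, hu, hv, ?_, ?_⟩
    · exact (hP.dir_eq_true_iff hu r1 r2).1 d1
    · exact (hP.reverse.dir_eq_true_iff hv r3 r4).1 d2

/-- Half of `needSet`: one direction for each common subpath. -/
def needHalf (s : I.LineEnd → Bool) :
    Set ((Fin I.numLines × Fin I.numLines) × List (Fin I.n)) :=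
  needPart s True False False True ∪ (needPart s True False False False ∪
    (needPart s False True False False ∪
      {x | x ∈ needPart s False False False False ∧ x.2 <:+: I.line x.1.1}))

theorem ncard_needHalf : (needHalf (I := I) s).ncard = cost s + I.unavoidableCrossings := by
  have hf : ∀ {t : Set ((Fin I.numLines × Fin I.numLines) × List (Fin I.n))},
      t ⊆ needSet s → t.Finite := fun h => needSet_finite.subset h
  have hsub : ∀ p q p' q', needPart s p q p' q' ⊆ needSet (I := I) s := fun p q p' q' x hx => hx.1
  have hU : {x | x ∈ needPart s False False False False ∧ x.2 <:+: I.line x.1.1} ⊆ needSet s :=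
    fun x hx => hx.1.1
  have e1 := Set.ncard_union_eq (s := needPart (I := I) s False True False False)
    (t := {x | x ∈ needPart s False False False False ∧ x.2 <:+: I.line x.1.1}) (by
      rw [Set.disjoint_left]
      rintro x ⟨-, h⟩ ⟨⟨-, h'⟩, -⟩
      exact h'.2.1.1 (h.2.1.2 trivial)) (hf (hsub _ _ _ _)) (hf hU)
  have e2 := Set.ncard_union_eq (s := needPart (I := I) s True False False False)
    (t := needPart s False True False False ∪
      {x | x ∈ needPart s False False False False ∧ x.2 <:+: I.line x.1.1}) (by
      rw [Set.disjoint_left]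
      rintro x ⟨-, h⟩ (⟨-, h'⟩ | ⟨⟨-, h'⟩, -⟩)
      exacts [h'.1.1 (h.1.2 trivial), h'.1.1 (h.1.2 trivial)]) (hf (hsub _ _ _ _))
      (hf (Set.union_subset (hsub _ _ _ _) hU))
  have e3 := Set.ncard_union_eq (s := needPart (I := I) s True False False True)
    (t := needPart s True False False False ∪ (needPart s False True False False ∪
      {x | x ∈ needPart s False False False False ∧ x.2 <:+: I.line x.1.1})) (by
      rw [Set.disjoint_left]
      rintro x ⟨-, h⟩ (⟨-, h'⟩ | ⟨-, h'⟩ | ⟨⟨-, h'⟩, -⟩)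
      exacts [h'.2.2.2.1 (h.2.2.2.2 trivial), h'.2.2.2.1 (h.2.2.2.2 trivial),
        h'.2.2.2.1 (h.2.2.2.2 trivial)]) (hf (hsub _ _ _ _))
      (hf (Set.union_subset (hsub _ _ _ _) (Set.union_subset (hsub _ _ _ _) hU)))
  rw [needHalf, e3, e2, e1, ncard_two, ncard_one_false, ncard_one_true,
    ← unavoidableCrossings_eq, cost]
  ring

theorem not_infix_both (hP : I.IsCommonSubpath i j P) (h1 : P <:+: I.line i)
    (h2 : P.reverse <:+: I.line i) : False := by
  obtain ⟨u, w, v, z, hu, hv⟩ := hP.exists_ends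
  have hn := I.nodup_line i
  have h3 : [u, w].Sublist (I.line i) := (hu.isInfix.trans h1).sublist
  have h4 : [w, u].Sublist (I.line i) :=
    ((reverse_pair_infix.2 hu.isInfix).trans h2).sublist
  exact pair_sublist_asymm hn h3 h4

/-- Reversing `P` maps `needSet` to itself without fixed points, and `needHalf` contains exactly one
of `P` and its reverse: which lines end at which end of `P` decides, or the direction of `line i` if
no line ends there. -/
theorem ncard_needSet (hI : I.IsProper) :
    (needSet (I := I) s).ncard = 2 * (cost s + I.unavoidableCrossings) := by
  have hinj : Function.Injective (fun x : (Fin I.numLines × Fin I.numLines) × List (Fin I.n) =>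
      (x.1, x.2.reverse)) := by
    rintro ⟨x, P⟩ ⟨y, Q⟩ h
    simpa using h
  have hhalf : needHalf (I := I) s ⊆ needSet s := by
    rintro x (h | h | h | h)
    exacts [h.1, h.1, h.1, h.1.1]
  have hunion : needSet (I := I) s = needHalf s ∪
      (fun x => (x.1, x.2.reverse)) '' needHalf (I := I) s := by
    ext ⟨⟨i, j⟩, P⟩
    constructor
    · intro hx
      obtain ⟨hij, hP, -⟩ := id hx
      -- At each end of `P` at most one of the lines ends, and neither line ends at both ends of
      -- `P`; this limits the cases that follow.
      have n1 := needSet_not_both hx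
      have n2 := needSet_not_both (reverse_mem_needSet hx)
      have n3 := hP.not_startsAt_reverse hI hij
      have n4 := hP.comm.not_startsAt_reverse hI hij.symm
      have cl : ∀ Q, ((i, j), Q) ∈ needHalf s → Q = P.reverse → ((i, j), P) ∈ needHalf s ∪
          (fun x => (x.1, x.2.reverse)) '' needHalf (I := I) s := by
        rintro Q hQ rfl
        exact Or.inr ⟨_, hQ, by simp⟩
      have hx' := reverse_mem_needSet hx
      have memP : ∀ {Q : List (Fin I.n)} {p q p' q' : Prop}, ((i, j), Q) ∈ needSet s →
          (I.StartsAt i Q ↔ p) → (I.StartsAt j Q ↔ q) → (I.StartsAt i Q.reverse ↔ p') →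
          (I.StartsAt j Q.reverse ↔ q') → ((i, j), Q) ∈ needPart s p q p' q' :=
        fun h h1 h2 h3 h4 => ⟨h, h1, h2, h3, h4⟩
      have hrr := List.reverse_reverse P
      by_cases a1 : I.StartsAt i P
      · have a2 : ¬ I.StartsAt j P := fun h => n1 ⟨a1, h⟩
        have a3 := n3 a1
        by_cases a4 : I.StartsAt j P.reverse
        · exact Or.inl (Or.inl (memP hx (iff_true_intro a1) (iff_false_intro a2)
            (iff_false_intro a3) (iff_true_intro a4)))
        · exact Or.inl (Or.inr (Or.inl (memP hx (iff_true_intro a1) (iff_false_intro a2)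
            (iff_false_intro a3) (iff_false_intro a4))))
      by_cases a2 : I.StartsAt j P
      · have a4 := n4 a2
        by_cases a3 : I.StartsAt i P.reverse
        · exact cl _ (Or.inl (memP hx' (iff_true_intro a3) (iff_false_intro a4)
            (by rw [hrr]; exact iff_false_intro a1) (by rw [hrr]; exact iff_true_intro a2))) rfl
        · exact Or.inl (Or.inr (Or.inr (Or.inl (memP hx (iff_false_intro a1) (iff_true_intro a2)
            (iff_false_intro a3) (iff_false_intro a4)))))
      have b1 : I.StartsAt i P.reverse.reverse ↔ False := by rw [hrr]; exact iff_false_intro a1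
      have b2 : I.StartsAt j P.reverse.reverse ↔ False := by rw [hrr]; exact iff_false_intro a2
      by_cases a3 : I.StartsAt i P.reverse
      · have a4 : ¬ I.StartsAt j P.reverse := fun h => n2 ⟨a3, h⟩
        exact cl _ (Or.inr (Or.inl (memP hx' (iff_true_intro a3) (iff_false_intro a4) b1 b2))) rfl
      by_cases a4 : I.StartsAt j P.reverse
      · exact cl _ (Or.inr (Or.inr (Or.inl (memP hx' (iff_false_intro a3) (iff_true_intro a4)
          b1 b2)))) rfl
      rcases hP.2.1 with h0 | h0
      · exact Or.inl (Or.inr (Or.inr (Or.inr ⟨memP hx (iff_false_intro a1) (iff_false_intro a2)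
          (iff_false_intro a3) (iff_false_intro a4), h0⟩)))
      · exact cl _ (Or.inr (Or.inr (Or.inr ⟨memP hx' (iff_false_intro a3) (iff_false_intro a4)
          b1 b2, h0⟩))) rfl
    · rintro (h | ⟨⟨⟨i', j'⟩, Q⟩, h, he⟩)
      · exact hhalf h
      · simp only [Prod.mk.injEq] at he
        obtain ⟨⟨rfl, rfl⟩, rfl⟩ := he
        exact reverse_mem_needSet (hhalf h)
  have hdisj : Disjoint (needHalf (I := I) s) ((fun x => (x.1, x.2.reverse)) '' needHalf s) := by
    rw [Set.disjoint_left]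
    rintro ⟨⟨i, j⟩, P⟩ h ⟨⟨⟨i', j'⟩, Q⟩, h', he⟩
    simp only [Prod.mk.injEq] at he
    obtain ⟨⟨rfl, rfl⟩, rfl⟩ := he
    rcases h with ⟨-, h⟩ | ⟨-, h⟩ | ⟨-, h⟩ | ⟨⟨hx, h⟩, h0⟩ <;>
      rcases h' with ⟨-, h'⟩ | ⟨-, h'⟩ | ⟨-, h'⟩ | ⟨⟨hx', h'⟩, h0'⟩ <;>
      simp only [List.reverse_reverse, iff_true, iff_false] at h h'
    all_goals first
      | exact not_infix_both hx'.2.1 h0' h0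
      | exact h'.1 h.2.2.1
      | exact h.2.2.1 h'.1
      | exact h'.2.1 h.2.2.2
      | exact h.2.2.2 h'.2.1
      | exact h.1 h'.2.2.1
      | exact h'.2.2.1 h.1
      | exact h.2.1 h'.2.2.2
      | exact h'.2.2.2 h.2.1
  conv_lhs => rw [hunion]
  rw [Set.ncard_union_eq hdisj (needSet_finite.subset hhalf)
    ((needSet_finite.subset hhalf).image _), Set.ncard_image_of_injective _ hinj, ncard_needHalf]
  ring

end Network
end MetroLine

/-! ### Lower and upper bounds for the number of crossings -/

namespace MetroLine
namespace Network

variable {I : Network} {i j k : Fin I.numLines} {u w v z a b x y : Fin I.n} {s : I.LineEnd → Bool}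
  {P P' : List (Fin I.n)} {e e' : I.LineEnd} {π : I.Orders}

/-- The pairs of a directed edge and an ordered pair of lines that cross on the edge. -/
def crossSet (π : I.Orders) : Set ((Fin I.n × Fin I.n) × (Fin I.numLines × Fin I.numLines)) :=
  {x | [x.2.1, x.2.2].Sublist (π x.1.1 x.1.2) ∧ [x.2.1, x.2.2].Sublist (π x.1.2 x.1.1)}

/-- Every crossing is seen from both directions of its edge. The factor matches the one in
`ncard_needSet`. -/
theorem ncard_crossSet (hπ : I.IsLayout π) : (crossSet π).ncard = 2 * crossings π := by
  have hinj : Function.Injective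
      (fun x : (Fin I.n × Fin I.n) × (Fin I.numLines × Fin I.numLines) => (x.1.swap, x.2)) := by
    rintro ⟨⟨a, b⟩, c⟩ ⟨⟨a', b'⟩, c'⟩ h
    simp only [Prod.swap_prod_mk, Prod.mk.injEq] at h
    simp [h]
  have h1 : crossSet π = {x | x ∈ crossSet π ∧ x.1.1 < x.1.2} ∪
      (fun x => (x.1.swap, x.2)) '' {x | x ∈ crossSet π ∧ x.1.1 < x.1.2} := by
    ext ⟨⟨u, w⟩, i, j⟩
    constructor
    · rintro ⟨h, h'⟩
      have hne : u ≠ w := (((hπ u w).2 i).1 (h.subset (by simp))).ne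
      rcases lt_or_gt_of_ne hne with hlt | hlt
      · exact Or.inl ⟨⟨h, h'⟩, hlt⟩
      · exact Or.inr ⟨((w, u), (i, j)), ⟨⟨h', h⟩, hlt⟩, rfl⟩
    · rintro (⟨h, -⟩ | ⟨⟨⟨u', w'⟩, i', j'⟩, ⟨⟨h, h'⟩, -⟩, he⟩)
      · exact h
      · simp only [Prod.swap_prod_mk, Prod.mk.injEq] at he
        obtain ⟨⟨rfl, rfl⟩, rfl, rfl⟩ := he
        exact ⟨h', h⟩
  have h2 : Disjoint {x | x ∈ crossSet π ∧ x.1.1 < x.1.2}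
      ((fun x => (x.1.swap, x.2)) '' {x | x ∈ crossSet π ∧ x.1.1 < x.1.2}) := by
    rw [Set.disjoint_left]
    rintro ⟨⟨u, w⟩, i, j⟩ ⟨-, h⟩ ⟨⟨⟨u', w'⟩, i', j'⟩, ⟨-, h'⟩, he⟩
    simp only [Prod.swap_prod_mk, Prod.mk.injEq] at he
    obtain ⟨⟨rfl, rfl⟩, -⟩ := he
    exact lt_asymm h h'
  have h3 : {x | x ∈ crossSet π ∧ x.1.1 < x.1.2}.ncard = crossings π := by
    rw [crossings, ← Set.ncard_coe_finset]
    congr 1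
    ext x
    simp only [crossSet, Set.mem_ofPred_eq, Finset.coe_filter, Finset.mem_univ, true_and]
    tauto
  rw [h1, Set.ncard_union_eq h2 (Set.toFinite _) (Set.toFinite _),
    Set.ncard_image_of_injective _ hinj, h3]
  ring

/-- The positions `s` of the line ends describe the layout `π`. -/
def DescribedBy (s : I.LineEnd → Bool) (π : I.Orders) : Prop :=
  ∀ i j u w, I.Passes i u w → I.Passes j u w → I.arm i u w = [] → I.arm j u w ≠ [] →
    ([i, j].Sublist (π u w) ↔ s (endAt i u) = true)

/-- The continuing lines are consecutive, so a line that ends here precedes all of them or none.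
Hence a solution has well-defined positions of its line ends. -/
theorem periphery_sublist (hπ : I.IsLayout π) (hp : Periphery π) (hi : I.Passes i u w)
    (hj : I.Passes j u w) (hk : I.Passes k u w) (hA : I.arm i u w = []) (hB : I.arm j u w ≠ [])
    (hC : I.arm k u w ≠ []) (h : [i, j].Sublist (π u w)) : [i, k].Sublist (π u w) := by
  obtain ⟨A, B, C, h1, h2, h3, h4⟩ := hp u w
  have hn := (hπ u w).1
  have hm := (hπ u w).2
  have inB : ∀ l, I.Passes l u w → I.arm l u w ≠ [] → l ∈ B := by
    intro l hl hl'
    have : l ∈ A ++ B ++ C := h1 ▸ (hm l).2 hl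
    rw [Ne, ← hl.isTerminal_iff] at hl'
    simp only [List.mem_append] at this
    rcases this with (h | h) | h
    · exact absurd (h2 l h) hl'
    · exact h
    · exact absurd (h4 l h) hl'
  have hjB := inB j hj hB
  have hkB := inB k hk hC
  have hiA : i ∈ A := by
    have : i ∈ A ++ B ++ C := h1 ▸ (hm i).2 hi
    simp only [List.mem_append] at this
    rcases this with (h | h') | h'
    · exact h
    · exact absurd (hi.isTerminal_iff.2 hA) (h3 i h').2
    · exfalso
      refine pair_sublist_asymm hn h ?_
      rw [h1]
      exact (List.singleton_sublist.2 (List.mem_append_right A hjB)).append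
        (List.singleton_sublist.2 h')
  rw [h1, List.append_assoc]
  exact (List.singleton_sublist.2 hiA).append
    (List.singleton_sublist.2 (List.mem_append_left C hkB))

theorem IsSolution.exists_describedBy (hπ : IsSolution π) : ∃ s, DescribedBy s π := by
  classical
  refine ⟨fun e => decide (∃ u w j, I.IsPortOf e u w ∧ I.Passes j u w ∧ I.arm j u w ≠ [] ∧
    [e.1, j].Sublist (π u w)), fun i j u w hi hj hA hB => ?_⟩
  simp only [decide_eq_true_eq]
  have hport := isPortOf_endAt hi hA
  constructor
  · intro h
    exact ⟨u, w, j, hport, hj, hB, h⟩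
  · rintro ⟨u', w', j', h1, h2, h3, h4⟩
    have e1 := hport.spec.2.2.1
    have e2 := h1.spec.2.2.1
    rw [e1] at e2
    obtain ⟨rfl, e2⟩ := List.cons.inj e2
    obtain ⟨rfl, -⟩ := List.cons.inj e2
    exact periphery_sublist hπ.1 hπ.2.1 hi h2 hj hA h3 hB h4

/-- Where the lines separate, the layout has the order given by `dir`, by the description or by the
absence of a vertex crossing. Without crossings on `P` this order is carried along `P`. -/
theorem dir_le_order (hπ : IsSolution π) (hd : DescribedBy s π) (hij : i ≠ j)
    (hP : I.IsCommonSubpath i j P)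
    (hc : ∀ x y, [x, y] <:+: P ∨ [y, x] <:+: P →
      ¬ ([i, j].Sublist (π x y) ∧ [i, j].Sublist (π y x)))
    (h : I.Passes i u w) (h' : I.Passes j u w) :
    ([u, w] <:+: P ∨ [w, u] <:+: P) → dir s i j u w = some true → [i, j].Sublist (π u w) := by
  refine back_induction (M := fun u w => ([u, w] <:+: P ∨ [w, u] <:+: P) →
    dir s i j u w = some true → [i, j].Sublist (π u w)) ?_ ?_ h h'
  · intro u w h h' hs _ hdir
    by_cases hA : I.arm i u w = []
    · by_cases hB : I.arm j u w = []
      · rw [(dir_nil_nil hA hB).2] at hdir; cases hdir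
      · rw [(dir_nil_cons hA hB).2, Option.some.injEq] at hdir
        exact (hd i j u w h h' hA hB).2 hdir
    · by_cases hB : I.arm j u w = []
      · rw [(dir_cons_nil hA hB).2, Option.some.injEq, Bool.not_eq_true'] at hdir
        rw [← hπ.1.total hij.symm h' h, hd j i u w h' h hB hA, ← endVal_eq (s := s), hdir]
        simp
      · have hnc := hπ.not_vertexCrossing hij h h' hA hB
        obtain ⟨a, A, hA⟩ := List.exists_cons_of_ne_nil hA
        obtain ⟨b, B, hB⟩ := List.exists_cons_of_ne_nil hB
        have hab : a ≠ b := by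
          rintro rfl
          simp [Separate, hA, hB, commonPrefix] at hs
        rw [vertexCrossing_iff_of_split hπ.1 hij h h' hA hB hab, not_not] at hnc
        obtain ⟨-, v, h1, h2⟩ := dir_cons_cons (s := s) h' hA hB hab
        rw [h1, Option.some.injEq] at hdir
        exact hnc.2 (h2.1 hdir)
  · intro u w a A B h h' hA hB p1 p2 _ _ ih hmem hdir
    have hmem' : [a, u] <:+: P ∨ [u, a] <:+: P := by
      have hr : [a, u] <:+: I.run i j u w := by
        refine ⟨(commonPrefix A B).reverse, w :: commonPrefix (I.arm i w u) (I.arm j w u), ?_⟩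
        change _ = (commonPrefix (I.arm i u w) (I.arm j u w)).reverse ++ u :: w :: _
        rw [hA, hB]; simp [commonPrefix, Network.arm]
      rcases hmem with h3 | h3
      · left; rw [hP.eq_run h3]; exact hr
      · right
        rw [← reverse_pair_infix, hP.eq_run h3, run, run_reverse]; exact hr
    rw [dir_step h h' hA hB] at hdir
    have h1 := ih hmem' hdir
    -- Without a crossing the order is reversed across the edge, and without a vertex crossing it is
    -- reversed once more in `u`.
    have h2 : ¬ [i, j].Sublist (π u a) := fun h2 => hc a u hmem' ⟨h1, h2⟩
    have hnc := hπ.not_vertexCrossing hij h h' (by simp [hA]) (by simp [hB])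
    rw [vertexCrossing_iff_of_common hπ.1 hij h h' hA hB] at hnc
    tauto

/-- Every layout described by `s` has crossings for the violated formulas. -/
theorem IsSolution.le_crossings (hI : I.IsProper) (hπ : IsSolution π) (hd : DescribedBy s π) :
    cost s + I.unavoidableCrossings ≤ crossings π := by
  classical
  have key : ∀ x ∈ needSet (I := I) s, ∃ e : Fin I.n × Fin I.n, [e.1, e.2] <:+: x.2 ∧
      (e, x.1) ∈ crossSet π := by
    rintro ⟨⟨i, j⟩, P⟩ ⟨hij, hP, u, w, h1, h2, h3⟩
    by_contra hc
    push Not at hc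
    have hc' : ∀ x y, [x, y] <:+: P ∨ [y, x] <:+: P →
        ¬ ([i, j].Sublist (π x y) ∧ [i, j].Sublist (π y x)) := by
      rintro x y (h | h) h'
      · exact hc (x, y) h h'
      · exact hc (y, x) h h'.symm
    obtain ⟨p1, p2⟩ := hP.passes h1
    exact hc' u w (Or.inl h1) ⟨dir_le_order hπ hd hij hP hc' p1 p2 (Or.inl h1) h2,
      dir_le_order hπ hd hij hP hc' p1.symm p2.symm (Or.inr h1) h3⟩
  have hle : (needSet (I := I) s).ncard ≤ (crossSet π).ncard := by
    -- A crossed edge determines the common subpath through it, so different forced crossings are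
    -- charged to different elements of `crossSet`.
    have hsub : needSet (I := I) s ⊆
        (fun x => (x.2, I.run x.2.1 x.2.2 x.1.1 x.1.2)) '' crossSet π := by
      rintro x hx
      obtain ⟨e, he, he'⟩ := key x hx
      exact ⟨(e, x.1), he', Prod.ext rfl (hx.2.1.eq_run he).symm⟩
    exact (Set.ncard_le_ncard hsub ((Set.toFinite _).image _)).trans
      (Set.ncard_image_le (Set.toFinite _))
  rw [ncard_needSet hI, ncard_crossSet hπ.1] at hle
  omega

theorem edge_cases {V : Type} {f : V → ℕ} (hf : Function.Injective f) {C D : List V}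
    {u w x y : V} (h : [x, y] <:+: C.reverse ++ u :: w :: D) :
    (x = u ∧ y = w) ∨ (f y, f x) ∈ edgesFrom f u C ∨ (f x, f y) ∈ edgesFrom f w D := by
  induction C generalizing u w D with
  | nil =>
    simp only [List.reverse_nil, List.nil_append] at h
    have key : ∀ (D : List V) (u : V), [x, y] <:+: u :: D → (f x, f y) ∈ edgesFrom f u D := by
      intro D
      induction D with
      | nil => intro u h; have := h.length_le; simp at this
      | cons d D ih =>
        intro u h
        rcases List.infix_cons_iff.1 h with h | h
        · obtain ⟨h1, h⟩ := List.cons_prefix_cons.1 h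
          rw [h1, (List.cons_prefix_cons.1 h).1]
          simp
        · simp [ih d h]
    rcases List.infix_cons_iff.1 h with h | h
    · obtain ⟨h1, h⟩ := List.cons_prefix_cons.1 h
      exact Or.inl ⟨h1, (List.cons_prefix_cons.1 h).1⟩
    · right; right; exact key D w h
  | cons c C ih =>
    rcases ih (u := c) (w := u) (D := w :: D) (by simpa using h) with ⟨rfl, rfl⟩ | h | h
    · simp
    · simp [h]
    · simp only [edgesFrom_cons, List.mem_cons, Prod.mk.injEq] at h
      rcases h with ⟨h1, h2⟩ | h
      · exact Or.inl ⟨hf h1, hf h2⟩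
      · simp [h]

theorem key_le_of_not_notMin (h : ¬ NotMin i j u w) (hxy : [x, y] <:+: I.run i j u w) :
    edgeKey (u.val, w.val) ≤ edgeKey (x.val, y.val) := by
  by_contra hlt
  rw [not_le] at hlt
  rcases edge_cases Fin.val_injective hxy with ⟨rfl, rfl⟩ | h1 | h1
  · exact lt_irrefl _ hlt
  · refine h ⟨_, Or.inl h1, ?_⟩
    rwa [edgeKey_swap]
  · exact h ⟨_, Or.inr (List.mem_cons_of_mem _ h1), hlt⟩

/-- A crossed edge has the smallest key on the common subpath, so both of its ports follow what lies
behind them; an undetermined value at one port would make the two choices opposite. -/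
theorem dir_of_crossing (hI : I.IsProper) (hij : i ≠ j) (h : I.Passes i u w) (h' : I.Passes j u w)
    (h1 : cmp s i j u w = true) (h2 : cmp s i j w u = true) :
    ¬ NotMin i j u w ∧ dir s i j u w = some true ∧ dir s i j w u = some true := by
  have hm : ¬ NotMin i j u w := by
    intro hm
    rw [cmp_swap_of_notMin h h' hm, cmp_antisymm hI hij.symm h'.symm h.symm, h2] at h1
    cases h1
  refine ⟨hm, ?_⟩
  have b1 : minB (backEdges i j u w) (frontEdges i j u w) = false := by
    by_contra hb
    rw [Bool.not_eq_false, minB_iff] at hb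
    obtain ⟨e, he, hlt⟩ := hb
    exact hm ⟨e, Or.inl he, hlt _ (by rw [frontEdges_eq]; simp)⟩
  have b2 : minB (backEdges i j w u) (frontEdges i j w u) = false := by
    by_contra hb
    rw [Bool.not_eq_false, minB_iff] at hb
    obtain ⟨e, he, hlt⟩ := hb
    refine hm ⟨e, Or.inr (by rw [frontEdges_eq]; exact List.mem_cons_of_mem _ he), ?_⟩
    rw [edgeKey_swap u.val]
    exact hlt _ (by rw [frontEdges_eq]; simp)
  rw [cmp, backMin_eq, b1] at h1
  rw [cmp, backMin_eq, b2] at h2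
  revert h1 h2
  generalize dir s i j u w = X
  generalize dir s i j w u = Y
  rcases X with _ | _ | _ <;> rcases Y with _ | _ | _ <;> simp [chooseOrder]

/-- If line ends at the same port are placed well, there are no further crossings. -/
theorem crossings_layoutOf_le (hI : I.IsProper) (hs : Good s) :
    crossings (layoutOf s) ≤ cost s + I.unavoidableCrossings := by
  have hl := isLayout_layoutOf hI hs
  have key : ∀ {u w i j}, ((u, w), (i, j)) ∈ crossSet (layoutOf s) → i ≠ j ∧ I.Passes i u w ∧
      I.Passes j u w ∧ ¬ NotMin i j u w ∧ dir s i j u w = some true ∧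
      dir s i j w u = some true := by
    rintro u w i j ⟨h1, h2⟩
    have hij : i ≠ j := by simpa using (hl u w).1.sublist h1
    obtain ⟨p1, p2, c1⟩ := ((layoutOf_spec hI hs u w).2.2 i j).1 h1
    obtain ⟨-, -, c2⟩ := ((layoutOf_spec hI hs w u).2.2 i j).1 h2
    exact ⟨hij, p1, p2, dir_of_crossing hI hij p1 p2 c1 c2⟩
  have hle : (crossSet (layoutOf (I := I) s)).ncard ≤ (needSet (I := I) s).ncard := by
    refine Set.ncard_le_ncard_of_injOn (fun x => (x.2, I.run x.2.1 x.2.2 x.1.1 x.1.2)) ?_ ?_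
      needSet_finite
    · rintro ⟨⟨u, w⟩, i, j⟩ hx
      obtain ⟨hij, p1, p2, -, d1, d2⟩ := key hx
      exact ⟨hij, isCommonSubpath_run p1 p2, u, w, pair_infix_run _ _ _ _, d1, d2⟩
    · rintro ⟨⟨u, w⟩, i, j⟩ hx ⟨⟨u', w'⟩, i', j'⟩ hx' he
      simp only [Prod.mk.injEq] at he
      obtain ⟨⟨rfl, rfl⟩, he⟩ := he
      obtain ⟨hij, p1, p2, m1, -⟩ := key hx
      obtain ⟨-, -, -, m2, -⟩ := key hx'
      have hP := isCommonSubpath_run p1 p2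
      have i1 : [u, w] <:+: I.run i j u w := pair_infix_run _ _ _ _
      have i2 : [u', w'] <:+: I.run i j u w := he ▸ pair_infix_run _ _ _ _
      have k1 := key_le_of_not_notMin m1 i2
      have k2 := key_le_of_not_notMin m2 (he ▸ i1)
      -- Two crossed edges on the same run both have the smallest key, so they are the same
      -- undirected edge, and the run traverses it in only one direction.
      have k3 := edgeKey_snd (le_antisymm k1 k2)
      have k5 := edgeKey_snd ((le_antisymm k1 k2).trans (edgeKey_swap u'.val w'.val))
      have hne : u' ≠ w' := (key hx').2.1.ne
      simp only at k3 k5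
      have k3 := k3.imp Fin.ext Fin.ext
      have k5 := k5.imp Fin.ext Fin.ext
      rcases k5 with rfl | rfl <;> rcases k3 with rfl | rfl
      · exact absurd rfl hne
      · rfl
      · exfalso
        have hn := hP.nodup
        exact pair_sublist_asymm hn i1.sublist i2.sublist
      · exact absurd rfl hne
  rw [ncard_needSet hI, ncard_crossSet hl] at hle
  omega

end Network
end MetroLine

/-! ### The exchange argument for ends at the same port -/

namespace MetroLine
namespace Network

variable {I : Network} {i j k : Fin I.numLines} {u w v z a b x y : Fin I.n} {s : I.LineEnd → Bool}
  {P P' : List (Fin I.n)} {e e' : I.LineEnd} {π : I.Orders}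

theorem TwoEndConflict.symm (h : I.TwoEndConflict e e') : I.TwoEndConflict e' e := by
  obtain ⟨h1, P, u, v, h2, h3, h4, h5, h6, h7, h8⟩ := h
  refine ⟨h1.symm, P.reverse, v, u, h2.comm.reverse, h4, by simpa using h3, ?_, ?_, h8, h7⟩
  · rw [List.head?_reverse]; exact h6
  · rw [List.getLast?_reverse]; exact h5

/-- The lines that want the line end `e` to be at the initial end (`b = true`) or at the final end
of its port. -/
def wantSet (s : I.LineEnd → Bool) (e : I.LineEnd) (b : Bool) : Set (Fin I.numLines) :=
  {j | e.1 ≠ j ∧ ∃ u w, I.IsPortOf e u w ∧ I.Passes j u w ∧ I.arm j u w ≠ [] ∧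
    dir s j e.1 w u = some b}

/-- The order seen from the opposite port is decided at the far end of the common subpath. By
properness the line of `e` continues there, so either `j` ends, and its value decides, or the lines
split. -/
theorem mem_wantSet_iff (hI : I.IsProper) {b : Bool} : j ∈ wantSet s e b ↔
    j ∈ Prod.fst '' {y | I.TwoEndConflict e y ∧ s y = b} ∨ I.OneEndConflict e j b := by
  classical
  have key : ∀ P u w v z, e.1 ≠ j → I.IsCommonSubpath e.1 j P → [u, w] <+: P →
      [v, z] <+: P.reverse → I.StartsAt e.1 P → ¬ I.StartsAt j P →
      (dir s j e.1 w u = some b ↔ if I.StartsAt j P.reverse then s (endAt j v) = b else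
        (if b then I.SplitBefore j e.1 v z else I.SplitBefore e.1 j v z)) := by
    intro P u w v z hij hP hu hv h1 h2
    have h3 := hP.not_startsAt_reverse hI hij h1
    obtain ⟨p1, p2⟩ := hP.reverse.passes hv.isInfix
    rw [hP.comm.reverse.dir_const (reverse_pair_infix.2 hu.isInfix) hv.isInfix]
    split
    · rename_i h4
      rw [startsAt_iff_of_prefix hv] at h3 h4
      rw [(dir_nil_cons h4 h3).2, Option.some.injEq, endVal_eq]
    · rename_i h4
      cases b with
      | true => simp only [if_true]; exact hP.comm.reverse.dir_eq_true_iff hv h4 h3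
      | false =>
        simp only [Bool.false_eq_true, if_false]
        rw [dir_symm p1 p2, ← hP.reverse.dir_eq_true_iff (s := s) hv h3 h4]
        rcases dir s e.1 j v z with _ | _ | _ <;> simp
  constructor
  · rintro ⟨hij, u, w, h1, h2, h3, h4⟩
    obtain ⟨q1, q2, -, q3⟩ := h1.spec
    have hP := isCommonSubpath_run q1 h2
    have hsep : commonPrefix (I.arm e.1 u w) (I.arm j u w) = [] := by
      rw [q2]; simp [commonPrefix]
    have hu : [u, w] <+: I.run e.1 j u w := by
      refine ⟨commonPrefix (I.arm e.1 w u) (I.arm j w u), ?_⟩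
      change _ = (commonPrefix (I.arm e.1 u w) (I.arm j u w)).reverse ++ u :: w :: _
      rw [hsep]; rfl
    obtain ⟨-, -, v, z, -, hv⟩ := hP.exists_ends
    have hs1 := (startsAt_iff_of_prefix hu (i := e.1)).2 q2
    have hs2 := (startsAt_iff_of_prefix hu (i := j)).not.2 h3
    have hs3 := hP.not_startsAt_reverse hI hij hs1
    have h5 := (key _ u w v z hij hP hu hv hs1 hs2).1 h4
    by_cases hs4 : I.StartsAt j (I.run e.1 j u w).reverse
    · rw [if_pos hs4] at h5
      exact Or.inl ⟨endAt j v, ⟨twoEndConflict_iff.2 ⟨hij, _, u, w, v, z, hP, hu, hv, hs1, hs2, hs4,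
        hs3, q3.symm, rfl⟩, h5⟩, rfl⟩
    · rw [if_neg hs4] at h5
      exact Or.inr (oneEndConflict_iff.2 ⟨hij, _, u, w, v, z, hP, hu, hv, hs1, hs2, q3.symm, h5⟩)
  · rintro (⟨y, ⟨h1, h2⟩, rfl⟩ | h)
    · obtain ⟨hij, P, u, w, v, z, hP, hu, hv, q1, q2, q3, q4, q5, q6⟩ := twoEndConflict_iff.1 h1
      obtain ⟨r1, -⟩ := hP.isPortOf hu q1
      rw [← q5] at r1
      have q2' := q2
      rw [startsAt_iff_of_prefix hu] at q2'
      refine ⟨hij, u, w, r1, (hP.passes hu.isInfix).2, q2', ?_⟩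
      rw [key P u w v z hij hP hu hv q1 q2, if_pos q3, ← q6, h2]
    · obtain ⟨hij, P, u, w, v, z, hP, hu, hv, q1, q2, q3, q4⟩ := oneEndConflict_iff.1 h
      obtain ⟨r1, -⟩ := hP.isPortOf hu q1
      rw [← q3] at r1
      have q2' := q2
      rw [startsAt_iff_of_prefix hu] at q2'
      refine ⟨hij, u, w, r1, (hP.passes hu.isInfix).2, q2', ?_⟩
      rw [key P u w v z hij hP hu hv q1 q2, if_neg]
      · exact q4
      · split at q4
        · exact (q4.not_startsAt hv).1
        · exact (q4.not_startsAt hv).2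

theorem eq_of_conflicts {w z : Fin I.n} (hP : I.IsCommonSubpath e.1 j P)
    (hP' : I.IsCommonSubpath e.1 j P') (hu : [u, w] <+: P) (hv : [v, z] <+: P')
    (h : I.StartsAt e.1 P) (h' : I.StartsAt e.1 P') (he : e = endAt e.1 u)
    (he' : e = endAt e.1 v) : P = P' :=
  eq_of_startsAt hP hP' h h' hu hv (by rw [← he, ← he'])

/-- The end `e` and the other line determine the common subpath, which has only one far end. -/
theorem twoEndConflict_unique {x y : I.LineEnd} (hx : I.TwoEndConflict e x)
    (hy : I.TwoEndConflict e y) (heq : x.1 = y.1) : x = y := by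
  obtain ⟨hij, P, u, w, v, z, hP, hu, hv, q1, q2, q3, q4, q5, q6⟩ := twoEndConflict_iff.1 hx
  obtain ⟨-, P', u', w', v', z', hP', hu', hv', r1, r2, r3, r4, r5, r6⟩ :=
    twoEndConflict_iff.1 hy
  rw [← heq] at hP' r6
  have := eq_of_conflicts hP hP' hu hu' q1 r1 q5 r5
  subst this
  rw [q6, r6, (prefix_pair_inj hv hv').1]

theorem TwoEndConflict.not_oneEndConflict {y : I.LineEnd} {b : Bool} (h : I.TwoEndConflict e y) :
    ¬ I.OneEndConflict e y.1 b := by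
  intro h'
  obtain ⟨hij, P, u, w, v, z, hP, hu, hv, q1, q2, q3, q4, q5, q6⟩ := twoEndConflict_iff.1 h
  obtain ⟨-, P', u', w', v', z', hP', hu', hv', r1, r2, r3, r4⟩ := oneEndConflict_iff.1 h'
  have := eq_of_conflicts hP hP' hu hu' q1 r1 q5 r3
  subst this
  split at r4
  · exact (r4.not_startsAt hv').1 q3
  · exact (r4.not_startsAt hv').2 q3

/-- The number of conflicts of `e` that are avoided by the position `b` of `e`. -/
noncomputable def numWant (s : I.LineEnd → Bool) (e : I.LineEnd) (b : Bool) : ℕ :=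
  {y | I.TwoEndConflict e y ∧ s y = b}.ncard + {j | I.OneEndConflict e j b}.ncard

theorem ncard_wantSet (hI : I.IsProper) (b : Bool) : (wantSet s e b).ncard = numWant s e b := by
  have h1 : wantSet s e b = Prod.fst '' {y | I.TwoEndConflict e y ∧ s y = b} ∪
      {j | I.OneEndConflict e j b} := by
    ext j; exact mem_wantSet_iff hI
  have h2 : Set.InjOn Prod.fst {y | I.TwoEndConflict e y ∧ s y = b} :=
    fun _ hy _ hy' heq => twoEndConflict_unique hy.1 hy'.1 heq
  have h3 : Disjoint (Prod.fst '' {y | I.TwoEndConflict e y ∧ s y = b})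
      {j | I.OneEndConflict e j b} := by
    rw [Set.disjoint_left]
    rintro _ ⟨y, ⟨hy, -⟩, rfl⟩ hy'
    exact hy.not_oneEndConflict hy'
  rw [h1, Set.ncard_union_eq h3 (Set.toFinite _) (Set.toFinite _), h2.ncard_image,
    numWant]

/-- Only the conflicts of `e` matter: with the value `true` those that want `false` are violated,
and after the change those that want `true`. -/
theorem cost_update_false (he : s e = true) :
    cost (Function.update s e false) + numWant s e false = cost s + numWant s e true := by
  classical
  set s' := Function.update s e false with hs'
  have hse : s' e = false := by simp [hs']
  have hsne : ∀ x, x ≠ e → s' x = s x := fun x hx => by simp [hs', hx]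
  have hself : ¬ I.TwoEndConflict e e := fun h => h.1 rfl
  -- `R`, and below `R0` and `R1`, collect the violations that do not involve `e`; the change does
  -- not affect them.
  set R : Set (I.LineEnd × I.LineEnd) :=
    {x | x.1 ≠ e ∧ x.2 ≠ e ∧ I.TwoEndConflict x.1 x.2 ∧ s x.1 = true ∧ s x.2 = false} with hR
  have t1 : twoSet s = R ∪ (fun y => (e, y)) '' {y | I.TwoEndConflict e y ∧ s y = false} := by
    ext ⟨x, y⟩
    simp only [twoSet, hR, Set.mem_union, Set.mem_ofPred_eq, Set.mem_image, Prod.mk.injEq]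
    constructor
    · rintro ⟨h1, h2, h3⟩
      by_cases hx : x = e
      · subst hx; exact Or.inr ⟨y, ⟨h1, h3⟩, rfl, rfl⟩
      · refine Or.inl ⟨hx, ?_, h1, h2, h3⟩
        rintro rfl; rw [he] at h3; cases h3
    · rintro (⟨-, -, h⟩ | ⟨y', ⟨h1, h2⟩, rfl, rfl⟩)
      · exact h
      · exact ⟨h1, he, h2⟩
  have t2 : twoSet s' = R ∪ (fun y => (y, e)) '' {y | I.TwoEndConflict e y ∧ s y = true} := by
    ext ⟨x, y⟩
    simp only [twoSet, hR, Set.mem_union, Set.mem_ofPred_eq, Set.mem_image, Prod.mk.injEq]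
    constructor
    · rintro ⟨h1, h2, h3⟩
      have hx : x ≠ e := by rintro rfl; rw [hse] at h2; cases h2
      rw [hsne x hx] at h2
      by_cases hy : y = e
      · subst hy; exact Or.inr ⟨x, ⟨h1.symm, h2⟩, rfl, rfl⟩
      · rw [hsne y hy] at h3
        exact Or.inl ⟨hx, hy, h1, h2, h3⟩
    · rintro (⟨hx, hy, h1, h2, h3⟩ | ⟨y', ⟨h1, h2⟩, rfl, rfl⟩)
      · rw [hsne x hx, hsne y hy]; exact ⟨h1, h2, h3⟩
      · have hx : y' ≠ e := by rintro rfl; exact hself h1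
        rw [hsne y' hx]; exact ⟨h1.symm, h2, hse⟩
  set R0 : Set (I.LineEnd × Fin I.numLines) :=
    {x | x.1 ≠ e ∧ I.OneEndConflict x.1 x.2 false ∧ s x.1 = true} with hR0
  set R1 : Set (I.LineEnd × Fin I.numLines) :=
    {x | x.1 ≠ e ∧ I.OneEndConflict x.1 x.2 true ∧ s x.1 = false} with hR1
  have o1 : oneSet s false = R0 ∪ (fun j => (e, j)) '' {j | I.OneEndConflict e j false} := by
    ext ⟨x, j⟩
    simp only [oneSet, hR0, Set.mem_union, Set.mem_ofPred_eq, Set.mem_image, Prod.mk.injEq,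
      Bool.not_false]
    constructor
    · rintro ⟨h1, h2⟩
      by_cases hx : x = e
      · subst hx; exact Or.inr ⟨j, h1, rfl, rfl⟩
      · exact Or.inl ⟨hx, h1, h2⟩
    · rintro (⟨-, h⟩ | ⟨j', h1, rfl, rfl⟩)
      · exact h
      · exact ⟨h1, he⟩
  have o2 : oneSet s' false = R0 := by
    ext ⟨x, j⟩
    simp only [oneSet, hR0, Set.mem_ofPred_eq, Bool.not_false]
    constructor
    · rintro ⟨h1, h2⟩
      have hx : x ≠ e := by rintro rfl; rw [hse] at h2; cases h2
      exact ⟨hx, h1, by rwa [hsne x hx] at h2⟩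
    · rintro ⟨hx, h1, h2⟩
      exact ⟨h1, by rwa [hsne x hx]⟩
  have o3 : oneSet s true = R1 := by
    ext ⟨x, j⟩
    simp only [oneSet, hR1, Set.mem_ofPred_eq, Bool.not_true]
    constructor
    · rintro ⟨h1, h2⟩
      refine ⟨?_, h1, h2⟩
      rintro rfl; rw [he] at h2; cases h2
    · rintro ⟨hx, h⟩; exact h
  have o4 : oneSet s' true = R1 ∪ (fun j => (e, j)) '' {j | I.OneEndConflict e j true} := by
    ext ⟨x, j⟩
    simp only [oneSet, hR1, Set.mem_union, Set.mem_ofPred_eq, Set.mem_image, Prod.mk.injEq,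
      Bool.not_true]
    constructor
    · rintro ⟨h1, h2⟩
      by_cases hx : x = e
      · subst hx; exact Or.inr ⟨j, h1, rfl, rfl⟩
      · exact Or.inl ⟨hx, h1, by rwa [hsne x hx] at h2⟩
    · rintro (⟨hx, h1, h2⟩ | ⟨j', h1, rfl, rfl⟩)
      · exact ⟨h1, by rwa [hsne x hx]⟩
      · exact ⟨h1, hse⟩
  have d1 : Disjoint R ((fun y => (e, y)) '' {y | I.TwoEndConflict e y ∧ s y = false}) := by
    rw [Set.disjoint_left]
    rintro _ ⟨h, -⟩ ⟨y, -, rfl⟩; exact h rfl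
  have d2 : Disjoint R ((fun y => (y, e)) '' {y | I.TwoEndConflict e y ∧ s y = true}) := by
    rw [Set.disjoint_left]
    rintro _ ⟨-, h, -⟩ ⟨y, -, rfl⟩; exact h rfl
  have d3 : Disjoint R0 ((fun j => (e, j)) '' {j | I.OneEndConflict e j false}) := by
    rw [Set.disjoint_left]
    rintro _ ⟨h, -⟩ ⟨y, -, rfl⟩; exact h rfl
  have d4 : Disjoint R1 ((fun j => (e, j)) '' {j | I.OneEndConflict e j true}) := by
    rw [Set.disjoint_left]
    rintro _ ⟨h, -⟩ ⟨y, -, rfl⟩; exact h rfl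
  rw [cost, cost, t1, t2, o1, o2, o3, o4, Set.ncard_union_eq d1 (Set.toFinite _) (Set.toFinite _),
    Set.ncard_union_eq d2 (Set.toFinite _) (Set.toFinite _),
    Set.ncard_union_eq d3 (Set.toFinite _) (Set.toFinite _),
    Set.ncard_union_eq d4 (Set.toFinite _) (Set.toFinite _),
    Set.ncard_image_of_injective _ (Prod.mk_right_injective e),
    Set.ncard_image_of_injective _ (Prod.mk_left_injective e),
    Set.ncard_image_of_injective _ (Prod.mk_right_injective e),
    Set.ncard_image_of_injective _ (Prod.mk_right_injective e), numWant, numWant]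
  ring

theorem numWant_update {b c : Bool} : numWant (Function.update s e c) e b = numWant s e b := by
  rw [numWant, numWant]
  congr 2
  ext y
  refine and_congr_right fun h => ?_
  have : y ≠ e := by rintro rfl; exact h.1 rfl
  rw [Function.update_of_ne this]

theorem cost_update_true (he : s e = false) :
    cost (Function.update s e true) + numWant s e true = cost s + numWant s e false := by
  have h := cost_update_false (s := Function.update s e true) (e := e) (by simp)
  have h0 : Function.update (Function.update s e true) e false = s := by
    rw [Function.update_idem, ← he, Function.update_eq_self]
  rw [numWant_update, numWant_update, h0] at h
  exact h.symm

/-- An assignment that is optimal and cannot be made smaller places line ends well. -/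
theorem good_of_minimal (hI : I.IsProper)
    (h1 : ∀ e, s e = true → cost s < cost (Function.update s e false))
    (h2 : ∀ e, s e = false → cost s ≤ cost (Function.update s e true)) : Good s := by
  intro i k u w hik pi pk hi hk si sk hdir
  have r1 := isPortOf_endAt pi hi
  have r2 := isPortOf_endAt pk hk
  have c1 := cost_update_false (s := s) (e := endAt i u) si
  have c2 := cost_update_true (s := s) (e := endAt k u) sk
  have c3 := h1 (endAt i u) si
  have c4 := h2 (endAt k u) sk
  rw [← ncard_wantSet hI, ← ncard_wantSet hI] at c1 c2
  have port : ∀ {i : Fin I.numLines} {u' w'}, I.IsPortOf (endAt i u) u w →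
      I.IsPortOf (endAt i u) u' w' → u' = u ∧ w' = w := by
    intro i u' w' h h'
    have e1 := h.spec.2.2.1
    rw [h'.spec.2.2.1] at e1
    exact ⟨(List.cons.inj e1).1, (List.cons.inj (List.cons.inj e1).2).1⟩
  have nn : ∀ i j, i ≠ j → I.Passes i u w → I.Passes j u w → I.arm i u w = [] →
      dir s i j w u ≠ none := by
    intro i j hij pi pj hi h0
    rw [dir_eq_none_iff pi.symm pj.symm] at h0
    exact hI i j hij (subpath_of_prefix pi pj (by simp [hi]) (h0 ▸ List.prefix_refl _))
  -- At the opposite port, `j` before `i` and `i` before `k` put `j` before `k`. Properness makes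
  -- the order of `j` and `k` determined, and `dir_acyclic` excludes the other one.
  have s1 : wantSet s (endAt i u) true ⊆ wantSet s (endAt k u) true := by
    rintro j ⟨hij, u', w', hp, pj, hj, hd⟩
    obtain ⟨rfl, rfl⟩ := port r1 hp
    have hkj : k ≠ j := by rintro rfl; exact hj hk
    refine ⟨hkj, u', w', r2, pj, hj, ?_⟩
    have h5 := dir_acyclic pj.symm pi.symm pk.symm hd hdir
    have h6 := nn k j hkj pk pj hk
    change dir s j k w' u' = some true
    rw [dir_symm pk.symm pj.symm]
    rcases hh : dir s k j w' u' with _ | _ | _ <;> simp_all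
  have s2 : wantSet s (endAt k u) false ⊆ wantSet s (endAt i u) false := by
    rintro j ⟨hkj, u', w', hp, pj, hj, hd⟩
    obtain ⟨rfl, rfl⟩ := port r2 hp
    have hij : i ≠ j := by rintro rfl; exact hj hi
    refine ⟨hij, u', w', r1, pj, hj, ?_⟩
    change dir s j k w' u' = some false at hd
    change dir s j i w' u' = some false
    have hd' : dir s k j w' u' = some true := by rw [dir_symm pj.symm pk.symm, hd]; rfl
    have h5 := dir_acyclic pi.symm pk.symm pj.symm hdir hd'
    have h6 := nn i j hij pi pj hi
    have h7 := dir_symm (s := s) pi.symm pj.symm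
    rw [h7] at h5 ⊢
    rcases hh : dir s i j w' u' with _ | _ | _ <;> simp_all
  have l1 := Set.ncard_le_ncard s1 (Set.toFinite _)
  have l2 := Set.ncard_le_ncard s2 (Set.toFinite _)
  -- want(i, true) ≤ want(k, true) ≤ want(k, false) ≤ want(i, false) < want(i, true), where the
  -- second step is the optimality at `k` and the last one the strict optimality at `i`.
  omega

end Network
end MetroLine

namespace MetroLine

/-! ### Minimum cuts by augmenting paths -/

section MinCut

variable {ν : Type} [DecidableEq ν]

/-- The number of arcs of `A` that leave the vertex set `X`. -/
def outArcs (A : List (ν × ν)) (X : ν → Bool) : ℕ :=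
  A.countP fun a => X a.1 && !X a.2

/-- The vertices reached by the tree arcs `T`. -/
def reached (c : ν) (T : List (ν × ν)) : List ν :=
  c :: T.map Prod.snd

/-- Adds an arc of `A` that leaves the set of reached vertices to the tree, if there is any. -/
def growTree (A : List (ν × ν)) (c : ν) (T : List (ν × ν)) : List (ν × ν) :=
  (A.filter fun a => decide (a.1 ∈ reached c T) && !decide (a.2 ∈ reached c T)).take 1 ++ T

def searchTree (A : List (ν × ν)) (c : ν) : List (ν × ν) :=
  (growTree A c)^[A.length] []

/-- Follows a path backwards: the arc `a` is reversed if it enters the current vertex. -/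
def reverseArc (x : List (ν × ν) × ν) (a : ν × ν) : List (ν × ν) × ν :=
  if a.2 = x.2 then ((a.2, a.1) :: x.1.erase a, a.1) else x

/-- The tree lists its latest arcs first, so one pass starting from `d` meets the arcs of the path
back to `c` in the right order. -/
def augment (c d : ν) (A : List (ν × ν)) : List (ν × ν) :=
  if d ∈ reached c (searchTree A c) then ((searchTree A c).foldl reverseArc (A, d)).1 else A

/-- The source side of the minimum cut with the smallest source side. -/
def minCut (c d : ν) (A : List (ν × ν)) : List ν :=
  let A' := (augment c d)^[A.length + 1] A
  reached c (searchTree A' c)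

/-- `T` lists the arcs of a tree with root `c`, the latest arc first. -/
def IsSearchTree (A : List (ν × ν)) (c : ν) : List (ν × ν) → Prop
  | [] => True
  | a :: T => a ∈ A ∧ a.1 ∈ reached c T ∧ a.2 ∉ reached c T ∧ IsSearchTree A c T

variable {A T : List (ν × ν)} {c d v : ν} {X : ν → Bool}

theorem growTree_cases (A : List (ν × ν)) (c : ν) (T : List (ν × ν)) :
    (growTree A c T = T ∧ outArcs A (fun x => decide (x ∈ reached c T)) = 0) ∨
    ∃ a ∈ A, a.1 ∈ reached c T ∧ a.2 ∉ reached c T ∧ growTree A c T = a :: T := by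
  unfold growTree outArcs
  rcases h : A.filter fun a => decide (a.1 ∈ reached c T) && !decide (a.2 ∈ reached c T) with _ | ⟨a, l⟩
  · exact Or.inl ⟨by rw [h]; rfl, by rw [List.countP_eq_length_filter, h]; rfl⟩
  · have : a ∈ A.filter fun a => decide (a.1 ∈ reached c T) && !decide (a.2 ∈ reached c T) := by
      rw [h]; simp
    rw [List.mem_filter] at this
    refine Or.inr ⟨a, this.1, ?_, ?_, by rw [h]; rfl⟩ <;> simp_all

theorem isSearchTree_iterate (A : List (ν × ν)) (c : ν) (k : ℕ) : IsSearchTree A c ((growTree A c)^[k] []) := by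
  induction k with
  | zero => trivial
  | succ k ih =>
    rw [Function.iterate_succ_apply']
    rcases growTree_cases A c ((growTree A c)^[k] []) with ⟨h, -⟩ | ⟨a, h1, h2, h3, h4⟩
    · rwa [h]
    · rw [h4]; exact ⟨h1, h2, h3, ih⟩

theorem isSearchTree_searchTree : IsSearchTree A c (searchTree A c) :=
  isSearchTree_iterate A c _

/-- Each successful round reaches the head of an arc for the first time, so the number of arcs with
unreached heads decreases; after `A.length` rounds no arc leaves the reached set. -/
theorem outArcs_searchTree : outArcs A (fun x => decide (x ∈ reached c (searchTree A c))) = 0 := by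
  have key : ∀ k, outArcs A (fun x => decide (x ∈ reached c ((growTree A c)^[k] []))) = 0 ∨
      (A.countP fun a => decide (a.2 ∉ reached c ((growTree A c)^[k] []))) + k ≤ A.length := by
    intro k
    induction k with
    | zero => exact Or.inr List.countP_le_length
    | succ k ih =>
      rw [Function.iterate_succ_apply']
      rcases growTree_cases A c ((growTree A c)^[k] []) with ⟨h, h'⟩ | ⟨a, h1, h2, h3, h4⟩
      · rw [h]; exact Or.inl h'
      · rcases ih with ih | ih
        · exfalso
          rw [outArcs, List.countP_eq_zero] at ih
          exact ih a h1 (by simp [h2, h3])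
        · right
          rw [h4]
          have : (A.countP fun b => decide (b.2 ∉ reached c (a :: (growTree A c)^[k] []))) <
              A.countP fun b => decide (b.2 ∉ reached c ((growTree A c)^[k] [])) := by
            obtain ⟨A1, A2, rfl⟩ := List.append_of_mem h1
            rw [List.countP_append, List.countP_append, List.countP_cons, List.countP_cons]
            have m : ∀ b : ν × ν, b.2 ∉ reached c (a :: (growTree (A1 ++ a :: A2) c)^[k] []) →
                b.2 ∉ reached c ((growTree (A1 ++ a :: A2) c)^[k] []) := by
              intro b hb hb'
              apply hb
              simp only [reached, List.map_cons, List.mem_cons] at hb' ⊢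
              tauto
            have m1 : ∀ l : List (ν × ν), (l.countP fun b => decide
                (b.2 ∉ reached c (a :: (growTree (A1 ++ a :: A2) c)^[k] []))) ≤
                l.countP fun b => decide (b.2 ∉ reached c ((growTree (A1 ++ a :: A2) c)^[k] [])) :=
              fun l => List.countP_mono_left fun b _ hb => by simpa using m b (by simpa using hb)
            have := m1 A1
            have := m1 A2
            rw [if_neg, if_pos (by simpa using h3)]
            · omega
            · simp [reached]
          omega
  rcases key A.length with h | h
  · exact h
  · have h0 : (A.countP fun a => decide (a.2 ∉ reached c (searchTree A c))) = 0 := by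
      change _ + A.length ≤ A.length at h
      unfold searchTree; omega
    rw [outArcs, List.countP_eq_zero]
    rw [List.countP_eq_zero] at h0
    intro a ha
    have := h0 a ha
    simp_all

/-- Reversing an arc changes the size of a cut by a difference of the values at its ends, written
here without subtraction; such differences telescope along a path. -/
theorem outArcs_reverse {a : ν × ν} (ha : a ∈ A) :
    outArcs ((a.2, a.1) :: A.erase a) X + (X a.1).toNat = outArcs A X + (X a.2).toNat := by
  have h : outArcs A X = outArcs (a :: A.erase a) X := (List.perm_cons_erase ha).countP_eq _
  rw [h, outArcs, outArcs, List.countP_cons, List.countP_cons]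
  rcases h1 : X a.1 <;> rcases h2 : X a.2 <;> simp

omit [DecidableEq ν] in
theorem IsSearchTree.mem (h : IsSearchTree A c T) {a : ν × ν} (ha : a ∈ T) : a ∈ A := by
  induction T with
  | nil => simp at ha
  | cons b T ih =>
    rcases List.mem_cons.1 ha with rfl | ha
    · exact h.1
    · exact ih h.2.2.2 ha

/-- The older tree arcs have heads other than that of `a`, so they are not erased. -/
theorem IsSearchTree.of_erase {a : ν × ν} (hT : IsSearchTree A c (a :: T)) :
    IsSearchTree ((a.2, a.1) :: A.erase a) c T := by
  have hmem : ∀ b ∈ T, b ∈ (a.2, a.1) :: A.erase a := by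
    intro b hb
    refine List.mem_cons_of_mem _ ((List.mem_erase_of_ne ?_).2 (hT.2.2.2.mem hb))
    rintro rfl
    exact hT.2.2.1 (by simp only [reached, List.mem_cons, List.mem_map]; exact Or.inr ⟨_, hb, rfl⟩)
  have hT' := hT.2.2.2
  clear hT
  induction T with
  | nil => trivial
  | cons b T ih =>
    exact ⟨hmem b (by simp), hT'.2.1, hT'.2.2.1,
      ih (fun x hx => hmem x (List.mem_cons_of_mem _ hx)) hT'.2.2.2⟩

/-- The changes along the path from `c` to `v` telescope. With `v = d`, every cut that separates `c`
from `d` loses exactly one arc. -/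
theorem outArcs_foldl (A : List (ν × ν)) (T : List (ν × ν)) (v : ν) (hT : IsSearchTree A c T)
    (hv : v ∈ reached c T) :
    outArcs (T.foldl reverseArc (A, v)).1 X + (X c).toNat = outArcs A X + (X v).toNat := by
  induction T generalizing A v with
  | nil =>
    obtain rfl : v = c := by simpa [reached] using hv
    rfl
  | cons a T ih =>
    rw [List.foldl_cons]
    by_cases h : a.2 = v
    · have h1 : reverseArc (A, v) a = ((a.2, a.1) :: A.erase a, a.1) := by simp [reverseArc, h]
      rw [h1, ih]
      · rw [outArcs_reverse hT.1, h]
      · exact hT.of_erase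
      · exact hT.2.1
    · have h1 : reverseArc (A, v) a = (A, v) := by simp [reverseArc, h]
      rw [h1]
      refine ih A v hT.2.2.2 ?_
      simp only [reached, List.map_cons, List.mem_cons] at hv ⊢
      rcases hv with hv | hv | hv
      · exact Or.inl hv
      · exact absurd hv.symm h
      · exact Or.inr hv

/-- `f` is the value of the flow. It is subtracted from all cuts alike, so the residual network has
the same minimum cuts. -/
theorem exists_outArcs_iterate (A : List (ν × ν)) (c d : ν) (k : ℕ) : ∃ f,
    (∀ X : ν → Bool, X c = true → X d = false →
      outArcs A X = outArcs ((augment c d)^[k] A) X + f) ∧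
    (f = k ∨ d ∉ reached c (searchTree ((augment c d)^[k] A) c)) := by
  induction k with
  | zero => exact ⟨0, fun _ _ _ => rfl, Or.inl rfl⟩
  | succ k ih =>
    obtain ⟨f, h1, h2⟩ := ih
    rw [Function.iterate_succ_apply']
    by_cases hd : d ∈ reached c (searchTree ((augment c d)^[k] A) c)
    · refine ⟨f + 1, fun X hc hd' => ?_, Or.inl (by tauto)⟩
      have := outArcs_foldl (X := X) _ _ d isSearchTree_searchTree hd
      rw [h1 X hc hd']
      rw [hc, hd'] at this
      rw [augment, if_pos hd]
      simp only [Bool.toNat_true, Bool.toNat_false] at this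
      omega
    · have : augment c d ((augment c d)^[k] A) = (augment c d)^[k] A := by rw [augment, if_neg hd]
      rw [this]
      exact ⟨f, h1, Or.inr hd⟩

theorem exists_minCut (A : List (ν × ν)) (hcd : c ≠ d) : ∃ (A' : List (ν × ν)) (f : ℕ),
    (∀ X : ν → Bool, X c = true → X d = false → outArcs A X = outArcs A' X + f) ∧
    minCut c d A = reached c (searchTree A' c) ∧ d ∉ minCut c d A := by
  obtain ⟨f, h1, h2⟩ := exists_outArcs_iterate A c d (A.length + 1)
  refine ⟨_, f, h1, rfl, ?_⟩
  rcases h2 with h2 | h2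
  -- If all rounds had succeeded, the cut with source side `{c}` would have more than `A.length`
  -- arcs.
  · exfalso
    have := h1 (fun x => decide (x = c)) (by simp) (by simpa using hcd.symm)
    have h3 : outArcs A (fun x => decide (x = c)) ≤ A.length := List.countP_le_length
    omega
  · exact h2

theorem mem_minCut_source : c ∈ minCut c d A := by
  simp [minCut, reached]

theorem not_mem_minCut_sink (hcd : c ≠ d) : d ∉ minCut c d A :=
  let ⟨_, _, _, _, h⟩ := exists_minCut A hcd
  h

theorem outArcs_minCut_le (hcd : c ≠ d) (hc : X c = true) (hd : X d = false) :
    outArcs A (fun x => decide (x ∈ minCut c d A)) ≤ outArcs A X := by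
  obtain ⟨A', f, h1, h2, h3⟩ := exists_minCut A hcd
  rw [h1 X hc hd, h1 _ (by simpa using mem_minCut_source) (by simpa using h3), h2,
    outArcs_searchTree]
  omega

/-- In the residual network the reached set has no leaving arc, but without `v` it is left by the
tree arc through which `v` was reached. This supplies the strict inequality of `good_of_minimal`. -/
theorem outArcs_minCut_lt (hcd : c ≠ d) (hc : X c = true) (hd : X d = false)
    (hv : v ∈ minCut c d A) (hv' : v ≠ c) (hX : ∀ x, X x = true ↔ x ∈ minCut c d A ∧ x ≠ v) :
    outArcs A (fun x => decide (x ∈ minCut c d A)) < outArcs A X := by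
  obtain ⟨A', f, h1, h2, h3⟩ := exists_minCut A hcd
  rw [h1 X hc hd, h1 _ (by simpa using mem_minCut_source) (by simpa using h3)]
  rw [h2] at hX hv ⊢
  rw [outArcs_searchTree]
  have key : ∀ T, IsSearchTree A' c T → v ∈ reached c T →
      ∃ a ∈ A', a.1 ∈ reached c T ∧ a.1 ≠ v ∧ a.2 = v := by
    intro T hT hvT
    induction T with
    | nil => simp [reached, hv'] at hvT
    | cons a T ih =>
      have hsub : ∀ x, x ∈ reached c T → x ∈ reached c (a :: T) := by
        intro x hx
        simp only [reached, List.map_cons, List.mem_cons] at hx ⊢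
        tauto
      by_cases h : v ∈ reached c T
      · obtain ⟨b, hb, h4, h5⟩ := ih hT.2.2.2 h
        exact ⟨b, hb, hsub _ h4, h5⟩
      · have : v = a.2 := by
          simp only [reached, List.map_cons, List.mem_cons] at hvT h
          tauto
        exact ⟨a, hT.1, hsub _ hT.2.1, fun h' => h (h' ▸ hT.2.1), this.symm⟩
  obtain ⟨a, ha, h4, h5, h6⟩ := key _ isSearchTree_searchTree hv
  have : 0 < outArcs A' X := by
    rw [outArcs, List.countP_pos_iff]
    refine ⟨a, ha, ?_⟩
    have e1 : X a.1 = true := (hX _).2 ⟨h4, h5⟩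
    have e2 : X a.2 = false := by
      rw [Bool.eq_false_iff]; intro h; exact ((hX _).1 h).2 h6
    simp [e1, e2]
  omega

end MinCut

end MetroLine

/-! ### The cost of positions as the capacity of a cut -/

namespace MetroLine

section ConflictArc

variable {α : Type} [DecidableEq α]

theorem look_prefix {p c : α} {A B : List α} (h : (look p c A B).2.2.2 = []) : B <+: A := by
  induction A generalizing p c B with
  | nil => cases B <;> simp_all [look]
  | cons a A ih =>
    cases B with
    | nil => simp
    | cons b B =>
      by_cases hab : a = b
      · subst hab
        rw [look_cons_cons] at h
        exact List.cons_prefix_cons.2 ⟨rfl, ih h⟩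
      · simp [look, hab] at h

/-- The arc of the flow network with source `0` and sink `1` that expresses the conflict of a line
end, represented by the node `x`, with a line `l`, whose ends are the nodes `y` and `y + 1`. -/
def conflictArc (clk : α → α → α → α → Bool) (l : List α) (x y : ℕ)
    (r : α × α × List α × List α) : ℕ × ℕ :=
  if dirOf clk (fun _ => false) (fun _ => false) r = some true then (0, x)
  else if dirOf clk (fun _ => true) (fun _ => true) r = some false then (x, 1)
  else (x, y + (decide (l.head? ≠ some r.2.1)).toNat)

end ConflictArc

namespace Network

variable {I : Network} {i j k : Fin I.numLines} {u w v z a b x y : Fin I.n} {s : I.LineEnd → Bool}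
  {e : I.LineEnd}

/-- The pairs of line ends and lines with a conflict that is counted by `cost`. -/
def pairSet (s : I.LineEnd → Bool) : Set (I.LineEnd × Fin I.numLines) :=
  {x | x.2 ∈ wantSet (if s x.1 then s else fun _ => false) x.1 !s x.1}

/-- A violated formula with two variables is counted only at its end with value `true`: for an end
with value `false`, the assignment is replaced by the constant `false`, which leaves only the
formulas with one variable. -/
theorem ncard_pairSet (hI : I.IsProper) : (pairSet s).ncard = cost s := by
  have h1 : pairSet s = ((fun x : I.LineEnd × I.LineEnd => (x.1, x.2.1)) '' twoSet s ∪
      oneSet s false) ∪ oneSet s true := by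
    ext ⟨e, j⟩
    simp only [pairSet, Set.mem_ofPred_eq]
    rw [mem_wantSet_iff hI]
    rcases h : s e with _ | _
    · constructor
      · rintro (⟨y, ⟨-, h1⟩, -⟩ | h1)
        · simp at h1
        · exact Or.inr ⟨h1, h⟩
      · rintro ((⟨⟨e', y⟩, ⟨-, h1, -⟩, h2⟩ | ⟨-, h1⟩) | ⟨h1, -⟩)
        · obtain rfl : e' = e := congrArg Prod.fst h2
          simp [h] at h1
        · simp [h] at h1
        · exact Or.inr h1
    · constructor
      · rintro (⟨y, ⟨h1, h2⟩, rfl⟩ | h1)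
        · exact Or.inl (Or.inl ⟨(e, y), ⟨h1, h, h2⟩, rfl⟩)
        · exact Or.inl (Or.inr ⟨h1, h⟩)
      · rintro ((⟨⟨e', y⟩, ⟨h0, h1, h3⟩, h2⟩ | ⟨h1, -⟩) | ⟨-, h1⟩)
        · obtain rfl : e' = e := congrArg Prod.fst h2
          obtain rfl : y.1 = j := congrArg Prod.snd h2
          exact Or.inl ⟨y, ⟨h0, h3⟩, rfl⟩
        · exact Or.inr h1
        · simp [h] at h1
  have h2 : Set.InjOn (fun x : I.LineEnd × I.LineEnd => (x.1, x.2.1)) (twoSet s) := by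
    rintro ⟨e, y⟩ ⟨hy, -⟩ ⟨e', y'⟩ ⟨hy', -⟩ heq
    simp only [Prod.mk.injEq] at heq hy hy'
    obtain ⟨rfl, heq⟩ := heq
    refine Prod.ext rfl ?_
    exact twoEndConflict_unique hy hy' heq
  have h3 : Disjoint ((fun x : I.LineEnd × I.LineEnd => (x.1, x.2.1)) '' twoSet s)
      (oneSet s false) := by
    rw [Set.disjoint_left]
    rintro _ ⟨⟨e, y⟩, ⟨hy, -⟩, rfl⟩ ⟨hy', -⟩
    exact hy.not_oneEndConflict hy'
  have h4 : Disjoint ((fun x : I.LineEnd × I.LineEnd => (x.1, x.2.1)) '' twoSet s ∪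
      oneSet s false) (oneSet s true) := by
    rw [Set.disjoint_left]
    rintro ⟨e, j⟩ h ⟨-, h'⟩
    simp only [Bool.not_true] at h'
    rcases h with ⟨⟨e', y⟩, ⟨-, hy, -⟩, heq⟩ | ⟨-, h⟩
    · simp only [Prod.mk.injEq] at heq hy
      rw [heq.1, h'] at hy; cases hy
    · simp only [Bool.not_false] at h
      rw [h] at h'; cases h'
  rw [h1, Set.ncard_union_eq h4 (Set.toFinite _) (Set.toFinite _),
    Set.ncard_union_eq h3 (Set.toFinite _) (Set.toFinite _), h2.ncard_image, cost]

/-- The node of the flow network for a line end. -/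
def endNode (e : I.LineEnd) : ℕ := e.1.val + e.1.val + 2 + e.2.toNat

theorem endNode_injective : Function.Injective (endNode (I := I)) := by
  rintro ⟨i, b⟩ ⟨j, c⟩ h
  have : i.val = j.val ∧ b = c := by
    cases b <;> cases c <;> simp only [endNode, Bool.toNat_true, Bool.toNat_false] at h <;>
      constructor <;> first | rfl | omega
  exact Prod.ext (Fin.ext this.1) this.2

/-- If the lines split, the constant assignments in `conflictArc` detect which value is wanted, and
an arc from the source or to the sink expresses it. If `j` ends, the arc leads to that end of `j`
and is cut exactly if `e` has value `true` and the end of `j` has value `false`. -/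
theorem conflictArc_cut_iff (hI : I.IsProper) {X : ℕ → Bool} (h0 : X 0 = true) (h1 : X 1 = false)
    (hs : ∀ e, X (endNode e) = s e) (he : I.IsPortOf e u w) (hij : e.1 ≠ j) (hj : I.Passes j u w) :
    (X (conflictArc clock (I.line j) (endNode e) (endNode (j, false))
        (look u w (I.arm j w u) (I.arm e.1 w u))).1 &&
      !X (conflictArc clock (I.line j) (endNode e) (endNode (j, false))
        (look u w (I.arm j w u) (I.arm e.1 w u))).2) = true ↔
      dir (if s e then s else fun _ => false) j e.1 w u = some !s e := by
  -- Otherwise the line of `e`, which ends at `u`, would be a subpath of `j`; so it does not end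
  -- where the two lines separate.
  have hp : ¬ I.arm e.1 w u <+: I.arm j w u := by
    intro h
    obtain ⟨p1, p2, -⟩ := he.spec
    exact hI e.1 j hij (subpath_of_prefix p1 hj (by simp [p2]) h)
  have hlook := mt (look_prefix (p := u) (c := w)) hp
  unfold dir
  generalize hr : look u w (I.arm j w u) (I.arm e.1 w u) = r at hlook
  obtain ⟨p, c, A, B⟩ := r
  rcases B with _ | ⟨b, B⟩
  · exact absurd rfl hlook
  rcases A with _ | ⟨a, A⟩
  · have h2 : X (endNode (j, false) + (decide ((I.line j).head? ≠ some c)).toNat) =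
        s (endAt j c) := by
      rw [← hs]; congr 1
    simp only [conflictArc, dirOf, Option.some.injEq, Bool.false_eq_true, if_false,
      Bool.true_eq_false, h2, hs]
    rcases s e with _ | _ <;> simp [endVal_eq]
  · simp only [conflictArc, dirOf, Option.some.injEq]
    generalize clock _ _ b a = q
    rcases q with _ | _
    · rcases h : s e with _ | _ <;> simp [h1, hs, h]
    · rcases h : s e with _ | _ <;> simp [h0, hs, h]

/-- The position assignment given by a node set of the flow network. -/
def assignment (I : Network) (X : List ℕ) : I.LineEnd → Bool :=
  fun e => decide (endNode e ∈ X)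

/-- Every assignment is the restriction of a cut, so a minimum cut gives an optimal one. Removing a
line end from the source side strictly increases the cost, as `good_of_minimal` requires. -/
theorem minCut_optimal (hI : I.IsProper) {A : List (ℕ × ℕ)} (hA : ∀ X : ℕ → Bool, X 0 = true →
      X 1 = false → outArcs A X = cost fun e : I.LineEnd => X (endNode e)) :
    Good (I.assignment (minCut 0 1 A)) ∧ ∀ s : I.LineEnd → Bool,
      cost (I.assignment (minCut 0 1 A)) ≤ cost s := by
  classical
  set M := minCut 0 1 A with hM
  have e0 : ∀ e : I.LineEnd, endNode e ≠ 0 ∧ endNode e ≠ 1 := fun e => by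
    unfold endNode; omega
  have h01 : (0 : ℕ) ≠ 1 := by decide
  have c0 : cost (I.assignment M) = outArcs A fun x => decide (x ∈ M) := by
    rw [hA _ (by simpa [hM] using mem_minCut_source) (by simpa [hM] using not_mem_minCut_sink h01)]
    rfl
  have key : ∀ s : I.LineEnd → Bool, cost (I.assignment M) ≤ cost s := by
    intro s
    set X : ℕ → Bool := fun x => decide (x = 0 ∨ ∃ e, endNode e = x ∧ s e = true) with hX
    have x1 : X 1 = false := by
      simp only [hX, decide_eq_false_iff_not]
      rintro (h | ⟨e, h, -⟩)
      · cases h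
      · exact (e0 e).2 h
    have x2 : (fun e => X (endNode e)) = s := by
      funext e
      rw [Bool.eq_iff_iff]
      simp only [hX, decide_eq_true_eq, (e0 e).1, false_or]
      constructor
      · rintro ⟨e', h, h'⟩; rwa [← endNode_injective h]
      · exact fun h => ⟨e, rfl, h⟩
    have := hA X (by simp [hX]) x1
    rw [x2] at this
    rw [c0, ← this]
    exact outArcs_minCut_le h01 (by simp [hX]) x1
  refine ⟨good_of_minimal hI ?_ (fun e _ => key _), key⟩
  intro e he
  simp only [assignment, decide_eq_true_eq] at he
  set X : ℕ → Bool := fun x => decide (x ∈ M ∧ x ≠ endNode e) with hX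
  have x0 : X 0 = true := by
    simp only [hX, decide_eq_true_eq]
    exact ⟨mem_minCut_source, (e0 e).1.symm⟩
  have x1 : X 1 = false := by
    simp only [hX, decide_eq_false_iff_not]
    exact fun h => not_mem_minCut_sink h01 h.1
  have x2 : (fun e' => X (endNode e')) = Function.update (I.assignment M) e false := by
    funext e'
    by_cases h : e' = e
    · subst h; simp [hX]
    · rw [Function.update_of_ne h]
      simp [hX, assignment, endNode_injective.eq_iff, h]
  have := hA X x0 x1
  rw [x2] at this
  rw [c0, ← this]
  exact outArcs_minCut_lt h01 x0 x1 he (e0 e).1 (fun x => by simp [hX, hM])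

theorem isOptimal_layoutOf (hI : I.IsProper) (hs : Good s) (h : ∀ s' : I.LineEnd → Bool, cost s ≤ cost s') :
    IsOptimal (layoutOf s) := by
  refine ⟨isSolution_layoutOf hI hs, fun π' hπ' => ?_⟩
  obtain ⟨s', hs'⟩ := hπ'.exists_describedBy
  exact (crossings_layoutOf_le hI hs).trans
    ((Nat.add_le_add_right (h s') _).trans (hπ'.le_crossings hI hs'))

/-- The layout is described by some positions `s'`, and the minimality of `s` turns the lower bound
for `s'` into one for `s`. -/
theorem crossings_layoutOf (hI : I.IsProper) (hs : Good s) (h : ∀ s' : I.LineEnd → Bool, cost s ≤ cost s') :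
    crossings (layoutOf s) = cost s + I.unavoidableCrossings := by
  refine (crossings_layoutOf_le hI hs).antisymm ?_
  obtain ⟨s', hs'⟩ := (isSolution_layoutOf hI hs).exists_describedBy
  exact (Nat.add_le_add_right (h s') _).trans ((isSolution_layoutOf hI hs).le_crossings hI hs')

end Network
end MetroLine

namespace MetroLine

/-! ### Functions computable in polynomial time -/

/-- Types with an encoding by binary trees. -/
class TreeEncoding (α : Type) where
  enc : α → Data

open TreeEncoding (enc)

instance : TreeEncoding ℕ := ⟨Data.ofNat⟩

instance : TreeEncoding Unit := ⟨fun _ => .nil⟩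

instance : TreeEncoding Bool := ⟨fun b => if b then .cons .nil .nil else .nil⟩

instance {α β : Type} [TreeEncoding α] [TreeEncoding β] : TreeEncoding (α × β) :=
  ⟨fun x => .cons (enc x.1) (enc x.2)⟩

instance {α : Type} [TreeEncoding α] : TreeEncoding (List α) :=
  ⟨fun l => Data.ofList (l.map enc)⟩

/-- The size of the encoding. -/
def encSize {α : Type} [TreeEncoding α] (x : α) : ℕ := (enc x).size

/-- The function `f` is computed by a program in polynomial time. -/
@[fun_prop]
def PolyFun {α β : Type} [TreeEncoding α] [TreeEncoding β] (f : α → β) : Prop :=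
  ∃ (p : Prog) (q : Polynomial ℕ), ∀ x, ∃ t, Runs p (enc x) (enc (f x)) t ∧ t ≤ q.eval (encSize x)

theorem Data.size_pos (x : Data) : 1 ≤ x.size := by
  cases x <;> simp [Data.size]

/-- Time bounds the size of the output; therefore time bounds can be composed by substituting
polynomials. -/
theorem Runs.size_le {p : Prog} {x y : Data} {t : ℕ} (h : Runs p x y t) : x.size ≤ t ∧ y.size ≤ t := by
  have h0 := Data.size_pos x
  induction h <;> (try simp only [Data.size] at *) <;> grind [Data.size_pos]

theorem polynomial_eval_mono (q : Polynomial ℕ) : Monotone fun n => q.eval n := by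
  intro a b h
  simp only [Polynomial.eval_eq_sum_range]
  exact Finset.sum_le_sum fun i _ => Nat.mul_le_mul_left _ (Nat.pow_le_pow_left h i)

section Sizes

variable {α β : Type} [TreeEncoding α] [TreeEncoding β]

theorem encSize_pos (x : α) : 1 ≤ encSize x := Data.size_pos _

@[simp] theorem encSize_prod (x : α × β) : encSize x = encSize x.1 + encSize x.2 + 1 := rfl

@[simp] theorem encSize_nil : encSize ([] : List α) = 1 := rfl

@[simp] theorem encSize_cons (a : α) (l : List α) : encSize (a :: l) = encSize a + encSize l + 1 := rfl

@[simp] theorem encSize_nat (n : ℕ) : encSize n = 2 * n + 1 := by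
  induction n with
  | zero => rfl
  | succ n ih =>
    have : encSize (n + 1) = 1 + encSize n + 1 := rfl
    omega

theorem encSize_mem {a : α} {l : List α} (h : a ∈ l) : encSize a + 1 ≤ encSize l := by
  induction l with
  | nil => simp at h
  | cons b l ih =>
    have := encSize_pos b
    have := encSize_pos l
    rcases List.mem_cons.1 h with rfl | h
    · simp only [encSize_cons]; omega
    · have := ih h
      simp only [encSize_cons]; omega

theorem length_le_encSize (l : List α) : l.length + 1 ≤ encSize l := by
  induction l with
  | nil => simp
  | cons b l ih => simp only [encSize_cons, List.length_cons]; omega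

theorem encSize_append (l l' : List α) : encSize (l ++ l') + 1 = encSize l + encSize l' := by
  induction l with
  | nil => simp; omega
  | cons b l ih => simp only [encSize_cons, List.cons_append]; omega

theorem encSize_perm {l l' : List α} (h : l.Perm l') : encSize l = encSize l' := by
  induction h with
  | nil => rfl
  | cons _ _ ih => simp [ih]
  | swap _ _ _ => simp; omega
  | trans _ _ h1 h2 => exact h1.trans h2

theorem encSize_tail_le (l : List α) : encSize l.tail ≤ encSize l := by
  cases l <;> simp; omega

end Sizes

namespace PolyFun

variable {α β γ σ : Type} [TreeEncoding α] [TreeEncoding β] [TreeEncoding γ] [TreeEncoding σ]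

theorem size_le {f : α → β} (hf : PolyFun f) :
    ∃ q : Polynomial ℕ, ∀ x, encSize (f x) ≤ q.eval (encSize x) := by
  obtain ⟨p, q, h⟩ := hf
  refine ⟨q, fun x => ?_⟩
  obtain ⟨t, h1, h2⟩ := h x
  exact h1.size_le.2.trans h2

/-- Values of different types with the same tree are interchangeable, for instance a list and the
pair of its head and tail. -/
theorem of_enc {β' : Type} [TreeEncoding β'] {f : α → β} {g : α → β'} (hf : PolyFun f)
    (h : ∀ x, enc (g x) = enc (f x)) : PolyFun g := by
  obtain ⟨p, q, hp⟩ := hf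
  exact ⟨p, q, fun x => by rw [h]; exact hp x⟩

@[fun_prop]
theorem id' : PolyFun (fun x : α => x) :=
  ⟨.skip, Polynomial.X, fun x => ⟨_, .skip _, by simp [encSize]⟩⟩

theorem exists_const (d : Data) : ∃ (p : Prog) (q : Polynomial ℕ), ∀ x : Data, ∃ t, Runs p x d t ∧
    t ≤ q.eval x.size := by
  induction d with
  | nil => exact ⟨.nil, Polynomial.X, fun x => ⟨_, .nil _, by simp⟩⟩
  | cons a b iha ihb =>
    obtain ⟨p, q, h⟩ := iha
    obtain ⟨p', q', h'⟩ := ihb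
    refine ⟨.pair p p', q + q' + Polynomial.X, fun x => ?_⟩
    obtain ⟨t, h1, h2⟩ := h x
    obtain ⟨t', h1', h2'⟩ := h' x
    exact ⟨_, .pair h1 h1', by simp; omega⟩

@[fun_prop]
theorem const (b : β) : PolyFun (fun _ : α => b) := by
  obtain ⟨p, q, h⟩ := exists_const (enc b)
  exact ⟨p, q, fun x => h _⟩

@[fun_prop]
theorem comp {g : β → γ} {f : α → β} (hg : PolyFun g) (hf : PolyFun f) :
    PolyFun (fun x => g (f x)) := by
  obtain ⟨p, q, h⟩ := hf
  obtain ⟨p', q', h'⟩ := hg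
  refine ⟨.seq p p', q + q'.comp q + Polynomial.X, fun x => ?_⟩
  obtain ⟨t, h1, h2⟩ := h x
  obtain ⟨t', h1', h2'⟩ := h' (f x)
  refine ⟨_, .seq h1 h1', ?_⟩
  have h3 := polynomial_eval_mono q' (h1.size_le.2.trans h2)
  simp only [Polynomial.eval_add, Polynomial.eval_comp, Polynomial.eval_X]
  simp only [encSize] at *
  omega

@[fun_prop]
theorem prodMk {f : α → β} {g : α → γ} (hf : PolyFun f) (hg : PolyFun g) :
    PolyFun (fun x => (f x, g x)) := by
  obtain ⟨p, q, h⟩ := hf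
  obtain ⟨p', q', h'⟩ := hg
  refine ⟨.pair p p', q + q' + Polynomial.X, fun x => ?_⟩
  obtain ⟨t, h1, h2⟩ := h x
  obtain ⟨t', h1', h2'⟩ := h' x
  exact ⟨_, .pair h1 h1', by simp only [Polynomial.eval_add, Polynomial.eval_X, encSize] at *; omega⟩

theorem fst' : PolyFun (fun x : α × β => x.1) :=
  ⟨.head, Polynomial.X, fun _ => ⟨_, .head_cons _ _, by simp [encSize, enc]⟩⟩

theorem snd' : PolyFun (fun x : α × β => x.2) :=
  ⟨.tail, Polynomial.X, fun _ => ⟨_, .tail_cons _ _, by simp [encSize, enc]⟩⟩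

@[fun_prop]
theorem fst {f : α → β × γ} (hf : PolyFun f) : PolyFun (fun x => (f x).1) := comp fst' hf

@[fun_prop]
theorem snd {f : α → β × γ} (hf : PolyFun f) : PolyFun (fun x => (f x).2) := comp snd' hf

@[fun_prop]
theorem cons {f : α → β} {g : α → List β} (hf : PolyFun f) (hg : PolyFun g) :
    PolyFun (fun x => f x :: g x) :=
  (prodMk hf hg).of_enc fun _ => rfl

@[fun_prop]
theorem tail {f : α → List β} (hf : PolyFun f) : PolyFun (fun x => (f x).tail) := by
  refine comp (g := List.tail) ⟨.tail, Polynomial.X, fun l => ?_⟩ hf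
  cases l with
  | nil => exact ⟨_, .tail_nil, by simp [encSize, enc, Data.ofList]⟩
  | cons a l => exact ⟨_, .tail_cons _ _, by simp [encSize, enc, Data.ofList]⟩

@[fun_prop]
theorem succ {f : α → ℕ} (hf : PolyFun f) : PolyFun (fun x => f x + 1) :=
  (prodMk (const ()) hf).of_enc fun _ => rfl

@[fun_prop]
theorem pred {f : α → ℕ} (hf : PolyFun f) : PolyFun (fun x => (f x).pred) := by
  refine comp (g := Nat.pred) ⟨.tail, Polynomial.X, fun l => ?_⟩ hf
  cases l with
  | zero => exact ⟨_, .tail_nil, by simp [encSize, enc, Data.ofNat]⟩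
  | succ l => exact ⟨_, .tail_cons _ _, by simp [encSize, enc, Data.ofNat]⟩

/-- Case distinction by whether the encoding of `c x` is `nil`. -/
theorem ite_enc {c : α → γ} {f g : α → β} (P : α → Prop) [DecidablePred P] (hc : PolyFun c)
    (hP : ∀ x, P x ↔ enc (c x) ≠ .nil) (hf : PolyFun f) (hg : PolyFun g) :
    PolyFun (fun x => if P x then f x else g x) := by
  obtain ⟨p, q, h⟩ := hf
  obtain ⟨p', q', h'⟩ := hg
  obtain ⟨p'', q'', h''⟩ := hc
  refine ⟨.cond p'' p p', q + q' + q'' + Polynomial.X, fun x => ?_⟩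
  obtain ⟨t, h1, h2⟩ := h x
  obtain ⟨t', h1', h2'⟩ := h' x
  obtain ⟨t'', h1'', h2''⟩ := h'' x
  simp only [Polynomial.eval_add, Polynomial.eval_X, encSize] at *
  have hPx := hP x
  generalize enc (c x) = d at *
  cases d with
  | nil => exact ⟨_, by rw [if_neg (by simp [hPx])]; exact .cond_nil h1'' h1', by omega⟩
  | cons a b => exact ⟨_, by rw [if_pos (by simp [hPx])]; exact .cond_cons h1'' h1, by omega⟩

@[fun_prop]
theorem cond {c : α → Bool} {f g : α → β} (hc : PolyFun c) (hf : PolyFun f) (hg : PolyFun g) :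
    PolyFun (fun x => cond (c x) (f x) (g x)) := by
  have : (fun x => _root_.cond (c x) (f x) (g x)) = fun x => if c x = true then f x else g x := by
    funext x; cases c x <;> rfl
  rw [this]
  exact ite_enc _ hc (fun x => by cases c x <;> simp [enc]) hf hg

@[fun_prop]
theorem isEmpty {f : α → List β} (hf : PolyFun f) : PolyFun (fun x => (f x).isEmpty) := by
  have : (fun x => (f x).isEmpty) = fun x => if f x ≠ [] then false else true := by
    funext x; cases f x <;> rfl
  rw [this]
  exact ite_enc _ hf (fun x => by cases f x <;> simp [enc, Data.ofList]) (const _) (const _)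

@[fun_prop]
theorem headD {f : α → List β} {g : α → β} (hf : PolyFun f) (hg : PolyFun g) :
    PolyFun (fun x => (f x).headD (g x)) := by
  obtain ⟨p, q, h⟩ := hf
  obtain ⟨p', q', h'⟩ := hg
  refine ⟨.cond p (.seq p .head) p', 3 * q + q' + 2 * Polynomial.X, fun x => ?_⟩
  obtain ⟨t, h1, h2⟩ := h x
  obtain ⟨t', h1', h2'⟩ := h' x
  have h3 := h1.size_le
  simp only [Polynomial.eval_add, Polynomial.eval_mul, Polynomial.eval_X, Polynomial.eval_ofNat,
    encSize] at *
  cases hl : f x with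
  | nil =>
    rw [hl] at h1
    exact ⟨_, .cond_nil h1 h1', by omega⟩
  | cons a l =>
    rw [hl] at h1 h3
    exact ⟨_, .cond_cons h1 (.seq h1 (.head_cons _ _)), by
      simp only [enc, List.map_cons, Data.ofList] at h3 ⊢; omega⟩

@[fun_prop]
theorem isZero {f : α → ℕ} (hf : PolyFun f) : PolyFun (fun x => (f x).beq 0) := by
  have : (fun x => (f x).beq 0) = fun x => if f x ≠ 0 then false else true := by
    funext x; cases f x <;> rfl
  rw [this]
  exact ite_enc _ hf (fun x => by cases f x <;> simp [enc, Data.ofNat]) (const _) (const _)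

@[fun_prop]
theorem and {f g : α → Bool} (hf : PolyFun f) (hg : PolyFun g) : PolyFun (fun x => f x && g x) := by
  have : (fun x => f x && g x) = fun x => _root_.cond (f x) (g x) false := by
    funext x; cases f x <;> rfl
  rw [this]; fun_prop

@[fun_prop]
theorem or {f g : α → Bool} (hf : PolyFun f) (hg : PolyFun g) : PolyFun (fun x => f x || g x) := by
  have : (fun x => f x || g x) = fun x => _root_.cond (f x) true (g x) := by
    funext x; cases f x <;> rfl
  rw [this]; fun_prop

@[fun_prop]
theorem not {f : α → Bool} (hf : PolyFun f) : PolyFun (fun x => !f x) := by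
  have : (fun x => !f x) = fun x => _root_.cond (f x) false true := by
    funext x; cases f x <;> rfl
  rw [this]; fun_prop

end PolyFun
end MetroLine

/-! ### Loops and list functions in polynomial time -/

namespace MetroLine
open TreeEncoding (enc)

namespace PolyFun

variable {α β γ σ : Type} [TreeEncoding α] [TreeEncoding β] [TreeEncoding γ] [TreeEncoding σ]

/-- The state of the loop consists of the remaining list, the accumulator and the unchanged input.
The test `head` returns the remaining list, whose tree is `nil` exactly when nothing is left. -/
theorem runs_foldl {step : α → σ → β → σ} {p : Prog} {q : Polynomial ℕ}
    (hp : ∀ z : (β × List β) × (σ × α), ∃ t, Runs p (enc z)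
      (enc (z.1.2, (step z.2.2 z.2.1 z.1.1, z.2.2))) t ∧ t ≤ q.eval (encSize z))
    (x : α) (m : ℕ) (l : List β) (s : σ)
    (hm : ∀ l', l' <+: l → encSize (l'.foldl (step x) s) ≤ m) :
    ∃ t, Runs (.whileDo .head p) (enc (l, (s, x)))
        (enc (([] : List β), (l.foldl (step x) s, x))) t ∧
      t ≤ (l.length + 1) * (q.eval (encSize l + m + encSize x + 2) +
        2 * (encSize l + m + encSize x + 2)) := by
  induction l generalizing s with
  | nil =>
    refine ⟨_, .while_nil (.head_cons _ _), ?_⟩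
    have := hm [] (List.prefix_refl _)
    simp only [List.foldl_nil] at this
    change encSize (([] : List β), (s, x)) + encSize (([] : List β), (s, x)) ≤ _
    simp only [encSize_prod, encSize_nil, List.length_nil]
    omega
  | cons a l ih =>
    -- The nonempty list `a :: l` has the same tree as the pair `(a, l)` that `p` expects.
    obtain ⟨t1, h1, h2⟩ := hp ((a, l), (s, x))
    obtain ⟨t2, h3, h4⟩ := ih (step x s a) fun l' hl' => hm (a :: l') (by simpa using hl')
    refine ⟨_, .while_cons (.head_cons _ _) h1 h3, ?_⟩
    have hs := hm [] (List.nil_prefix)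
    simp only [List.foldl_nil] at hs
    change encSize (a :: l, (s, x)) + t1 + t2 + encSize (a :: l, (s, x)) ≤ _
    have e1 : encSize ((a, l), (s, x)) ≤ encSize (a :: l) + m + encSize x + 2 := by
      simp only [encSize_prod, encSize_cons]; omega
    have e2 := polynomial_eval_mono q e1
    have e3 : encSize l + m + encSize x + 2 ≤ encSize (a :: l) + m + encSize x + 2 := by
      simp only [encSize_cons]; omega
    have e4 := polynomial_eval_mono q e3
    have e5 : (l.length + 1) * (q.eval (encSize l + m + encSize x + 2) +
        2 * (encSize l + m + encSize x + 2)) ≤ (l.length + 1) *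
        (q.eval (encSize (a :: l) + m + encSize x + 2) +
        2 * (encSize (a :: l) + m + encSize x + 2)) :=
      Nat.mul_le_mul_left _ (Nat.add_le_add e4 (Nat.mul_le_mul_left _ e3))
    have e6 : encSize (a :: l, (s, x)) ≤ encSize (a :: l) + m + encSize x + 2 := by
      simp only [encSize_prod]; omega
    simp only at e2
    rw [List.length_cons, Nat.add_mul _ 1]
    omega

/-- A polynomial step alone is not enough, since iteration could make the accumulator grow
exponentially; the polynomial `b` has to bound all intermediate values. -/
theorem foldl_bound {step : α → σ → β → σ} {init : α → σ} {l : α → List β}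
    (hs : PolyFun fun z : (α × σ) × β => step z.1.1 z.1.2 z.2) (hi : PolyFun init) (hl : PolyFun l)
    (b : Polynomial ℕ) (hb : ∀ x l', l' <+: l x →
      encSize (l'.foldl (step x) (init x)) ≤ b.eval (encSize x)) :
    PolyFun fun x => (l x).foldl (step x) (init x) := by
  have hbody : PolyFun fun z : (β × List β) × (σ × α) =>
      (z.1.2, (step z.2.2 z.2.1 z.1.1, z.2.2)) :=
    prodMk (snd (fst id')) (prodMk (comp hs (prodMk (prodMk (snd (snd id')) (fst (snd id')))
      (fst (fst id')))) (snd (snd id')))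
  have hinit : PolyFun fun x => (l x, (init x, x)) := prodMk hl (prodMk hi id')
  obtain ⟨p, q, hp⟩ := hbody
  obtain ⟨p', q', hp'⟩ := hinit
  have hfin : PolyFun fun z : List β × (σ × α) => z.2.1 := fst (snd id')
  obtain ⟨p'', q'', hp''⟩ := hfin
  -- `M` bounds both the data sizes and the number of rounds, and `W` the cost of the loop.
  set M : Polynomial ℕ := q' + b + Polynomial.X + 2 with hM
  set W : Polynomial ℕ := (M + 1) * (q.comp M + 2 * M) with hW
  refine ⟨.seq p' (.seq (.whileDo .head p) p''), q' + W + q''.comp M + M + Polynomial.X,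
    fun x => ?_⟩
  obtain ⟨t1, h1, h2⟩ := hp' x
  obtain ⟨t2, h3, h4⟩ := runs_foldl hp x (b.eval (encSize x)) (l x) (init x) (hb x)
  obtain ⟨t3, h5, h6⟩ := hp'' ([], ((l x).foldl (step x) (init x), x))
  refine ⟨_, .seq h1 (.seq h3 h5), ?_⟩
  have s1 : encSize (l x, (init x, x)) ≤ t1 := h1.size_le.2
  have s2 := hb x _ (List.prefix_refl _)
  have s3 := length_le_encSize (l x)
  have s4 := encSize_pos (init x)
  have hMe : M.eval (encSize x) = q'.eval (encSize x) + b.eval (encSize x) + encSize x + 2 := by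
    simp [hM]
  have s5 : encSize (l x) + b.eval (encSize x) + encSize x + 2 ≤ M.eval (encSize x) := by
    simp only [encSize_prod] at s1
    omega
  have s6 : (l x).length + 1 ≤ M.eval (encSize x) + 1 := by omega
  have s7 := polynomial_eval_mono q s5
  have s8 := h4.trans (Nat.mul_le_mul s6 (Nat.add_le_add s7 (Nat.mul_le_mul_left 2 s5)))
  have hWe : W.eval (encSize x) = (M.eval (encSize x) + 1) *
      (q.eval (M.eval (encSize x)) + 2 * M.eval (encSize x)) := by simp [hW]
  have s9 : encSize (([] : List β), ((l x).foldl (step x) (init x), x)) ≤ M.eval (encSize x) := by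
    simp only [encSize_prod, encSize_nil] at s1 ⊢
    omega
  have s10 := h6.trans (polynomial_eval_mono q'' s9)
  simp only [Polynomial.eval_add, Polynomial.eval_comp, Polynomial.eval_X]
  change t1 + (t2 + t3 + encSize (l x, (init x, x))) + encSize x ≤ _
  rw [hWe]
  simp only [encSize_prod] at s1 s5 s7 s8 s10 ⊢
  omega

/-- It suffices that each step adds at most an amount that depends on the input but not on the
accumulator. -/
theorem foldl_growth {step : α → σ → β → σ} {init : α → σ} {l : α → List β}
    (hs : PolyFun fun z : (α × σ) × β => step z.1.1 z.1.2 z.2) (hi : PolyFun init) (hl : PolyFun l)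
    (c : Polynomial ℕ) (hc : ∀ x s, ∀ a ∈ l x,
      encSize (step x s a) ≤ encSize s + c.eval (encSize x)) :
    PolyFun fun x => (l x).foldl (step x) (init x) := by
  obtain ⟨qi, hqi⟩ := hi.size_le
  obtain ⟨ql, hql⟩ := hl.size_le
  refine foldl_bound hs hi hl (qi + ql * c) fun x l' hl' => ?_
  have key : ∀ (l' : List β) s, (∀ a ∈ l', a ∈ l x) →
      encSize (l'.foldl (step x) s) ≤ encSize s + l'.length * c.eval (encSize x) := by
    intro l'
    induction l' with
    | nil => intro s _; simp
    | cons a l' ih =>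
      intro s h
      have h1 := hc x s a (h a (by simp))
      have h2 := ih (step x s a) fun b hb => h b (List.mem_cons_of_mem _ hb)
      rw [List.foldl_cons, List.length_cons, Nat.add_mul]
      omega
  have h1 := key l' (init x) hl'.subset
  have h2 : l'.length ≤ ql.eval (encSize x) := by
    have := hl'.length_le
    have := length_le_encSize (l x)
    have := hql x
    omega
  have h3 := Nat.mul_le_mul_right (c.eval (encSize x)) h2
  have := hqi x
  simp only [Polynomial.eval_add, Polynomial.eval_mul]
  omega

@[fun_prop]
theorem reverse {f : α → List β} (hf : PolyFun f) : PolyFun fun x => (f x).reverse := by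
  have : (fun x => (f x).reverse) = fun x => (f x).foldl (fun acc a => a :: acc) [] := by
    funext x; rw [List.foldl_flip_cons_eq_append']; simp
  rw [this]
  obtain ⟨q, hq⟩ := hf.size_le
  refine foldl_growth (step := fun _ acc a => a :: acc) (by fun_prop) (by fun_prop) hf (q + 1) ?_
  intro x s a ha
  have := encSize_mem ha
  have := hq x
  simp; omega

theorem foldr_growth {step : α → β → σ → σ} {init : α → σ} {l : α → List β}
    (hs : PolyFun fun z : (α × σ) × β => step z.1.1 z.2 z.1.2) (hi : PolyFun init) (hl : PolyFun l)
    (c : Polynomial ℕ) (hc : ∀ x s, ∀ a ∈ l x,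
      encSize (step x a s) ≤ encSize s + c.eval (encSize x)) :
    PolyFun fun x => (l x).foldr (step x) (init x) := by
  have : (fun x => (l x).foldr (step x) (init x)) =
      fun x => (l x).reverse.foldl (fun s a => step x a s) (init x) := by
    funext x; rw [List.foldl_reverse]
  rw [this]
  exact foldl_growth (step := fun x s a => step x a s) hs hi (reverse hl) c fun x s a ha =>
    hc x s a (List.mem_reverse.1 ha)

@[fun_prop]
theorem append {f g : α → List β} (hf : PolyFun f) (hg : PolyFun g) :
    PolyFun fun x => f x ++ g x := by
  have : (fun x => f x ++ g x) = fun x => (f x).foldr (fun a acc => a :: acc) (g x) := by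
    funext x; simp
  rw [this]
  obtain ⟨q, hq⟩ := hf.size_le
  refine foldr_growth (step := fun _ a acc => a :: acc) (by fun_prop) hg hf (q + 1) ?_
  intro x s a ha
  have := encSize_mem ha
  have := hq x
  simp; omega

@[fun_prop]
theorem map {f : α → β → γ} {l : α → List β} (hf : PolyFun fun z : α × β => f z.1 z.2)
    (hl : PolyFun l) : PolyFun fun x => (l x).map (f x) := by
  have : (fun x => (l x).map (f x)) = fun x => (l x).foldr (fun a acc => f x a :: acc) [] := by
    funext x; rw [List.map_eq_foldr]
  rw [this]
  obtain ⟨q, hq⟩ := hl.size_le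
  obtain ⟨q', hq'⟩ := hf.size_le
  refine foldr_growth (step := fun x a acc => f x a :: acc) (by fun_prop) (by fun_prop) hl
    (q'.comp (q + Polynomial.X + 1) + 1) ?_
  intro x s a ha
  have h1 := encSize_mem ha
  have h2 := hq x
  have h3 := hq' (x, a)
  have h4 : encSize (x, a) ≤ (q + Polynomial.X + 1).eval (encSize x) := by
    simp; omega
  have h5 := polynomial_eval_mono q' h4
  simp only [encSize_cons, Polynomial.eval_add, Polynomial.eval_comp, Polynomial.eval_one] at *
  omega

@[fun_prop]
theorem filter {p : α → β → Bool} {l : α → List β} (hp : PolyFun fun z : α × β => p z.1 z.2)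
    (hl : PolyFun l) : PolyFun fun x => (l x).filter (p x) := by
  have : (fun x => (l x).filter (p x)) =
      fun x => (l x).foldr (fun a acc => _root_.cond (p x a) (a :: acc) acc) [] := by
    funext x
    induction l x with
    | nil => rfl
    | cons a l ih => rw [List.filter_cons, List.foldr_cons, ← ih]; cases p x a <;> rfl
  rw [this]
  obtain ⟨q, hq⟩ := hl.size_le
  refine foldr_growth (step := fun x a acc => _root_.cond (p x a) (a :: acc) acc) (by fun_prop)
    (by fun_prop) hl (q + 1) ?_
  intro x s a ha
  have h1 := encSize_mem ha
  have h2 := hq x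
  cases p x a
  · simp
  · simp; omega

@[fun_prop]
theorem takeWhile {p : α → β → Bool} {l : α → List β} (hp : PolyFun fun z : α × β => p z.1 z.2)
    (hl : PolyFun l) : PolyFun fun x => (l x).takeWhile (p x) := by
  have : (fun x => (l x).takeWhile (p x)) =
      fun x => (l x).foldr (fun a acc => _root_.cond (p x a) (a :: acc) []) [] := by
    funext x
    induction l x with
    | nil => rfl
    | cons a l ih => rw [List.takeWhile_cons, List.foldr_cons, ← ih]; cases p x a <;> rfl
  rw [this]
  obtain ⟨q, hq⟩ := hl.size_le
  refine foldr_growth (step := fun x a acc => _root_.cond (p x a) (a :: acc) []) (by fun_prop)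
    (by fun_prop) hl (q + 1) ?_
  intro x s a ha
  have h1 := encSize_mem ha
  have h2 := hq x
  cases p x a <;> simp <;> omega

@[fun_prop]
theorem dropWhile {p : α → β → Bool} {l : α → List β} (hp : PolyFun fun z : α × β => p z.1 z.2)
    (hl : PolyFun l) : PolyFun fun x => (l x).dropWhile (p x) := by
  have : (fun x => (l x).dropWhile (p x)) = fun x => ((l x).foldl (fun acc a =>
      _root_.cond (acc.isEmpty && p x a) [] (a :: acc)) []).reverse := by
    funext x
    -- An empty accumulator signals that elements are still being dropped; once it is nonempty,
    -- everything is kept.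
    have h1 : ∀ (l acc : List β), acc ≠ [] → (l.foldl (fun acc a =>
        _root_.cond (acc.isEmpty && p x a) [] (a :: acc)) acc).reverse = acc.reverse ++ l := by
      intro l
      induction l with
      | nil => simp
      | cons a l ih =>
        intro acc hacc
        have : acc.isEmpty = false := by simpa using hacc
        simp only [List.foldl_cons, this, Bool.false_and, cond_false]
        rw [ih _ (by simp)]; simp
    induction l x with
    | nil => rfl
    | cons a l ih =>
      rw [List.dropWhile_cons, List.foldl_cons]
      cases h : p x a
      · simpa using (h1 l [a] (by simp)).symm
      · simpa using ih
  rw [this]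
  obtain ⟨q, hq⟩ := hl.size_le
  refine reverse (foldl_growth (step := fun x acc a =>
    _root_.cond (acc.isEmpty && p x a) [] (a :: acc)) (by fun_prop) (by fun_prop) hl (q + 1) ?_)
  intro x s a ha
  have h1 := encSize_mem ha
  have h2 := hq x
  cases (s.isEmpty && p x a) <;> simp <;> omega

@[fun_prop]
theorem any {p : α → β → Bool} {l : α → List β} (hp : PolyFun fun z : α × β => p z.1 z.2)
    (hl : PolyFun l) : PolyFun fun x => (l x).any (p x) := by
  have : (fun x => (l x).any (p x)) = fun x => !((l x).filter (p x)).isEmpty := by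
    funext x
    rw [Bool.eq_iff_iff]
    simp
  rw [this]; fun_prop

@[fun_prop]
theorem all {p : α → β → Bool} {l : α → List β} (hp : PolyFun fun z : α × β => p z.1 z.2)
    (hl : PolyFun l) : PolyFun fun x => (l x).all (p x) := by
  have : (fun x => (l x).all (p x)) = fun x => !(l x).any fun a => !p x a := by
    funext x; simp [List.not_any_eq_all_not]
  rw [this]; fun_prop

@[fun_prop]
theorem flatten {f : α → List (List β)} (hf : PolyFun f) : PolyFun fun x => (f x).flatten := by
  have : (fun x => (f x).flatten) = fun x => (f x).foldr (fun a acc => a ++ acc) [] := by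
    funext x
    induction f x with
    | nil => rfl
    | cons a l ih => simp [ih]
  rw [this]
  obtain ⟨q, hq⟩ := hf.size_le
  refine foldr_growth (step := fun _ a acc => a ++ acc) (by fun_prop) (by fun_prop) hf q ?_
  intro x s a ha
  have h1 := encSize_mem ha
  have h2 := hq x
  have h3 := encSize_append a s
  omega

@[fun_prop]
theorem flatMap {f : α → β → List γ} {l : α → List β} (hf : PolyFun fun z : α × β => f z.1 z.2)
    (hl : PolyFun l) : PolyFun fun x => (l x).flatMap (f x) := by
  have : (fun x => (l x).flatMap (f x)) = fun x => ((l x).map (f x)).flatten := by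
    funext x; rfl
  rw [this]; fun_prop

@[fun_prop]
theorem length {f : α → List β} (hf : PolyFun f) : PolyFun fun x => (f x).length := by
  have : PolyFun fun x => (f x).map fun _ => () := by fun_prop
  refine this.of_enc fun x => ?_
  induction f x with
  | nil => rfl
  | cons a l ih =>
    change Data.cons .nil (enc l.length) = Data.cons .nil (enc (l.map fun _ => ()))
    rw [ih]

/-- A unary number is the same tree as a list of units, so iterating a number of times is a fold
over a list. -/
theorem units {f : α → ℕ} (hf : PolyFun f) : PolyFun fun x => List.replicate (f x) () := by
  refine hf.of_enc fun x => ?_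
  induction f x with
  | zero => rfl
  | succ n ih =>
    change Data.cons .nil (enc (List.replicate n ())) = Data.cons .nil (enc n)
    rw [ih]

theorem foldl_replicate {δ : Type} (f : δ → δ) (n : ℕ) (s : δ) :
    (List.replicate n ()).foldl (fun s _ => f s) s = f^[n] s := by
  induction n generalizing s with
  | zero => rfl
  | succ n ih => rw [List.replicate_succ, List.foldl_cons, ih, Function.iterate_succ_apply]

theorem iterate_bound {step : α → σ → σ} {init : α → σ} {n : α → ℕ}
    (hs : PolyFun fun z : α × σ => step z.1 z.2) (hi : PolyFun init) (hn : PolyFun n)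
    (b : Polynomial ℕ) (hb : ∀ x, ∀ k ≤ n x, encSize ((step x)^[k] (init x)) ≤ b.eval (encSize x)) :
    PolyFun fun x => (step x)^[n x] (init x) := by
  have : (fun x => (step x)^[n x] (init x)) =
      fun x => (List.replicate (n x) ()).foldl (fun s _ => step x s) (init x) := by
    funext x; rw [foldl_replicate]
  rw [this]
  refine foldl_bound (step := fun x s _ => step x s) (comp hs (fst id')) hi (units hn) b ?_
  intro x l' hl'
  obtain ⟨k, hk, rfl⟩ : ∃ k ≤ n x, l' = List.replicate k () :=
    ⟨l'.length, by simpa using hl'.length_le, List.eq_replicate_of_mem (by simp)⟩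
  rw [foldl_replicate]
  exact hb x k hk

theorem iterate_growth {step : α → σ → σ} {init : α → σ} {n : α → ℕ}
    (hs : PolyFun fun z : α × σ => step z.1 z.2) (hi : PolyFun init) (hn : PolyFun n)
    (c : Polynomial ℕ) (hc : ∀ x s, encSize (step x s) ≤ encSize s + c.eval (encSize x)) :
    PolyFun fun x => (step x)^[n x] (init x) := by
  have : (fun x => (step x)^[n x] (init x)) =
      fun x => (List.replicate (n x) ()).foldl (fun s _ => step x s) (init x) := by
    funext x; rw [foldl_replicate]
  rw [this]
  exact foldl_growth (step := fun x s _ => step x s) (comp hs (fst id')) hi (units hn) c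
    fun x s _ _ => hc x s

@[fun_prop]
theorem add {f g : α → ℕ} (hf : PolyFun f) (hg : PolyFun g) : PolyFun fun x => f x + g x := by
  have : (fun x => f x + g x) = fun x => (fun n => n + 1)^[g x] (f x) := by
    funext x; simp
  rw [this]
  exact iterate_growth (step := fun _ n => n + 1) (by fun_prop) hf hg 2 fun x s => by simp; omega

@[fun_prop]
theorem sub {f g : α → ℕ} (hf : PolyFun f) (hg : PolyFun g) : PolyFun fun x => f x - g x := by
  have : (fun x => f x - g x) = fun x => Nat.pred^[g x] (f x) := by
    funext x; rw [Nat.pred_iterate]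
  rw [this]
  exact iterate_growth (step := fun _ n => n.pred) (by fun_prop) hf hg 0 fun x s => by simp

@[fun_prop]
theorem ble {f g : α → ℕ} (hf : PolyFun f) (hg : PolyFun g) : PolyFun fun x => (f x).ble (g x) := by
  have : (fun x => (f x).ble (g x)) = fun x => (f x - g x).beq 0 := by
    funext x; rw [Bool.eq_iff_iff, Nat.ble_eq, Nat.beq_eq, Nat.sub_eq_zero_iff_le]
  rw [this]; fun_prop

@[fun_prop]
theorem decide_lt {f g : α → ℕ} (hf : PolyFun f) (hg : PolyFun g) :
    PolyFun fun x => decide (f x < g x) := by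
  have : (fun x => decide (f x < g x)) = fun x => !(g x).ble (f x) := by
    funext x; rw [Bool.eq_iff_iff, Bool.not_eq_true', ← Bool.not_eq_true, Nat.ble_eq]; simp
  rw [this]; fun_prop

@[fun_prop]
theorem decide_eq {f g : α → ℕ} (hf : PolyFun f) (hg : PolyFun g) :
    PolyFun fun x => decide (f x = g x) := by
  have : (fun x => decide (f x = g x)) = fun x => (f x).ble (g x) && (g x).ble (f x) := by
    funext x; rw [Bool.eq_iff_iff, Bool.and_eq_true, Nat.ble_eq, Nat.ble_eq]; simp; omega
  rw [this]; fun_prop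

@[fun_prop]
theorem decide_mem {f : α → ℕ} {l : α → List ℕ} (hf : PolyFun f) (hl : PolyFun l) :
    PolyFun fun x => decide (f x ∈ l x) := by
  have : (fun x => decide (f x ∈ l x)) = fun x => (l x).any fun a => decide (f x = a) := by
    funext x; rw [Bool.eq_iff_iff]; simp
  rw [this]; fun_prop

@[fun_prop]
theorem drop {f : α → List β} {n : α → ℕ} (hf : PolyFun f) (hn : PolyFun n) :
    PolyFun fun x => (f x).drop (n x) := by
  have : (fun x => (f x).drop (n x)) = fun x => List.tail^[n x] (f x) := by
    funext x; rw [List.tail_iterate]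
  rw [this]
  exact iterate_growth (step := fun _ l => l.tail) (by fun_prop) hf hn 0
    fun x s => by simpa using encSize_tail_le s

@[fun_prop]
theorem getD {f : α → List β} {n : α → ℕ} {d : α → β} (hf : PolyFun f) (hn : PolyFun n)
    (hd : PolyFun d) : PolyFun fun x => (f x).getD (n x) (d x) := by
  have : (fun x => (f x).getD (n x) (d x)) = fun x => ((f x).drop (n x)).headD (d x) := by
    funext x; simp [List.getD_eq_getElem?_getD, List.headD_eq_head?_getD, List.head?_drop]
  rw [this]; fun_prop

@[fun_prop]
theorem range {n : α → ℕ} (hn : PolyFun n) : PolyFun fun x => List.range (n x) := by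
  have h : ∀ k, (fun l : List ℕ => l ++ [l.length])^[k] [] = List.range k := by
    intro k
    induction k with
    | zero => rfl
    | succ k ih => rw [Function.iterate_succ_apply', ih, List.range_succ, List.length_range]
  have : (fun x => List.range (n x)) = fun x => (fun l : List ℕ => l ++ [l.length])^[n x] [] := by
    funext x; rw [h]
  rw [this]
  obtain ⟨q, hq⟩ := hn.size_le
  -- The appended entry grows with the accumulator, so the intermediate lists are bounded
  -- explicitly, by a quadratic polynomial.
  refine iterate_bound (step := fun _ l => l ++ [l.length]) (by fun_prop) (by fun_prop) hn
    (q * (q + 1) + 1) fun x k hk => ?_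
  rw [h]
  have h1 : encSize (List.range k) ≤ k * (2 * k + 2) + 1 := by
    have : ∀ m ≤ k, encSize (List.range m) ≤ m * (2 * k + 2) + 1 := by
      intro m hm
      induction m with
      | zero => simp
      | succ m ih =>
        have := encSize_append (List.range m) [m]
        have := ih (by omega)
        rw [List.range_succ, Nat.add_mul]
        simp only [encSize_cons, encSize_nil, encSize_nat] at *
        omega
    exact this k le_rfl
  have h2 := hq x
  simp only [encSize_nat] at h2
  have h3 : k * (2 * k + 2) ≤ q.eval (encSize x) * (q.eval (encSize x) + 1) :=
    Nat.mul_le_mul (by omega) (by omega)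
  simp only [Polynomial.eval_add, Polynomial.eval_mul, Polynomial.eval_one]
  omega

@[fun_prop]
theorem product {f : α → List β} {g : α → List γ} (hf : PolyFun f) (hg : PolyFun g) :
    PolyFun fun x => f x ×ˢ g x := by
  change PolyFun fun x => (f x).flatMap fun a => (g x).map fun b => (a, b)
  fun_prop

@[fun_prop]
theorem take_one {f : α → List β} (hf : PolyFun f) : PolyFun fun x => (f x).take 1 := by
  have : (fun x => (f x).take 1) = fun x => (f x).foldr (fun a _ => [a]) [] := by
    funext x; cases f x <;> rfl
  rw [this]
  obtain ⟨q, hq⟩ := hf.size_le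
  refine foldr_growth (step := fun _ a _ => [a]) (by fun_prop) (by fun_prop) hf (q + 1) ?_
  intro x s a ha
  have h1 := encSize_mem ha
  have h2 := hq x
  simp; omega

@[fun_prop]
theorem zip {f : α → List β} {g : α → List γ} (hf : PolyFun f) (hg : PolyFun g) :
    PolyFun fun x => (f x).zip (g x) := by
  have : (fun x => (f x).zip (g x)) = fun x => ((f x).foldl (fun (s : List γ × List (β × γ)) a =>
      (s.1.tail, ((s.1.take 1).map fun b => (a, b)) ++ s.2)) (g x, [])).2.reverse := by
    funext x
    have key : ∀ (l : List β) (s : List γ × List (β × γ)),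
        (l.foldl (fun (s : List γ × List (β × γ)) a =>
        (s.1.tail, ((s.1.take 1).map fun b => (a, b)) ++ s.2)) s).2.reverse =
        s.2.reverse ++ l.zip s.1 := by
      intro l
      induction l with
      | nil => simp
      | cons a l ih =>
        rintro ⟨B, acc⟩
        rw [List.foldl_cons, ih]
        cases B <;> simp
    rw [key]; simp
  rw [this]
  obtain ⟨q, hq⟩ := hf.size_le
  refine reverse (snd (foldl_growth (step := fun _ (s : List γ × List (β × γ)) a =>
      (s.1.tail, ((s.1.take 1).map fun b => (a, b)) ++ s.2)) (by fun_prop) (by fun_prop) hf q ?_))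
  rintro x ⟨B, acc⟩ a ha
  have h1 := encSize_mem ha
  have h2 := hq x
  rcases B with _ | ⟨b, B⟩
  · simp
  · simp; omega

end PolyFun
end MetroLine

/-! ### The steps of the algorithm in polynomial time -/

namespace MetroLine
open TreeEncoding (enc)

instance {α : Type} [TreeEncoding α] : TreeEncoding (Option α) := ⟨fun o => enc o.toList⟩

namespace PolyFun

variable {α β : Type} [TreeEncoding α] [TreeEncoding β]

@[fun_prop]
theorem option_some {f : α → β} (hf : PolyFun f) : PolyFun fun x => some (f x) :=
  (cons hf (const ([] : List β))).of_enc fun _ => rfl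

@[fun_prop]
theorem toList {f : α → Option β} (hf : PolyFun f) : PolyFun fun x => (f x).toList :=
  hf.of_enc fun _ => rfl

@[fun_prop]
theorem decide_eq_some_bool {f : α → Option Bool} (hf : PolyFun f) (b : Bool) :
    PolyFun fun x => decide (f x = some b) := by
  have : (fun x => decide (f x = some b)) = fun x =>
      !(f x).toList.isEmpty && _root_.cond ((f x).toList.headD false) b !b := by
    funext x; rcases f x with _ | _ | _ <;> cases b <;> rfl
  rw [this]; fun_prop

@[fun_prop]
theorem decide_eq_none {f : α → Option β} [DecidableEq β] (hf : PolyFun f) :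
    PolyFun fun x => decide (f x = none) := by
  have : (fun x => decide (f x = none)) = fun x => (f x).toList.isEmpty := by
    funext x; rcases f x with _ | _ <;> simp
  rw [this]; fun_prop

@[fun_prop]
theorem toNat {f : α → Bool} (hf : PolyFun f) : PolyFun fun x => (f x).toNat := by
  change PolyFun fun x => _root_.cond (f x) 1 0
  fun_prop

/-- Case distinction with a decidable proposition. -/
theorem ite {P : α → Prop} [DecidablePred P] {f g : α → β} (hP : PolyFun fun x => decide (P x))
    (hf : PolyFun f) (hg : PolyFun g) : PolyFun fun x => if P x then f x else g x := by
  have : (fun x => if P x then f x else g x) = fun x => _root_.cond (decide (P x)) (f x) (g x) := by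
    funext x; by_cases h : P x <;> simp [h]
  rw [this]; fun_prop

section Lists

variable {l l' A B A' B' : α → List ℕ} {u w a b c : α → ℕ}

@[fun_prop]
theorem afterFirst (hl : PolyFun l) (hw : PolyFun w) :
    PolyFun fun x => MetroLine.afterFirst (l x) (w x) := by
  have : (fun x => MetroLine.afterFirst (l x) (w x)) =
      fun x => ((l x).dropWhile fun y => !decide (y = w x)).tail := by
    funext x; simp [MetroLine.afterFirst]
  rw [this]; fun_prop

theorem head?_eq_some (hl : PolyFun l) (hu : PolyFun u) :
    PolyFun fun x => decide ((l x).head? = some (u x)) := by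
  have : (fun x => decide ((l x).head? = some (u x))) =
      fun x => !(l x).isEmpty && decide ((l x).headD 0 = u x) := by
    funext x; cases l x <;> simp
  rw [this]; fun_prop

@[fun_prop]
theorem passesB (hl : PolyFun l) (hu : PolyFun u) (hw : PolyFun w) :
    PolyFun fun x => MetroLine.passesB (l x) (u x) (w x) :=
  or (head?_eq_some (by fun_prop) hu) (head?_eq_some (by fun_prop) hu)

@[fun_prop]
theorem arm (hl : PolyFun l) (hu : PolyFun u) (hw : PolyFun w) :
    PolyFun fun x => MetroLine.arm (l x) (u x) (w x) :=
  ite (head?_eq_some (by fun_prop) hu) (by fun_prop) (by fun_prop)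

theorem commonPrefix_eq {δ : Type} [DecidableEq δ] (A B : List δ) : MetroLine.commonPrefix A B =
    ((A.zip B).takeWhile fun z => decide (z.1 = z.2)).map Prod.fst := by
  induction A generalizing B with
  | nil => simp [MetroLine.commonPrefix]
  | cons a A ih =>
    cases B with
    | nil => simp [MetroLine.commonPrefix]
    | cons b B => by_cases h : a = b <;> simp [MetroLine.commonPrefix, h, ih]

@[fun_prop]
theorem commonPrefix (hA : PolyFun A) (hB : PolyFun B) :
    PolyFun fun x => MetroLine.commonPrefix (A x) (B x) := by
  have : (fun x => MetroLine.commonPrefix (A x) (B x)) = fun x =>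
      (((A x).zip (B x)).takeWhile fun z => decide (z.1 = z.2)).map fun z => z.1 := by
    funext x; exact commonPrefix_eq _ _
  rw [this]; fun_prop

/-- The recursion stops at the end of the common prefix; the last port reached is read off from the
prefix with `p` and `c` put in front. -/
theorem look_eq (p c : ℕ) (A B : List ℕ) : MetroLine.look p c A B =
    ((p :: c :: MetroLine.commonPrefix A B).getD (MetroLine.commonPrefix A B).length 0,
      (c :: MetroLine.commonPrefix A B).getD (MetroLine.commonPrefix A B).length 0,
      A.drop (MetroLine.commonPrefix A B).length, B.drop (MetroLine.commonPrefix A B).length) := by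
  induction A generalizing p c B with
  | nil => simp [MetroLine.commonPrefix, MetroLine.look]
  | cons a A ih =>
    cases B with
    | nil => simp [MetroLine.commonPrefix, MetroLine.look]
    | cons b B =>
      by_cases h : a = b
      · subst h; rw [look_cons_cons, ih]; simp [MetroLine.commonPrefix]
      · simp [MetroLine.commonPrefix, MetroLine.look, h]

@[fun_prop]
theorem look (hu : PolyFun u) (hw : PolyFun w) (hA : PolyFun A) (hB : PolyFun B) :
    PolyFun fun x => MetroLine.look (u x) (w x) (A x) (B x) := by
  simp only [look_eq]; fun_prop

@[fun_prop]
theorem clockB (hl : PolyFun l) (ha : PolyFun a) (hb : PolyFun b) (hc : PolyFun c) :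
    PolyFun fun x => MetroLine.clockB (l x) (a x) (b x) (c x) := by
  have : (fun x => MetroLine.clockB (l x) (a x) (b x) (c x)) = fun x =>
      decide (c x ∈ MetroLine.afterFirst (MetroLine.afterFirst (l x) (a x) ++
        (l x).takeWhile fun y => !decide (y = a x)) (b x)) := by
    funext x; simp [MetroLine.clockB, cutAt]
  rw [this]; fun_prop

@[fun_prop]
theorem dirOf {clk : α → ℕ → ℕ → ℕ → ℕ → Bool} {s s' : α → ℕ → Bool}
    {r : α → ℕ × ℕ × List ℕ × List ℕ}
    (hclk : PolyFun fun z : α × (ℕ × ℕ × ℕ × ℕ) => clk z.1 z.2.1 z.2.2.1 z.2.2.2.1 z.2.2.2.2)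
    (hs : PolyFun fun z : α × ℕ => s z.1 z.2) (hs' : PolyFun fun z : α × ℕ => s' z.1 z.2)
    (hr : PolyFun r) : PolyFun fun x => MetroLine.dirOf (clk x) (s x) (s' x) (r x) := by
  have : (fun x => MetroLine.dirOf (clk x) (s x) (s' x) (r x)) = fun x =>
      _root_.cond (r x).2.2.1.isEmpty
        (_root_.cond (r x).2.2.2.isEmpty none (some (s x (r x).2.1)))
        (_root_.cond (r x).2.2.2.isEmpty (some (!s' x (r x).2.1))
          (some (clk x (r x).2.1 (r x).1 ((r x).2.2.2.headD 0) ((r x).2.2.1.headD 0)))) := by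
    funext x
    rcases r x with ⟨p, c, _ | ⟨a, A⟩, _ | ⟨b, B⟩⟩ <;> rfl
  rw [this]
  have h1 : PolyFun fun x => s x (r x).2.1 := comp hs (prodMk id' (by fun_prop))
  have h2 : PolyFun fun x => s' x (r x).2.1 := comp hs' (prodMk id' (by fun_prop))
  have h3 : PolyFun fun x =>
      clk x (r x).2.1 (r x).1 ((r x).2.2.2.headD 0) ((r x).2.2.1.headD 0) :=
    comp hclk (prodMk id' (f := fun x => x) (g := fun x => ((r x).2.1, (r x).1,
      (r x).2.2.2.headD 0, (r x).2.2.1.headD 0)) (by fun_prop))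
  fun_prop

theorem conflictArc {clk : α → ℕ → ℕ → ℕ → ℕ → Bool} {r : α → ℕ × ℕ × List ℕ × List ℕ}
    (hclk : PolyFun fun z : α × (ℕ × ℕ × ℕ × ℕ) => clk z.1 z.2.1 z.2.2.1 z.2.2.2.1 z.2.2.2.2)
    (hl : PolyFun l) (ha : PolyFun a) (hb : PolyFun b) (hr : PolyFun r) :
    PolyFun fun x => MetroLine.conflictArc (clk x) (l x) (a x) (b x) (r x) := by
  have h : PolyFun fun x => decide ((l x).head? = some (r x).2.1) :=
    head?_eq_some hl (by fun_prop)
  have : (fun x => (decide ((l x).head? ≠ some (r x).2.1))) =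
      fun x => !decide ((l x).head? = some (r x).2.1) := by funext x; simp
  have h' : PolyFun fun x => (decide ((l x).head? ≠ some (r x).2.1)) := by rw [this]; fun_prop
  exact ite (decide_eq_some_bool (dirOf hclk (const false) (const false) hr) true) (by fun_prop)
    (ite (decide_eq_some_bool (dirOf hclk (const true) (const true) hr) false)
      (by fun_prop) (by fun_prop))

@[fun_prop]
theorem chooseOrder {f : α → Bool} {g h : α → Option Bool} (hf : PolyFun f) (hg : PolyFun g)
    (hh : PolyFun h) : PolyFun fun x => MetroLine.chooseOrder (f x) (g x) (h x) := by
  have : (fun x => MetroLine.chooseOrder (f x) (g x) (h x)) = fun x =>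
      _root_.cond (f x)
        (_root_.cond (decide (h x = none)) (decide (g x = some true)) (decide (h x = some false)))
        (_root_.cond (decide (g x = none)) (decide (h x = some false))
          (decide (g x = some true))) := by
    funext x
    rcases f x with _ | _ <;> rcases g x with _ | _ | _ <;> rcases h x with _ | _ | _ <;> rfl
  rw [this]; fun_prop

@[fun_prop]
theorem edgesFrom (hu : PolyFun u) (hl : PolyFun l) :
    PolyFun fun x => MetroLine.edgesFrom (fun y : ℕ => y) (u x) (l x) := by
  unfold MetroLine.edgesFrom; fun_prop

@[fun_prop]
theorem keyLt {f g : α → ℕ × ℕ} (hf : PolyFun f) (hg : PolyFun g) :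
    PolyFun fun x => MetroLine.keyLt (f x) (g x) := by
  have : (fun x => MetroLine.keyLt (f x) (g x)) = fun x =>
      decide ((f x).1 + (f x).2 < (g x).1 + (g x).2) ||
      (decide ((f x).1 + (f x).2 = (g x).1 + (g x).2) &&
        (decide ((f x).1 < (g x).1) && decide ((f x).1 < (g x).2) ||
          decide ((f x).2 < (g x).1) && decide ((f x).2 < (g x).2))) := by
    funext x; rw [Bool.eq_iff_iff]; simp [MetroLine.keyLt]; omega
  rw [this]; fun_prop

theorem backMin (hu : PolyFun u) (hw : PolyFun w) (hA : PolyFun A) (hB : PolyFun B)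
    (hA' : PolyFun A') (hB' : PolyFun B') :
    PolyFun fun x => MetroLine.backMin (fun y : ℕ => y) (u x) (w x) (A x) (B x) (A' x) (B' x) := by
  unfold MetroLine.backMin minB; fun_prop

theorem rankSort {r : α → ℕ → ℕ → Bool} (hr : PolyFun fun z : (α × ℕ) × ℕ => r z.1.1 z.1.2 z.2)
    (hl : PolyFun l) : PolyFun fun x => MetroLine.rankSort (r x) (l x) := by
  unfold MetroLine.rankSort
  have h : PolyFun fun z : ((α × ℕ) × ℕ) × ℕ => r z.1.1.1 z.2 z.1.2 :=
    comp hr (f := fun z : ((α × ℕ) × ℕ) × ℕ => ((z.1.1.1, z.2), z.1.2)) (by fun_prop)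
  have h' : PolyFun fun z : (α × ℕ) × ℕ => ((l z.1.1).filter fun j => r z.1.1 j z.2).length :=
    length (filter h (by fun_prop))
  exact flatMap (f := fun x k => (l x).filter fun i =>
    decide (((l x).filter fun j => r x j i).length = k))
    (filter (p := fun (z : α × ℕ) i => decide (((l z.1).filter fun j => r z.1 j i).length = z.2))
      (by fun_prop) (by fun_prop)) (by fun_prop)

end Lists

section MinCut

variable {E T : α → List (ℕ × ℕ)} {c d : α → ℕ}

@[fun_prop]
theorem reached (hc : PolyFun c) (hT : PolyFun T) : PolyFun fun x => MetroLine.reached (c x) (T x) := by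
  have : (fun x => MetroLine.reached (c x) (T x)) = fun x => c x :: (T x).map fun a => a.2 := rfl
  rw [this]; fun_prop

@[fun_prop]
theorem growTree (hE : PolyFun E) (hc : PolyFun c) (hT : PolyFun T) :
    PolyFun fun x => MetroLine.growTree (E x) (c x) (T x) := by
  unfold MetroLine.growTree; fun_prop

theorem searchTree (hE : PolyFun E) (hc : PolyFun c) :
    PolyFun fun x => MetroLine.searchTree (E x) (c x) := by
  obtain ⟨q, hq⟩ := hE.size_le
  refine iterate_growth (step := fun x T => MetroLine.growTree (E x) (c x) T) (by fun_prop)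
    (by fun_prop) (by fun_prop) (q + 1) fun x T => ?_
  have h := hq x
  rcases growTree_cases (E x) (c x) T with ⟨h1, -⟩ | ⟨a, h1, -, -, h2⟩
  · rw [h1]; omega
  · rw [h2, encSize_cons]
    have := encSize_mem h1
    simp only [Polynomial.eval_add, Polynomial.eval_one]
    omega

theorem erase_eq {δ : Type} [DecidableEq δ] [BEq δ] [LawfulBEq δ] (l : List δ) (a : δ) : l.erase a =
    (l.takeWhile fun y => !decide (y = a)) ++ (l.dropWhile fun y => !decide (y = a)).tail := by
  induction l with
  | nil => rfl
  | cons b l ih => by_cases h : b = a <;> simp [h, ih]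

@[fun_prop]
theorem reverseArc {s : α → List (ℕ × ℕ) × ℕ} {a : α → ℕ × ℕ} (hs : PolyFun s) (ha : PolyFun a) :
    PolyFun fun x => MetroLine.reverseArc (s x) (a x) := by
  have : (fun x => MetroLine.reverseArc (s x) (a x)) = fun x =>
      _root_.cond (decide ((a x).2 = (s x).2)) (((a x).2, (a x).1) ::
        (((s x).1.takeWhile fun y => !(decide (y.1 = (a x).1) && decide (y.2 = (a x).2))) ++
        ((s x).1.dropWhile fun y => !(decide (y.1 = (a x).1) && decide (y.2 = (a x).2))).tail),
        (a x).1) (s x) := by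
    funext x
    rw [MetroLine.reverseArc, erase_eq]
    have : (fun y : ℕ × ℕ => !decide (y = a x)) =
        fun y => !(decide (y.1 = (a x).1) && decide (y.2 = (a x).2)) := by
      funext y; rw [Bool.eq_iff_iff]; simp [Prod.ext_iff]
    rw [this]
    by_cases h : (a x).2 = (s x).2 <;> simp [h]
  rw [this]; fun_prop

theorem encSize_reverseArc (s : List (ℕ × ℕ) × ℕ) (a : ℕ × ℕ) :
    encSize (MetroLine.reverseArc s a) ≤ encSize s + 2 * encSize a := by
  obtain ⟨E, v⟩ := s
  rw [MetroLine.reverseArc]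
  split
  · have h : encSize (E.erase a) ≤ encSize E := by
      by_cases ha : a ∈ E
      · rw [encSize_perm (List.perm_cons_erase ha), encSize_cons]; omega
      · rw [List.erase_of_not_mem ha]
    simp only [encSize_prod, encSize_cons, encSize_nat] at *
    omega
  · omega

theorem augment (hE : PolyFun E) (hc : PolyFun c) (hd : PolyFun d) :
    PolyFun fun x => MetroLine.augment (c x) (d x) (E x) := by
  have h := searchTree hE hc
  obtain ⟨q, hq⟩ := h.size_le
  refine ite (by fun_prop) (fst (foldl_growth (step := fun _ s a => MetroLine.reverseArc s a)
    (by fun_prop) (by fun_prop) h (2 * q) ?_)) hE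
  intro x s a ha
  have h1 := encSize_reverseArc s a
  have h2 := encSize_mem ha
  have h3 := hq x
  simp only [Polynomial.eval_mul, Polynomial.eval_ofNat]
  omega

/-- Augmenting only reverses arcs and permutes the list, which does not change its size, so the
iteration in `minCut` has bounded values. -/
theorem encSize_augment (c d : ℕ) (E : List (ℕ × ℕ)) :
    encSize (MetroLine.augment c d E) = encSize E := by
  rw [MetroLine.augment]
  split
  · have key : ∀ (T E : List (ℕ × ℕ)) (v : ℕ), IsSearchTree E c T →
        encSize (T.foldl MetroLine.reverseArc (E, v)).1 = encSize E := by
      intro T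
      induction T with
      | nil => intros; rfl
      | cons a T ih =>
        intro E v hT
        rw [List.foldl_cons]
        by_cases h : a.2 = v
        · have h1 : MetroLine.reverseArc (E, v) a = ((a.2, a.1) :: E.erase a, a.1) := by
            simp [MetroLine.reverseArc, h]
          rw [h1, ih _ _ hT.of_erase, encSize_cons, encSize_perm (List.perm_cons_erase hT.1),
            encSize_cons]
          simp only [encSize_prod]
          omega
        · have h1 : MetroLine.reverseArc (E, v) a = (E, v) := by simp [MetroLine.reverseArc, h]
          rw [h1, ih _ _ hT.2.2.2]
    exact key _ _ _ isSearchTree_searchTree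
  · rfl

theorem minCut (hE : PolyFun E) (hc : PolyFun c) (hd : PolyFun d) :
    PolyFun fun x => MetroLine.minCut (c x) (d x) (E x) := by
  obtain ⟨q, hq⟩ := hE.size_le
  refine reached hc (searchTree (iterate_growth
    (step := fun x A => MetroLine.augment (c x) (d x) A)
    (augment (by fun_prop) (by fun_prop) (by fun_prop)) hE (by fun_prop) 0 fun x A => ?_) hc)
  rw [encSize_augment]; simp

end MinCut

end PolyFun
end MetroLine

namespace MetroLine
open TreeEncoding (enc)

/-! ### Renaming of vertices -/

section Rename

variable {α β : Type} [DecidableEq α] [DecidableEq β] {f : α → β} (hf : Function.Injective f)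

include hf

theorem afterFirst_map (l : List α) (w : α) :
    afterFirst (l.map f) (f w) = (afterFirst l w).map f := by
  unfold afterFirst
  rw [List.dropWhile_map, List.map_tail]
  congr 3
  funext x; simp [hf.eq_iff]

omit [DecidableEq α] [DecidableEq β] in
theorem head?_map_eq_some (l : List α) (u : α) : (l.map f).head? = some (f u) ↔ l.head? = some u := by
  cases l <;> simp [hf.eq_iff]

theorem passesB_map (l : List α) (u w : α) : passesB (l.map f) (f u) (f w) = passesB l u w := by
  unfold passesB
  rw [← List.map_reverse, afterFirst_map hf, afterFirst_map hf]
  simp only [head?_map_eq_some hf]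

theorem arm_map (l : List α) (u w : α) : arm (l.map f) (f u) (f w) = (arm l u w).map f := by
  unfold arm
  rw [← List.map_reverse, afterFirst_map hf, afterFirst_map hf]
  simp only [head?_map_eq_some hf]
  split <;> rw [List.map_tail]

theorem commonPrefix_map (A B : List α) :
    commonPrefix (A.map f) (B.map f) = (commonPrefix A B).map f := by
  induction A generalizing B with
  | nil => simp [commonPrefix]
  | cons a A ih =>
    cases B with
    | nil => simp [commonPrefix]
    | cons b B => by_cases h : a = b <;> simp [commonPrefix, hf.eq_iff, h, ih]

theorem look_map (p c : α) (A B : List α) : look (f p) (f c) (A.map f) (B.map f) =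
    (f (look p c A B).1, f (look p c A B).2.1, (look p c A B).2.2.1.map f,
      (look p c A B).2.2.2.map f) := by
  induction A generalizing p c B with
  | nil => simp [look]
  | cons a A ih =>
    cases B with
    | nil => simp [look]
    | cons b B => by_cases h : a = b <;> simp [look, hf.eq_iff, h, ih]

theorem clockB_map (r : List α) (a b c : α) :
    clockB (r.map f) (f a) (f b) (f c) = clockB r a b c := by
  unfold clockB cutAt
  have : (r.map f).takeWhile (fun x => decide (x ≠ f a)) =
      (r.takeWhile fun x => decide (x ≠ a)).map f := by
    rw [List.takeWhile_map]
    congr 2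
    funext x; simp [hf.eq_iff]
  rw [this, afterFirst_map hf, ← List.map_append, afterFirst_map hf]
  simp [hf.eq_iff]

end Rename

section Rename

variable {α β : Type} {f : α → β}

theorem dirOf_map {clk : α → α → α → α → Bool} {clk' : β → β → β → β → Bool} {s t : α → Bool}
    {s' t' : β → Bool} (h : ∀ a b c d, clk' (f a) (f b) (f c) (f d) = clk a b c d)
    (hs : ∀ a, s' (f a) = s a) (ht : ∀ a, t' (f a) = t a) (r : α × α × List α × List α) :
    dirOf clk' s' t' (f r.1, f r.2.1, r.2.2.1.map f, r.2.2.2.map f) = dirOf clk s t r := by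
  obtain ⟨p, c, _ | ⟨a, A⟩, _ | ⟨b, B⟩⟩ := r <;> simp [dirOf, h, hs, ht]

theorem edgesFrom_map (f : α → ℕ) (u : α) (C : List α) :
    edgesFrom (fun y : ℕ => y) (f u) (C.map f) = edgesFrom f u C := by
  unfold edgesFrom
  rw [← List.map_cons, List.zip_map, List.map_map]
  rfl

theorem backMin_map [DecidableEq α] {f : α → ℕ} (hf : Function.Injective f) (u w : α)
    (A B A' B' : List α) : backMin (fun y : ℕ => y) (f u) (f w) (A.map f) (B.map f) (A'.map f)
      (B'.map f) = backMin f u w A B A' B' := by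
  unfold backMin
  rw [commonPrefix_map hf, commonPrefix_map hf, edgesFrom_map, edgesFrom_map]

theorem rankSort_map {r : α → α → Bool} {r' : β → β → Bool} (h : ∀ a b, r' (f a) (f b) = r a b)
    (c : List α) : rankSort r' (c.map f) = (rankSort r c).map f := by
  unfold rankSort
  rw [List.length_map, List.map_flatMap]
  congr 1
  funext k
  rw [List.filter_map]
  congr 2
  funext i
  have : ((fun j => r' j (f i)) ∘ f) = fun j => r j i := funext fun j => h j i
  simp only [Function.comp_apply, List.filter_map, List.length_map, this]

theorem conflictArc_map [DecidableEq α] [DecidableEq β] (hf : Function.Injective f)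
    {clk : α → α → α → α → Bool} {clk' : β → β → β → β → Bool}
    (h : ∀ a b c d, clk' (f a) (f b) (f c) (f d) = clk a b c d) (l : List α) (x y : ℕ)
    (r : α × α × List α × List α) :
    conflictArc clk' (l.map f) x y (f r.1, f r.2.1, r.2.2.1.map f, r.2.2.2.map f) =
      conflictArc clk l x y r := by
  unfold conflictArc
  rw [dirOf_map h (fun _ => rfl) (fun _ => rfl), dirOf_map h (fun _ => rfl) (fun _ => rfl)]
  simp only [Ne, head?_map_eq_some hf]

end Rename

/-! ### The algorithm -/

/-- The nodes of line ends in the flow network. -/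
def nodeOf (i : ℕ) (b : Bool) : ℕ := i + i + 2 + b.toNat

/-- The clockwise order of neighbours; `N` consists of the tables of neighbours and of lines. -/
def clockOf (N : List (List ℕ) × List (List ℕ)) (u a b c : ℕ) : Bool :=
  clockB (N.1.getD u []) a b c

def lineOf (N : List (List ℕ) × List (List ℕ)) (i : ℕ) : List ℕ :=
  N.2.getD i []

def readFrom (N : List (List ℕ) × List (List ℕ)) (e : ℕ × Bool) : List ℕ :=
  cond e.2 (lineOf N e.1).reverse (lineOf N e.1)

/-- Whether the line `j` contains the terminal port `(u, w)` of another line and continues. -/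
def isPassing (N : List (List ℕ) × List (List ℕ)) (i j u w : ℕ) : Bool :=
  !decide (i = j) && passesB (lineOf N j) u w && !(arm (lineOf N j) u w).isEmpty

/-- The arcs of the flow network. -/
def flowArcs (N : List (List ℕ) × List (List ℕ)) : List (ℕ × ℕ) :=
  (((List.range N.2.length ×ˢ [false, true]) ×ˢ List.range N.2.length).filter fun z =>
    isPassing N z.1.1 z.2 ((readFrom N z.1).headD 0) ((readFrom N z.1).tail.headD 0)).map fun z =>
      conflictArc (clockOf N) (lineOf N z.2) (nodeOf z.1.1 z.1.2) (nodeOf z.2 false)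
        (look ((readFrom N z.1).headD 0) ((readFrom N z.1).tail.headD 0)
          (arm (lineOf N z.2) ((readFrom N z.1).tail.headD 0) ((readFrom N z.1).headD 0))
          (arm (lineOf N z.1.1) ((readFrom N z.1).tail.headD 0) ((readFrom N z.1).headD 0)))

def endValue (N : List (List ℕ) × List (List ℕ)) (M : List ℕ) (i c : ℕ) : Bool :=
  decide (nodeOf i (!decide ((lineOf N i).head? = some c)) ∈ M)

def dirNum (N : List (List ℕ) × List (List ℕ)) (M : List ℕ) (i j u w : ℕ) : Option Bool :=
  dirOf (clockOf N) (endValue N M i) (endValue N M j)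
    (look w u (arm (lineOf N i) u w) (arm (lineOf N j) u w))

def cmpNum (N : List (List ℕ) × List (List ℕ)) (M : List ℕ) (u w i j : ℕ) : Bool :=
  chooseOrder
    (backMin (fun y : ℕ => y) u w (arm (lineOf N i) u w) (arm (lineOf N j) u w)
      (arm (lineOf N i) w u) (arm (lineOf N j) w u))
    (dirNum N M i j u w) (dirNum N M i j w u)

/-- The table of line orders for given positions `M` of the line ends. -/
def orderTable (N : List (List ℕ) × List (List ℕ)) (M : List ℕ) : List (List (List ℕ)) :=
  (List.range N.1.length).map fun u => (List.range N.1.length).map fun w =>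
    rankSort (cmpNum N M u w) ((List.range N.2.length).filter fun i => passesB (lineOf N i) u w)

def solveTable (N : List (List ℕ) × List (List ℕ)) : List (List (List ℕ)) :=
  orderTable N (minCut 0 1 (flowArcs N))

namespace PolyFun

variable {α : Type} [TreeEncoding α] {N : α → List (List ℕ) × List (List ℕ)} {M : α → List ℕ}
  {i j u w a b c : α → ℕ} {e : α → ℕ × Bool} {f : α → Bool}

@[fun_prop]
theorem nodeOf (hi : PolyFun i) (hf : PolyFun f) : PolyFun fun x => MetroLine.nodeOf (i x) (f x) := by
  unfold MetroLine.nodeOf; fun_prop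

@[fun_prop]
theorem clockOf (hN : PolyFun N) (hu : PolyFun u) (ha : PolyFun a) (hb : PolyFun b)
    (hc : PolyFun c) : PolyFun fun x => MetroLine.clockOf (N x) (u x) (a x) (b x) (c x) := by
  unfold MetroLine.clockOf; fun_prop

@[fun_prop]
theorem lineOf (hN : PolyFun N) (hi : PolyFun i) : PolyFun fun x => MetroLine.lineOf (N x) (i x) := by
  unfold MetroLine.lineOf; fun_prop

@[fun_prop]
theorem readFrom (hN : PolyFun N) (he : PolyFun e) :
    PolyFun fun x => MetroLine.readFrom (N x) (e x) := by
  unfold MetroLine.readFrom; fun_prop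

@[fun_prop]
theorem isPassing (hN : PolyFun N) (hi : PolyFun i) (hj : PolyFun j) (hu : PolyFun u)
    (hw : PolyFun w) : PolyFun fun x => MetroLine.isPassing (N x) (i x) (j x) (u x) (w x) := by
  unfold MetroLine.isPassing; fun_prop

theorem flowArcs (hN : PolyFun N) : PolyFun fun x => MetroLine.flowArcs (N x) := by
  unfold MetroLine.flowArcs
  refine map (f := fun x (z : (ℕ × Bool) × ℕ) => MetroLine.conflictArc (MetroLine.clockOf (N x))
    (MetroLine.lineOf (N x) z.2) (MetroLine.nodeOf z.1.1 z.1.2) (MetroLine.nodeOf z.2 false)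
        (MetroLine.look ((MetroLine.readFrom (N x) z.1).headD 0)
          ((MetroLine.readFrom (N x) z.1).tail.headD 0)
          (MetroLine.arm (MetroLine.lineOf (N x) z.2)
            ((MetroLine.readFrom (N x) z.1).tail.headD 0) ((MetroLine.readFrom (N x) z.1).headD 0))
          (MetroLine.arm (MetroLine.lineOf (N x) z.1.1)
            ((MetroLine.readFrom (N x) z.1).tail.headD 0)
            ((MetroLine.readFrom (N x) z.1).headD 0)))) ?_ (by fun_prop)
  exact conflictArc (by fun_prop) (by fun_prop) (by fun_prop) (by fun_prop) (by fun_prop)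

@[fun_prop]
theorem endValue (hN : PolyFun N) (hM : PolyFun M) (hi : PolyFun i) (hc : PolyFun c) :
    PolyFun fun x => MetroLine.endValue (N x) (M x) (i x) (c x) := by
  have h := head?_eq_some (lineOf hN hi) hc
  unfold MetroLine.endValue; fun_prop

@[fun_prop]
theorem dirNum (hN : PolyFun N) (hM : PolyFun M) (hi : PolyFun i) (hj : PolyFun j) (hu : PolyFun u)
    (hw : PolyFun w) : PolyFun fun x => MetroLine.dirNum (N x) (M x) (i x) (j x) (u x) (w x) := by
  unfold MetroLine.dirNum
  exact dirOf (by fun_prop) (by fun_prop) (by fun_prop) (by fun_prop)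

@[fun_prop]
theorem cmpNum (hN : PolyFun N) (hM : PolyFun M) (hu : PolyFun u) (hw : PolyFun w) (hi : PolyFun i)
    (hj : PolyFun j) : PolyFun fun x => MetroLine.cmpNum (N x) (M x) (u x) (w x) (i x) (j x) := by
  unfold MetroLine.cmpNum
  exact chooseOrder (backMin (by fun_prop) (by fun_prop) (by fun_prop) (by fun_prop) (by fun_prop)
    (by fun_prop)) (by fun_prop) (by fun_prop)

theorem orderTable (hN : PolyFun N) (hM : PolyFun M) :
    PolyFun fun x => MetroLine.orderTable (N x) (M x) := by
  unfold MetroLine.orderTable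
  refine map (f := fun x u => (List.range (N x).1.length).map fun w =>
    MetroLine.rankSort (MetroLine.cmpNum (N x) (M x) u w)
      ((List.range (N x).2.length).filter fun i =>
        MetroLine.passesB (MetroLine.lineOf (N x) i) u w)) ?_ (by fun_prop)
  refine map (f := fun (z : α × ℕ) w =>
    MetroLine.rankSort (MetroLine.cmpNum (N z.1) (M z.1) z.2 w)
      ((List.range (N z.1).2.length).filter fun i =>
        MetroLine.passesB (MetroLine.lineOf (N z.1) i) z.2 w)) ?_ (by fun_prop)
  exact rankSort (by fun_prop) (by fun_prop)

theorem solveTable : PolyFun solveTable :=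
  orderTable id' (minCut (flowArcs id') (const 0) (const 1))

end PolyFun
end MetroLine

/-! ### Correctness of the algorithm on encoded instances -/

namespace MetroLine
open TreeEncoding (enc)

namespace Network

variable {I : Network} {i j k : Fin I.numLines} {u w v z a b c : Fin I.n}

/-- The tables of neighbours and of lines. -/
def tables (I : Network) : List (List ℕ) × List (List ℕ) :=
  (List.ofFn fun u => (I.rot u).map Fin.val, List.ofFn fun i => (I.line i).map Fin.val)

theorem flatMap_val {n : ℕ} (l : List (Fin n)) :
    (l.flatMap fun a => [a.val]) = l.map Fin.val := by
  induction l with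
  | nil => rfl
  | cons a l ih => simp [List.flatMap_cons, ih]

theorem enc_tables (I : Network) : enc I.tables = I.encode := by
  simp only [tables, encode, enc, List.map_ofFn]
  congr 3 <;> funext x <;>
    simp only [Function.comp_def, List.bind_eq_flatMap, List.pure_def, flatMap_val, List.map_map]

theorem lineOf_tables (i : Fin I.numLines) : lineOf I.tables i = (I.line i).map Fin.val := by
  simp [lineOf, tables, List.getD_eq_getElem?_getD]

theorem clockOf_tables : clockOf I.tables u a b c = clock u a b c := by
  have : I.tables.1.getD u [] = (I.rot u).map Fin.val := by
    simp [tables, List.getD_eq_getElem?_getD]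
  rw [clockOf, this, clockB_map Fin.val_injective, clock]

theorem arm_tables : MetroLine.arm (lineOf I.tables i) u w = (I.arm i u w).map Fin.val := by
  rw [lineOf_tables, arm_map Fin.val_injective]; rfl

theorem nodeOf_eq (i : Fin I.numLines) (b : Bool) : nodeOf i b = endNode (I := I) (i, b) := rfl

theorem endValue_tables (M : List ℕ) :
    endValue I.tables M i c = endVal (I.assignment M) i c := by
  rw [endValue, endVal, assignment, nodeOf_eq, lineOf_tables]
  simp only [head?_map_eq_some Fin.val_injective, decide_not]

theorem dirNum_tables (M : List ℕ) :
    dirNum I.tables M i j u w = dir (I.assignment M) i j u w := by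
  rw [dirNum, arm_tables, arm_tables, look_map Fin.val_injective]
  exact dirOf_map (f := Fin.val) (fun a b c d => clockOf_tables) (fun c => endValue_tables M)
    (fun c => endValue_tables M) _

theorem cmpNum_tables (M : List ℕ) :
    cmpNum I.tables M u w i j = cmp (I.assignment M) i j u w := by
  rw [cmpNum, cmp, dirNum_tables, dirNum_tables, arm_tables, arm_tables, arm_tables, arm_tables,
    backMin_map Fin.val_injective]

theorem range_eq (n : ℕ) : List.range n = (List.finRange n).map Fin.val := by
  rw [List.map_coe_finRange_eq_range]

theorem orderTable_tables (M : List ℕ) : orderTable I.tables M =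
    List.ofFn fun u => List.ofFn fun w => (layoutOf (I.assignment M) u w).map Fin.val := by
  have h1 : I.tables.1.length = I.n := by simp [tables]
  have h2 : I.tables.2.length = I.numLines := by simp [tables]
  rw [orderTable, h1, h2, range_eq, range_eq, List.map_map, List.ofFn_eq_map]
  refine List.map_congr_left fun u _ => ?_
  simp only [Function.comp_apply]
  rw [List.map_map, List.ofFn_eq_map]
  refine List.map_congr_left fun w _ => ?_
  simp only [Function.comp_apply]
  rw [List.filter_map, layoutOf, rankSort_map fun i j => cmpNum_tables M]
  congr 3
  funext i
  rw [Function.comp_apply, lineOf_tables, passesB_map Fin.val_injective]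

theorem enc_orderTable (M : List ℕ) :
    enc (orderTable I.tables M) = encodeOrders (layoutOf (I.assignment M)) := by
  rw [orderTable_tables, encodeOrders]
  simp only [enc, List.map_ofFn, Function.comp_def, List.map_map, List.bind_eq_flatMap,
    List.pure_def, flatMap_val]

theorem readFrom_tables (e : I.LineEnd) :
    readFrom I.tables (e.1, e.2) = (I.fromEnd e).map Fin.val := by
  obtain ⟨i, b⟩ := e
  simp only [readFrom, lineOf_tables, fromEnd, directed]
  cases b <;> simp

theorem exists_isPortOf (e : I.LineEnd) : ∃ u w, I.IsPortOf e u w := by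
  have h := I.two_le_length e.1
  have h' : 2 ≤ (I.fromEnd e).length := by
    unfold fromEnd directed; split <;> simpa
  match hl : I.fromEnd e, h' with
  | u :: w :: l, _ => exact ⟨u, w, l, by rw [hl]; rfl⟩

theorem IsPortOf.readFrom_tables {e : I.LineEnd} (h : I.IsPortOf e u w) :
    (readFrom I.tables (e.1, e.2)).headD 0 = u ∧ (readFrom I.tables (e.1, e.2)).tail.headD 0 = w := by
  obtain ⟨l, hl⟩ := h
  rw [Network.readFrom_tables, ← hl]
  exact ⟨rfl, rfl⟩

theorem isPassing_tables : isPassing I.tables i j u w = true ↔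
    i ≠ j ∧ I.Passes j u w ∧ I.arm j u w ≠ [] := by
  rw [isPassing, arm_tables, lineOf_tables, passesB_map Fin.val_injective]
  simp only [Bool.and_eq_true, Bool.not_eq_true', decide_eq_false_iff_not,
    passesB_eq_true_iff (I.nodup_line j), List.isEmpty_map, ← Fin.ext_iff, Passes]
  rw [List.isEmpty_eq_false_iff]
  tauto

/-- There is one arc for each line end and each line passing through its terminal port, and it is
cut exactly if the pair belongs to `pairSet`. -/
theorem outArcs_flowArcs (hI : I.IsProper) {X : ℕ → Bool} (h0 : X 0 = true) (h1 : X 1 = false) :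
    outArcs (flowArcs I.tables) X = cost fun e : I.LineEnd => X (endNode e) := by
  classical
  have h2 : I.tables.2.length = I.numLines := by simp [tables]
  set s : I.LineEnd → Bool := fun e => X (endNode e) with hs
  rw [← ncard_pairSet hI, outArcs, flowArcs, List.countP_map, List.countP_filter, h2,
    List.countP_eq_length_filter]
  set p : (ℕ × Bool) × ℕ → Bool := fun z => _ with hp
  have hn : ((List.range I.numLines ×ˢ [false, true]) ×ˢ List.range I.numLines).Nodup :=
    (List.nodup_range.product (by decide)).product List.nodup_range
  rw [← List.toFinset_card_of_nodup (hn.filter _), ← Set.ncard_coe_finset]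
  set g : I.LineEnd × Fin I.numLines → (ℕ × Bool) × ℕ := fun x => ((x.1.1, x.1.2), x.2) with hg
  have hgi : Function.Injective g := by
    rintro ⟨⟨i, b⟩, j⟩ ⟨⟨i', b'⟩, j'⟩ h
    simp only [hg, Prod.mk.injEq] at h
    obtain ⟨⟨e1, e2⟩, e3⟩ := h
    rw [Fin.ext e1, e2, Fin.ext e3]
  rw [← Set.ncard_image_of_injective _ hgi]
  congr 1
  have key : ∀ e j, p (g (e, j)) = true ↔ (e, j) ∈ pairSet s := by
    intro e j
    obtain ⟨u, w, he⟩ := exists_isPortOf e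
    obtain ⟨r1, r2⟩ := he.readFrom_tables
    simp only [hp, hg, Function.comp_apply, r1, r2]
    rw [Bool.and_eq_true, isPassing_tables, arm_tables, arm_tables, look_map Fin.val_injective,
      lineOf_tables, conflictArc_map Fin.val_injective (fun a b c d => clockOf_tables), nodeOf_eq,
      nodeOf_eq]
    constructor
    · rintro ⟨h, h3, h4, h5⟩
      rw [conflictArc_cut_iff hI h0 h1 (fun _ => rfl) he h3 h4] at h
      exact ⟨h3, u, w, he, h4, h5, h⟩
    · rintro ⟨h3, u', w', he', h4, h5, h⟩
      have e1 := he.spec.2.2.1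
      rw [he'.spec.2.2.1] at e1
      simp only [List.cons.injEq] at e1
      obtain ⟨rfl, rfl, -⟩ := e1
      exact ⟨(conflictArc_cut_iff hI h0 h1 (fun _ => rfl) he h3 h4).2 h, h3, h4, h5⟩
  ext ⟨⟨i, b⟩, j⟩
  simp only [List.coe_toFinset, List.mem_filter, Set.mem_ofPred_eq, Set.mem_image]
  constructor
  · rintro ⟨hm, hz⟩
    obtain ⟨hm1, hm2⟩ := List.pair_mem_product.1 hm
    exact ⟨((⟨i, List.mem_range.1 (List.pair_mem_product.1 hm1).1⟩, b),
      ⟨j, List.mem_range.1 hm2⟩), (key _ _).1 hz, rfl⟩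
  · rintro ⟨⟨e, k⟩, h, h'⟩
    rw [← key] at h
    rw [h'] at h
    refine ⟨?_, h⟩
    rw [← h']
    exact List.pair_mem_product.2 ⟨List.pair_mem_product.2 ⟨List.mem_range.2 e.1.2, by simp⟩,
      List.mem_range.2 k.2⟩

theorem exists_layout (I : Network) (hI : I.IsProper) :
    ∃ s : I.LineEnd → Bool, Good s ∧ (∀ s' : I.LineEnd → Bool, cost s ≤ cost s') ∧
      enc (solveTable I.tables) = encodeOrders (layoutOf s) := by
  obtain ⟨h1, h2⟩ := minCut_optimal hI fun X h0 h1 => outArcs_flowArcs hI h0 h1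
  exact ⟨_, h1, h2, enc_orderTable _⟩

theorem exists_program : ∃ (p : Prog) (q : Polynomial ℕ), ∀ I : Network, I.IsProper →
    ∃ (π : I.Orders) (t : ℕ), IsOptimal π ∧ Runs p I.encode (encodeOrders π) t ∧
      t ≤ q.eval I.encode.size := by
  obtain ⟨p, q, h⟩ := PolyFun.solveTable
  refine ⟨p, q, fun I hI => ?_⟩
  obtain ⟨s, h1, h2, h3⟩ := exists_layout I hI
  obtain ⟨t, h4, h5⟩ := h I.tables
  rw [h3] at h4
  rw [encSize] at h5
  rw [enc_tables] at h4 h5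
  exact ⟨layoutOf s, t, isOptimal_layoutOf hI h1 h2, h4, h5⟩

end Network
end MetroLine

namespace MetroLine
namespace Network

variable {I : Network} {i j k : Fin I.numLines} {u w v z : Fin I.n} {s : I.LineEnd → Bool}
  {e e' : I.LineEnd} {top : I.Sides} {S : I.ConflictVertex → Bool} {π : I.Orders}

/-! ### Cuts of the conflict graph -/

theorem IsPortOf.unique (h : I.IsPortOf e u w) (h' : I.IsPortOf e v z) : v = u ∧ z = w := by
  have e1 := h.spec.2.2.1
  rw [h'.spec.2.2.1] at e1
  exact ⟨(List.cons.inj e1).1, (List.cons.inj (List.cons.inj e1).2).1⟩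

/-- Whether the top side of the terminal port of `e` is the initial end. -/
noncomputable def topAt (top : I.Sides) (e : I.LineEnd) : Bool :=
  top (exists_isPortOf e).choose (exists_isPortOf e).choose_spec.choose

theorem IsPortOf.topAt_eq (h : I.IsPortOf e u w) : topAt top e = top u w := by
  obtain ⟨h1, h2⟩ := h.unique (exists_isPortOf e).choose_spec.choose_spec
  exact congrArg₂ top h1 h2

/-- The positions of the line ends that are given by a partition of the conflict graph. -/
noncomputable def positions (top : I.Sides) (S : I.ConflictVertex → Bool) : I.LineEnd → Bool :=
  fun e => S (.var e) == topAt top e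

theorem hasClause_iff {b : Bool} : HasClause top e j b ↔ I.OneEndConflict e j (b == topAt top e) := by
  constructor
  · rintro ⟨u, w, h, h'⟩
    rwa [h.topAt_eq]
  · intro h
    obtain ⟨u, w, h'⟩ := exists_isPortOf e
    exact ⟨u, w, h', by rwa [h'.topAt_eq] at h⟩

theorem TopsAligned.topAt_ne (ht : TopsAligned top) (h : I.TwoEndConflict e e') :
    topAt top e ≠ topAt top e' := by
  obtain ⟨u, w, h1⟩ := exists_isPortOf e
  obtain ⟨v, z, h2⟩ := exists_isPortOf e'
  rw [h1.topAt_eq, h2.topAt_eq]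
  exact ht e e' u w v z h h1 h2

/-- The colour of a line end is the top bit of its port; alignment says precisely that the two ends
of a two-variable formula differ in it. -/
theorem TopsAligned.almostBipartite (ht : TopsAligned top) :
    AlmostBipartite (conflictGraph top) ConflictVertex.b ConflictVertex.t := by
  classical
  refine ⟨fun x => match x with
    | .var e => topAt top e
    | _ => false, fun x hx => ?_⟩
  simp only [conflictGraph, Multiset.mem_add, Multiset.mem_map, Finset.mem_val, Finset.mem_filter,
    Finset.mem_univ, true_and] at hx
  rcases hx with (⟨y, ⟨-, h⟩, rfl⟩ | ⟨y, -, rfl⟩) | ⟨y, -, rfl⟩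
  · right; right
    rw [Sym2.map_mk, Sym2.mk_isDiag_iff]
    exact ht.topAt_ne h
  · left; simp
  · right; left; simp

/-- `twoSet` puts the end with value `true` first, whereas the edges of the conflict graph put the
smaller line first. -/
theorem ncard_twoSet : (twoSet s).ncard =
    {x : I.LineEnd × I.LineEnd | x.1.1 < x.2.1 ∧ I.TwoEndConflict x.1 x.2 ∧ s x.1 ≠ s x.2}.ncard := by
  have h1 : twoSet s = {x | x.1.1 < x.2.1 ∧ I.TwoEndConflict x.1 x.2 ∧ s x.1 = true ∧
      s x.2 = false} ∪ Prod.swap '' {x | x.1.1 < x.2.1 ∧ I.TwoEndConflict x.1 x.2 ∧ s x.1 = false ∧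
      s x.2 = true} := by
    ext ⟨x, y⟩
    simp only [twoSet, Set.mem_ofPred_eq, Set.mem_union, Set.image_swap_eq_preimage_swap,
      Set.mem_preimage, Prod.swap_prod_mk]
    constructor
    · rintro ⟨h, hx, hy⟩
      rcases lt_or_gt_of_ne h.1 with h' | h'
      · exact Or.inl ⟨h', h, hx, hy⟩
      · exact Or.inr ⟨h', h.symm, hy, hx⟩
    · rintro (⟨-, h⟩ | ⟨-, h, hy, hx⟩)
      · exact h
      · exact ⟨h.symm, hx, hy⟩
  have h2 : {x : I.LineEnd × I.LineEnd | x.1.1 < x.2.1 ∧ I.TwoEndConflict x.1 x.2 ∧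
      s x.1 ≠ s x.2} = {x | x.1.1 < x.2.1 ∧ I.TwoEndConflict x.1 x.2 ∧ s x.1 = true ∧
      s x.2 = false} ∪ {x | x.1.1 < x.2.1 ∧ I.TwoEndConflict x.1 x.2 ∧ s x.1 = false ∧
      s x.2 = true} := by
    ext ⟨x, y⟩
    simp only [Set.mem_ofPred_eq, Set.mem_union]
    rcases s x with _ | _ <;> rcases s y with _ | _ <;> simp
  rw [h1, h2, Set.ncard_union_eq _ (Set.toFinite _) (Set.toFinite _),
    Set.ncard_union_eq _ (Set.toFinite _) (Set.toFinite _),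
    Set.ncard_image_of_injective _ Prod.swap_injective]
  · rw [Set.disjoint_left]
    rintro x ⟨-, -, h, -⟩ ⟨-, -, h', -⟩
    rw [h] at h'; cases h'
  · rw [Set.disjoint_left]
    rintro x ⟨h, -⟩ ⟨y, ⟨h', -⟩, rfl⟩
    exact lt_asymm h h'

theorem ncard_oneSet : (oneSet s false).ncard + (oneSet s true).ncard =
    {x : I.LineEnd × Fin I.numLines | I.OneEndConflict x.1 x.2 !s x.1}.ncard := by
  rw [← Set.ncard_union_eq _ (Set.toFinite _) (Set.toFinite _)]
  · congr 1
    ext ⟨x, j⟩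
    simp only [oneSet, Set.mem_union, Set.mem_ofPred_eq]
    rcases s x with _ | _ <;> simp
  · rw [Set.disjoint_left]
    rintro x ⟨-, h⟩ ⟨-, h'⟩
    rw [h] at h'; cases h'

/-- Passing from sides to initial ends negates exactly one end of each two-variable formula, so its
edge is uncut if and only if the positions differ. An edge at `b` or `t` is uncut if and only if the
line end is not on the side that its clause demands. -/
theorem uncut_conflictGraph (ht : TopsAligned top)
    (hS : IsCut ConflictVertex.b ConflictVertex.t S) :
    uncut (conflictGraph top) S = cost (positions top S) := by
  classical
  have card : ∀ {β : Type} [Fintype β] (p : β → Prop) [DecidablePred p]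
      (f : β → Sym2 I.ConflictVertex),
      (((Finset.univ.filter p).val.map f).filter fun e => (e.map S).IsDiag).card =
        {x | p x ∧ ((f x).map S).IsDiag}.ncard := by
    intro β _ p _ f
    rw [Multiset.filter_map, Multiset.card_map, ← Finset.filter_val, Finset.card_val,
      ← Set.ncard_coe_finset]
    congr 1
    ext x; simp
  rw [uncut, conflictGraph, Multiset.filter_add, Multiset.filter_add, Multiset.card_add,
    Multiset.card_add, card, card, card, cost, add_assoc, add_assoc, ncard_twoSet, ncard_oneSet,
    ← Set.ncard_union_eq _ (Set.toFinite _) (Set.toFinite _)]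
  · congr 2
    · ext ⟨x, y⟩
      simp only [Sym2.map_mk, Sym2.mk_isDiag_iff, Set.mem_ofPred_eq, and_assoc]
      refine and_congr_right fun _ => and_congr_right fun h => ?_
      have := ht.topAt_ne h
      simp only [positions]
      revert this
      rcases S (.var x) with _ | _ <;> rcases S (.var y) with _ | _ <;>
        rcases topAt top x with _ | _ <;> rcases topAt top y with _ | _ <;> simp
    · ext ⟨x, j⟩
      simp only [Sym2.map_mk, Sym2.mk_isDiag_iff, Set.mem_ofPred_eq, Set.mem_union, hasClause_iff,
        hS.1, hS.2, positions]
      rcases S (.var x) with _ | _ <;> rcases topAt top x with _ | _ <;> simp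
  · rw [Set.disjoint_left]
    rintro x ⟨-, h⟩ ⟨-, h'⟩
    simp only [Sym2.map_mk, Sym2.mk_isDiag_iff, hS.1, hS.2] at h h'
    rw [← h] at h'; cases h'

theorem describedBy_iff (hI : I.IsLayout π) :
    DescribedBy (positions top S) π ↔ Describes top S π := by
  have key : ∀ {i j u w}, I.Passes i u w → I.Passes j u w → I.arm i u w = [] → I.arm j u w ≠ [] →
      ([j, i].Sublist (π u w) ↔ ¬ [i, j].Sublist (π u w)) := by
    intro i j u w hi hj h h'
    exact (pair_sublist_not_iff (hI u w).1 (((hI u w).2 i).2 hi) (((hI u w).2 j).2 hj)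
      (by rintro rfl; exact h' h)).symm
  constructor
  · intro h x u w hx j hj hju
    obtain ⟨h1, h2, -, h3⟩ := hx.spec
    have h4 := ((hI u w).2 j).1 hj
    rw [h4.isIntermediate_iff] at hju
    have h5 := h x.1 j u w h1 h4 h2 hju
    rw [key h1 h4 h2 hju, h5, h3, positions, hx.topAt_eq, beq_iff_eq]
    split <;> assumption
  · intro h i j u w hi hj h1 h2
    have hx := isPortOf_endAt hi h1
    have h3 := h _ u w hx j (((hI u w).2 j).2 hj) (hj.isIntermediate_iff.2 h2)
    change if _ then [i, j].Sublist _ else [j, i].Sublist _ at h3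
    rw [key hi hj h1 h2] at h3
    rw [positions, hx.topAt_eq, beq_iff_eq]
    split at h3 <;> tauto

/-- The cut given by positions of the line ends. -/
noncomputable def cutOf (top : I.Sides) (s : I.LineEnd → Bool) : I.ConflictVertex → Bool
  | .b => false
  | .t => true
  | .var e => s e == topAt top e

theorem isCut_cutOf : IsCut ConflictVertex.b ConflictVertex.t (cutOf top s) := ⟨rfl, rfl⟩

theorem positions_cutOf : positions top (cutOf top s) = s := by
  funext e
  simp only [positions, cutOf]
  rcases s e with _ | _ <;> rcases topAt top e with _ | _ <;> rfl

/-- The maps `positions` and `cutOf` identify cuts with position assignments, descriptions with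
descriptions, and numbers of uncut edges with costs. -/
theorem TopsAligned.minUncutSolves (hI : I.IsProper) (ht : TopsAligned top) :
    MinUncutSolves top := by
  refine ⟨fun π hπ => ⟨?_, fun S hS hd => ?_⟩, fun S hS => ?_⟩
  · obtain ⟨s, hs⟩ := hπ.exists_describedBy
    refine ⟨cutOf top s, isCut_cutOf, ?_⟩
    rwa [← describedBy_iff hπ.1, positions_cutOf]
  · rw [uncut_conflictGraph ht hS]
    exact hπ.le_crossings hI ((describedBy_iff hπ.1).2 hd)
  -- One optimal layout serves for all minimum cuts, since their numbers of uncut edges all equal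
  -- the minimum of `cost`.
  · obtain ⟨s, h1, h2, -⟩ := exists_layout I hI
    refine ⟨layoutOf s, isOptimal_layoutOf hI h1 h2, ?_⟩
    rw [crossings_layoutOf hI h1 h2]
    congr 1
    refine le_antisymm ?_ ?_
    · rw [uncut_conflictGraph ht hS.1]; exact h2 _
    · have := hS.2 _ (isCut_cutOf (top := top) (s := s))
      rwa [uncut_conflictGraph ht isCut_cutOf, positions_cutOf] at this

end Network
end MetroLine

/-! ### Consistent line directions -/

namespace MetroLine

/-- The first and the last two vertices of a subpath of a path have opposite directions. -/
theorem decide_infix_ne {α : Type} {l P : List α} {u w v z : α} (hl : l.Nodup) (hP : Subpath P l)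
    (hu : [u, w] <+: P) (hv : [v, z] <+: P.reverse) [Decidable ([u, w] <:+: l)]
    [Decidable ([v, z] <:+: l)] : decide ([u, w] <:+: l) ≠ decide ([v, z] <:+: l) := by
  classical
  have key : ∀ {Q : List α} {a b}, [a, b] <:+: Q → ¬ [a, b] <:+: Q.reverse ∨ ¬ Q.Nodup := by
    intro Q a b h
    by_contra! h'
    have h2 : [b, a].Sublist Q := by
      have := (List.reverse_infix.2 h'.1).sublist
      simpa using this
    exact pair_sublist_asymm h'.2 h.sublist h2
  rcases hP with hP | hP
  · have h1 : [u, w] <:+: l := hu.isInfix.trans hP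
    have h2 : [v, z] <:+: l.reverse := hv.isInfix.trans (List.reverse_infix.2 hP)
    have h3 : ¬ [v, z] <:+: l := by
      rcases key h2 with h | h
      · simpa using h
      · exact absurd (List.nodup_reverse.2 hl) h
    simp [h1, h3]
  · have h1 : [v, z] <:+: l := hv.isInfix.trans hP
    have h2 : [u, w] <:+: l.reverse := by
      have := List.reverse_infix.2 hP
      rw [List.reverse_reverse] at this
      exact hu.isInfix.trans this
    have h3 : ¬ [u, w] <:+: l := by
      rcases key h2 with h | h
      · simpa using h
      · exact absurd (List.nodup_reverse.2 hl) h
    simp [h1, h3]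

/-- A path on which consecutive values differ by one is monotone. -/
theorem monotone_of_chain {α : Type} {f : α → ℤ} {l : List α}
    (h : l.IsChain fun a b => f a + 1 = f b ∨ f b + 1 = f a) (hn : (l.map f).Nodup) :
    l.Pairwise (fun a b => f a < f b) ∨ l.Pairwise (fun a b => f b < f a) := by
  induction l with
  | nil => exact Or.inl .nil
  | cons a l ih =>
    rcases l with _ | ⟨b, l⟩
    · exact Or.inl (List.pairwise_singleton _ _)
    · rw [List.map_cons, List.nodup_cons] at hn
      have hab := h.rel
      rcases ih h.of_cons hn.2 with ih | ih
      · by_cases hlt : f a < f b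
        · left
          rw [List.pairwise_cons] at ih ⊢
          refine ⟨fun c hc => ?_, List.pairwise_cons.2 ih⟩
          rcases List.mem_cons.1 hc with rfl | hc
          · exact hlt
          · exact hlt.trans (ih.1 c hc)
        · rcases l with _ | ⟨c, l⟩
          · right
            simp only [List.pairwise_cons, List.mem_singleton, forall_eq, List.not_mem_nil,
              false_imp_iff, implies_true, List.Pairwise.nil, and_true]
            omega
          · exfalso
            have hbc := h.of_cons.rel
            have h1 := (List.pairwise_cons.1 ih).1 c (by simp)
            have h2 : f a ≠ f c := fun h' => hn.1 (by simp [h'])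
            omega
      · by_cases hlt : f b < f a
        · right
          rw [List.pairwise_cons] at ih ⊢
          refine ⟨fun c hc => ?_, List.pairwise_cons.2 ih⟩
          rcases List.mem_cons.1 hc with rfl | hc
          · exact hlt
          · exact (ih.1 c hc).trans hlt
        · rcases l with _ | ⟨c, l⟩
          · left
            simp only [List.pairwise_cons, List.mem_singleton, forall_eq, List.not_mem_nil,
              false_imp_iff, implies_true, List.Pairwise.nil, and_true]
            omega
          · exfalso
            have hbc := h.of_cons.rel
            have h1 := (List.pairwise_cons.1 ih).1 c (by simp)
            have h2 : f a ≠ f c := fun h' => hn.1 (by simp [h'])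
            omega

namespace Network

variable {I : Network} {d : Fin I.numLines → Bool}

theorem nodup_directed (i : Fin I.numLines) (b : Bool) : (I.directed i b).Nodup := by
  unfold directed; split
  · exact List.nodup_reverse.2 (I.nodup_line i)
  · exact I.nodup_line i

theorem subpath_directed_iff {i : Fin I.numLines} {b : Bool} {P : List (Fin I.n)} :
    Subpath P (I.directed i b) ↔ Subpath P (I.line i) := by
  unfold directed Subpath
  cases b
  · simp
  · simp only [if_true]
    have h1 : ∀ Q, Q <:+: (I.line i).reverse ↔ Q.reverse <:+: I.line i := fun Q => by
      rw [← List.reverse_infix, List.reverse_reverse]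
    rw [h1, h1, List.reverse_reverse]
    exact or_comm

/-- On every edge of `P` the direction of one of its lines decides about the top side. This line
runs through `P` in one direction, so it leaves the port at one end of `P` and arrives at the port
at the other. -/
theorem IsConsistent.topsAligned (hd : I.IsConsistent d) : TopsAligned (I.sidesOf d) := by
  classical
  intro x y u w v z h hx hy
  obtain ⟨-, P, u', w', v', z', hP, hu, hv, q1, q2, q3, q4, q5, q6⟩ := twoEndConflict_iff.1 h
  obtain ⟨p1, -⟩ := hP.isPortOf hu q1
  obtain ⟨p2, -⟩ := hP.comm.reverse.isPortOf hv q3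
  rw [← q5] at p1
  rw [← q6] at p2
  obtain ⟨rfl, rfl⟩ := p1.unique hx
  obtain ⟨rfl, rfl⟩ := p2.unique hy
  have hsub : Subpath P (I.directed x.1 (d x.1)) := subpath_directed_iff.2 hP.2.1
  have key : ∀ a b, I.Passes x.1 a b →
      (I.sidesOf d a b = decide ([a, b] <:+: I.directed x.1 (d x.1))) := by
    intro a b hp
    rw [sidesOf, decide_eq_decide]
    exact ⟨fun ⟨i, hi⟩ => hd _ _ i x.1 hi hp, fun h => ⟨_, h⟩⟩
  rw [key _ _ (hP.passes hu.isInfix).1, key _ _ (hP.reverse.passes hv.isInfix).1]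
  exact decide_infix_ne (nodup_directed _ _) hsub hu hv

theorem HasMonotoneLines.hasConsistentDirections (h : I.HasMonotoneLines) :
    I.HasConsistentDirections := by
  classical
  obtain ⟨x, hx⟩ := h
  have h1 : ∀ i, ∃ b, (I.directed i b).Pairwise fun u v => x u < x v := by
    intro i
    rcases hx i with h | h
    · exact ⟨false, h⟩
    · exact ⟨true, List.pairwise_reverse.2 h⟩
  choose d hd using h1
  have key : ∀ {i u v}, [u, v] <:+: I.directed i (d i) → x u < x v := fun h => by
    simpa using (hd _).sublist h.sublist
  refine ⟨d, fun u v i j hi hj => ?_⟩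
  rcases subpath_directed_iff.2 hj with h | h
  · exact h
  · exact absurd (key hi) (lt_asymm (key h))

theorem IsPathNetwork.hasMonotoneLines (h : I.IsPathNetwork) : I.HasMonotoneLines := by
  obtain ⟨g⟩ := h
  refine ⟨fun u => ((g u).val : ℝ), fun i => ?_⟩
  have h1 := monotone_of_chain (f := fun u => ((g u).val : ℤ)) (l := I.line i) ?_ ?_
  · simpa using h1
  · refine (I.isChain_line i).imp fun a b hab => ?_
    have := g.map_adj_iff.2 hab
    rw [SimpleGraph.pathGraph_adj] at this
    omega
  · refine (I.nodup_line i).map ?_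
    intro a b hab
    exact g.injective (Fin.ext (by simpa using hab))

end Network
end MetroLine

/-! ### Caterpillars -/

namespace MetroLine

section Tree

variable {V : Type} [DecidableEq V] {G : SimpleGraph V}

/-- A path of a tree whose ends lie on another path is a subpath. -/
theorem subpath_support_of_ends (hG : G.IsAcyclic) {a b u v : V} {s : G.Walk a b} (hs : s.IsPath)
    {p : G.Walk u v} (hp : p.IsPath) (hu : u ∈ s.support) (hv : v ∈ s.support) :
    Subpath p.support s.support := by
  have h := hv
  rw [← s.take_spec hu, SimpleGraph.Walk.mem_support_append_iff] at h
  rcases h with h | h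
  · right
    have h1 : ((s.takeUntil u hu).dropUntil v h).IsPath := (hs.takeUntil hu).dropUntil h
    have h2 := congrArg Subtype.val ((hG.subsingleton_path _ _).elim ⟨_, hp.reverse⟩ ⟨_, h1⟩)
    simp only at h2
    rw [← SimpleGraph.Walk.support_reverse, h2]
    exact ((s.takeUntil u hu).support_dropUntil_suffix_support h).isInfix.trans
      (s.support_takeUntil_prefix_support hu).isInfix
  · left
    have h1 : ((s.dropUntil u hu).takeUntil v h).IsPath := (hs.dropUntil hu).takeUntil h
    have h2 := congrArg Subtype.val ((hG.subsingleton_path _ _).elim ⟨_, hp⟩ ⟨_, h1⟩)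
    simp only at h2
    rw [h2]
    exact ((s.dropUntil u hu).support_takeUntil_prefix_support h).isInfix.trans
      (s.support_dropUntil_suffix_support hu).isInfix

theorem exists_path_in_support {a b u v : V} (s : G.Walk a b) (hu : u ∈ s.support)
    (hv : v ∈ s.support) : ∃ p : G.Walk u v, p.IsPath ∧ p.support ⊆ s.support := by
  refine ⟨((s.takeUntil u hu).reverse.append (s.takeUntil v hv)).toPath.1,
    ((s.takeUntil u hu).reverse.append (s.takeUntil v hv)).toPath.2, ?_⟩
  intro x hx
  have := SimpleGraph.Walk.support_toPath_subset_support _ hx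
  rw [SimpleGraph.Walk.mem_support_append_iff, SimpleGraph.Walk.support_reverse,
    List.mem_reverse] at this
  rcases this with h | h
  · exact s.support_takeUntil_subset_support hu h
  · exact s.support_takeUntil_subset_support hv h

/-- In a tree all of whose vertices are on or adjacent to a path `s`, a vertex with two neighbors is
on `s`. -/
theorem mem_support_of_two_adj (hG : G.IsAcyclic) {a b : V} (s : G.Walk a b)
    (hdom : ∀ v, v ∈ s.support ∨ ∃ w ∈ s.support, G.Adj v w) {u x y : V} (hx : G.Adj u x)
    (hy : G.Adj u y) (hxy : x ≠ y) : u ∈ s.support := by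
  by_contra hu
  obtain ⟨c, hc, huc⟩ := (hdom u).resolve_left hu
  -- Any neighbour `z` is joined to `c` without using `u`: along `s`, preceded by one edge if `z` is
  -- off `s`. Since the tree has only one path from `u` to `c`, this gives `z = c`.
  have key : ∀ z, G.Adj u z → z = c := by
    intro z hz
    have hp : (SimpleGraph.Walk.cons huc SimpleGraph.Walk.nil).IsPath := by
      simp [huc.ne]
    obtain ⟨q, hq, hqu⟩ : ∃ q : G.Walk z c, q.IsPath ∧ u ∉ q.support := by
      by_cases hzs : z ∈ s.support
      · obtain ⟨q, hq, hqs⟩ := exists_path_in_support s hzs hc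
        exact ⟨q, hq, fun h => hu (hqs h)⟩
      · obtain ⟨w, hw, hzw⟩ := (hdom z).resolve_left hzs
        obtain ⟨q, hq, hqs⟩ := exists_path_in_support s hw hc
        refine ⟨.cons hzw q, ?_, ?_⟩
        · rw [SimpleGraph.Walk.cons_isPath_iff]
          exact ⟨hq, fun h => hzs (hqs h)⟩
        · rw [SimpleGraph.Walk.support_cons, List.mem_cons]
          rintro (h | h)
          · exact hz.ne h
          · exact hu (hqs h)
    have hq' : (SimpleGraph.Walk.cons hz q).IsPath := by
      rw [SimpleGraph.Walk.cons_isPath_iff]; exact ⟨hq, hqu⟩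
    have h2 := congrArg (fun p => p.1.support) ((hG.subsingleton_path _ _).elim ⟨_, hp⟩ ⟨_, hq'⟩)
    simp only [SimpleGraph.Walk.support_cons, SimpleGraph.Walk.support_nil, List.cons.injEq,
      true_and] at h2
    have h3 : q.support.head? = some z := by cases q <;> rfl
    rw [← h2] at h3
    simpa using h3.symm
  exact hxy ((key x hx).trans (key y hy).symm)

end Tree

namespace Network

variable {I : Network} {i : Fin I.numLines} {u v w : Fin I.n}

theorem Passes.exists_two_adj (h : I.Passes i u w) (hA : I.arm i u w ≠ []) :
    ∃ a, I.graph.Adj u a ∧ a ≠ w := by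
  rcases hl : I.arm i u w with _ | ⟨a, A⟩
  · exact absurd hl hA
  · refine ⟨a, (h.step hl).1.adj.symm, ?_⟩
    rintro rfl
    have := h.nodup
    rw [hl] at this
    have := (List.nodup_append.1 this).2.2 a (by simp) a (by simp)
    exact this rfl

/-- Both terminals of a two-variable formula are intermediate stations of the other line. They
therefore have two neighbours and lie on the spine, so that `P` is part of the spine, whose
direction determines aligned tops. -/
theorem IsCaterpillar.exists_topsAligned (h : I.IsCaterpillar) : ∃ top : I.Sides, TopsAligned top := by
  classical
  obtain ⟨hT, a, b, s, hs, hdom⟩ := h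
  refine ⟨fun u w => decide ([u, w] <:+: s.support), ?_⟩
  intro x y u w v z h hx hy
  obtain ⟨-, P, u', w', v', z', hP, hu, hv, q1, q2, q3, q4, q5, q6⟩ := twoEndConflict_iff.1 h
  obtain ⟨p1, -⟩ := hP.isPortOf hu q1
  obtain ⟨p2, -⟩ := hP.comm.reverse.isPortOf hv q3
  rw [← q5] at p1
  rw [← q6] at p2
  obtain ⟨rfl, rfl⟩ := p1.unique hx
  obtain ⟨rfl, rfl⟩ := p2.unique hy
  rw [startsAt_iff_of_prefix hu] at q2
  rw [startsAt_iff_of_prefix hv] at q4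
  have m1 : u ∈ s.support := by
    obtain ⟨c, h1, h2⟩ := (hP.passes hu.isInfix).2.exists_two_adj q2
    exact mem_support_of_two_adj hT.isAcyclic s hdom h1 (hP.passes hu.isInfix).2.adj h2
  have m2 : v ∈ s.support := by
    obtain ⟨c, h1, h2⟩ := (hP.reverse.passes hv.isInfix).1.exists_two_adj q4
    exact mem_support_of_two_adj hT.isAcyclic s hdom h1 (hP.reverse.passes hv.isInfix).1.adj h2
  have hne : P ≠ [] := by rintro rfl; simp at hu
  have hchain : P.IsChain I.graph.Adj := by
    rcases hP.2.1 with h1 | h1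
    · exact (I.isChain_line _).infix h1
    · have h2 := (I.isChain_line _).infix h1
      rw [List.isChain_reverse] at h2
      exact h2.imp fun _ _ h => h.symm
  have hsup := SimpleGraph.Walk.support_ofSupport hne hchain
  have hpath : (SimpleGraph.Walk.ofSupport P hne hchain).IsPath := by
    rw [SimpleGraph.Walk.isPath_def, hsup]; exact hP.nodup
  have e1 : P.head hne = u := by
    obtain ⟨t, rfl⟩ := hu; rfl
  have e2 : P.getLast hne = v := by
    obtain ⟨t, ht⟩ := hv
    have : P.reverse.head? = some v := by rw [← ht]; rfl
    rw [List.head?_reverse, List.getLast?_eq_getLast_of_ne_nil hne] at this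
    exact Option.some.inj this
  have hsub := subpath_support_of_ends hT.isAcyclic hs hpath (by rwa [e1]) (by rwa [e2])
  rw [hsup] at hsub
  exact decide_infix_ne (SimpleGraph.Walk.isPath_def _ |>.1 hs) hsub hu hv

end Network
end MetroLine

theorem mainTheorem6 :
    -- one polynomial-time algorithm finds optimal layouts
    (∃ (p : MetroLine.Prog) (q : Polynomial ℕ), ∀ I : MetroLine.Network, I.IsProper →
      (I.HasConsistentDirections ∨ I.IsCaterpillar) →
      ∃ (π : I.Orders) (t : ℕ), MetroLine.Network.IsOptimal π ∧
        MetroLine.Runs p I.encode (MetroLine.Network.encodeOrders π) t ∧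
        t ≤ q.eval I.encode.size) ∧
    -- with the top sides given by consistent directions, the conflict graph is almost bipartite and
    -- MIN-UNCUT on it solves the problem
    (∀ I : MetroLine.Network, I.IsProper → ∀ d : Fin I.numLines → Bool, I.IsConsistent d →
      MetroLine.Network.TopsAligned (I.sidesOf d) ∧
      MetroLine.AlmostBipartite (MetroLine.Network.conflictGraph (I.sidesOf d))
        MetroLine.Network.ConflictVertex.b MetroLine.Network.ConflictVertex.t ∧
      MetroLine.Network.MinUncutSolves (I.sidesOf d)) ∧
    -- the same on caterpillars for suitable top sides
    (∀ I : MetroLine.Network, I.IsProper → I.IsCaterpillar → ∃ top : I.Sides,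
      MetroLine.Network.TopsAligned top ∧
      MetroLine.AlmostBipartite (MetroLine.Network.conflictGraph top)
        MetroLine.Network.ConflictVertex.b MetroLine.Network.ConflictVertex.t ∧
      MetroLine.Network.MinUncutSolves top) ∧
    -- networks with consistent directions: paths, and left-to-right or upward trees
    (∀ I : MetroLine.Network, I.IsPathNetwork ∨ I.HasMonotoneLines →
      I.HasConsistentDirections) := by
  obtain ⟨p, q, h⟩ := MetroLine.Network.exists_program
  refine ⟨⟨p, q, fun I hI _ => h I hI⟩, fun I hI d hd => ?_, fun I hI hc => ?_, fun I hI => ?_⟩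
  · exact ⟨hd.topsAligned, hd.topsAligned.almostBipartite, hd.topsAligned.minUncutSolves hI⟩
  · obtain ⟨top, ht⟩ := hc.exists_topsAligned
    exact ⟨top, ht, ht.almostBipartite, ht.minUncutSolves hI⟩
  · rcases hI with hI | hI
    · exact hI.hasMonotoneLines.hasConsistentDirections
    · exact hI.hasConsistentDirections
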